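/- Let $d\ge 1$ and $\mathbb R^{d+1}_+=\mathbb R^d\times(0,\infty)$. For $O\subseteq\mathbb R^d$ let the tent over $O$ be \[T(O)=\Bigl(\bigcup_{x\notin O}\{(y,t)\in\mathbb R^{d+1}_+:\|x-y\|<t\}\Bigr)^{\complement},\] the complement being taken in $\mathbb R^{d+1}_+$. For $1<p<\infty$ let $H^p(\mathbb R^{d+1}_+)$ be the space of complex-valued harmonic functions $u$ on $\mathbb R^{d+1}_+$ with $\|u\|_{H^p}:=\sup_{t>0}\|u(\cdot,t)\|_{L^p(\mathbb R^d)}<\infty$. For $\alpha>1$ and $q\in[1,\infty)$, a non-negative Borel measure $\mu$ on $\mathbb R^{d+1}_+$ is called embedding $\alpha$-Carleson (with exponent $q$) if there is a constant $M_q<\infty$ such that \[\|u\|_{L^q(\mathbb R^{d+1}_+,\mu)}\le M_q\,\|u\|_{H^{\alpha q}(\mathbb R^{d+1}_+)}\qquad\text{for all }u\in H^{\alpha q}(\mathbb R^{d+1}_+).\] The Fefferman–Stein maximal function of $\mu$ is \[\psi_\mu(x)=\sup\Bigl\{\frac{\mu(T(Q))}{|Q|}: Q\subseteq\mathbb R^d\text{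 an open axis-parallel cube with } x\in Q\Bigr\}\in[0,\infty],\qquad x\in\mathbb R^d.\] **Theorem.** Let $\alpha>1$, let $\beta$ be its conjugate exponent, $\frac1\alpha+\frac1\beta=1$, and let $q\in[1,\infty)$. A non-negative Borel measure $\mu$ on $\mathbb R^{d+1}_+$ is embedding $\alpha$-Carleson with exponent $q$ if and only if $\psi_\mu\in L^\beta(\mathbb R^d)$. In particular, the embedding $\alpha$-Carleson property does not depend on $q$. -/

import Mathlib

open MeasureTheory
open scoped ENNReal NNReal

/-- `ℝᵈ⁺¹` as the Euclidean (`ℓ²`) product `ℝᵈ × ℝ`. -/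
abbrev AmbientSpace (d : ℕ) : Type := WithLp 2 (EuclideanSpace ℝ (Fin d) × ℝ)

/-- The open half space `{(x, t) : x ∈ ℝᵈ, t > 0}`. -/
def upperHalfSpace (d : ℕ) : Set (AmbientSpace d) := {z | 0 < z.snd}

/-- The cone `Γ(x) = {(y, t) : ‖x - y‖ < t}` with vertex `x`. -/
def cone {d : ℕ} (x : EuclideanSpace ℝ (Fin d)) : Set (upperHalfSpace d) :=
  {z | ‖x - z.1.fst‖ < z.1.snd}

/-- The tent `T(O)` over `O ⊆ ℝᵈ`: the complement, in the half space, of the union of the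
cones with vertex outside `O`. -/
def tent {d : ℕ} (O : Set (EuclideanSpace ℝ (Fin d))) : Set (upperHalfSpace d) :=
  (⋃ x ∈ Oᶜ, cone x)ᶜ

/-- The open axis-parallel cube with lower corner `a` and side length `l`. -/
def openCube {d : ℕ} (a : EuclideanSpace ℝ (Fin d)) (l : ℝ) : Set (EuclideanSpace ℝ (Fin d)) :=
  {x | ∀ i, a i < x i ∧ x i < a i + l}

/-- The Fefferman-Stein maximal function: the supremum of `μ(T(Q)) / |Q|` over all (nondegenerate)
cubes `Q` that contain `x`. -/
noncomputable def feffermanSteinMaximal {d : ℕ} (μ : Measure (upperHalfSpace d))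
    (x : EuclideanSpace ℝ (Fin d)) : ℝ≥0∞ :=
  ⨆ (a : EuclideanSpace ℝ (Fin d)) (l : ℝ) (_ : 0 < l) (_ : x ∈ openCube a l),
    μ (tent (openCube a l)) / volume (openCube a l)

/-- The norm of the harmonic Hardy space: `sup_{t > 0} ‖u(·, t)‖_{Lᵖ(ℝᵈ)}`. -/
noncomputable def hardyNorm {d : ℕ} (p : ℝ≥0∞) (u : AmbientSpace d → ℂ) : ℝ≥0∞ :=
  ⨆ (t : ℝ) (_ : 0 < t),
    eLpNorm (fun x : EuclideanSpace ℝ (Fin d) => u (WithLp.toLp 2 (x, t))) p volume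

/-- Membership in the harmonic Hardy space `Hᵖ` of the half space, for `p > 1`: `u` is harmonic
in the half space and its Hardy norm is finite. Values outside the half space play no role. -/
def MemHardy {d : ℕ} (p : ℝ≥0∞) (u : AmbientSpace d → ℂ) : Prop :=
  InnerProductSpace.HarmonicOnNhd u (upperHalfSpace d) ∧ hardyNorm p u < ∞

/-- `μ` is an embedding `α`-Carleson measure, tested with the exponent `q`
(for `α > 0`, `1 ≤ q < ∞`, `α q > 1`): `‖u‖_{L^q(μ)} ≤ M ‖u‖_{H^{αq}}` for all `u ∈ H^{αq}`. -/
def IsEmbeddingCarleson {d : ℕ} (α q : ℝ) (μ : Measure (upperHalfSpace d)) : Prop :=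
  ∃ M : ℝ≥0, ∀ u : AmbientSpace d → ℂ, MemHardy (ENNReal.ofReal (α * q)) u →
    eLpNorm (fun z : upperHalfSpace d => u z) (ENNReal.ofReal q) μ
      ≤ M * hardyNorm (ENNReal.ofReal (α * q)) u

/-! Necessity. The embedding is tested on a single Poisson integral. Take finitely many levels `k`
and, for each, finitely many disjoint cubes with `μ (T Q) ≥ 2 ^ k * |Q|`. Put `ρ = 2 ^ (β - 1)` and
let `f` be the supremum over `k` of `ρ ^ (k / q)` on the union of the cubes of level `k`. Since `(β
- 1) α = β`, the integral of `f ^ (α q)` is at most `X = ∑ 2 ^ (k β) |Q|`. The Poisson integral of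
`f` is bounded below by a multiple of `ρ ^ (k / q)` on the tents of level `k`, and the geometric
growth of `ρ ^ k` makes the sum over levels comparable to its largest term. Hence `X ≤ ∑ ρ ^ k μ (T
Q) ≤ C * X ^ (1 / α)`, and as `X` is finite it is absorbed: `X ≤ C ^ β` (`sum_volume_openCube_le`).
A Vitali covering of the sets `{ψ > 2 ^ k}` turns this uniform packing bound into `ψ ∈ L ^ β`.

Sufficiency. For `u` in the Hardy space, the translate `u (·, · + ε)` is bounded
(`exists_bound_of_memHardy`), so the maximum principle bounds its modulus by the Poisson integral of
its boundary modulus (`norm_le_halfSpaceIntegral`). In the cone over `x` this is at most a multiple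
`g x` of the Hardy-Littlewood maximal function. Thus the set where the translate exceeds `t` lies in
the tent over `{g > t}`. A Vitali covering by balls gives `μ (T O) ≤ C ∫_O ψ`
(`exists_measure_tent_le`), so the layer cake formula yields `∫ |u| ^ q dμ ≤ C ∫ ψ g ^ q`. Hölder
with exponents `β, α` and the maximal theorem in `L ^ (α q)` bound this by the Hardy norm, and
Fatou's lemma removes `ε`.

The potential theory rests on one smooth radial mean: harmonicity of a continuous function is
equivalent to the mean value property for `radialWeight`. This gives harmonicity of Poisson
integrals by Fubini, and subharmonicity of `‖u‖` by the triangle inequality. -/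

open InnerProductSpace Topology Filter

set_option linter.unusedSectionVars false

/-! ### A smooth radial weight and the derivative of weighted means. -/

section RadialMollifier

variable {E F : Type*} [NormedAddCommGroup E] [InnerProductSpace ℝ E]
  [NormedAddCommGroup F] [NormedSpace ℝ F]

/-- The radial bump function `y ↦ exp (-1 / (1 - ‖y‖²))`, supported in the unit ball. -/
noncomputable def radialPotential (y : E) : ℝ := expNegInvGlue (1 - ‖y‖ ^ 2)

/-- The radial weight `φ` with `∇ radialPotential y = - φ y • y`. -/
noncomputable def radialWeight (y : E) : ℝ :=
  2 * ((1 - ‖y‖ ^ 2)⁻¹ ^ 2 * expNegInvGlue (1 - ‖y‖ ^ 2))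

lemma contDiff_radialPotential {n : ℕ∞} : ContDiff ℝ n (radialPotential : E → ℝ) :=
  expNegInvGlue.contDiff.comp (contDiff_const.sub (contDiff_norm_sq ℝ))

lemma contDiff_radialWeight {n : ℕ∞} : ContDiff ℝ n (radialWeight : E → ℝ) := by
  have h := (expNegInvGlue.contDiff_polynomial_eval_inv_mul (n := n) (Polynomial.X ^ 2)).comp
    ((contDiff_const (c := (1 : ℝ))).sub (contDiff_norm_sq ℝ (E := E)))
  have h2 := (contDiff_const (c := (2 : ℝ))).mul h
  change ContDiff ℝ n (fun y : E => radialWeight y)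
  simpa [Function.comp_def, radialWeight] using h2

lemma continuous_radialPotential : Continuous (radialPotential : E → ℝ) :=
  (contDiff_radialPotential (n := 0)).continuous

lemma continuous_radialWeight : Continuous (radialWeight : E → ℝ) :=
  (contDiff_radialWeight (n := 0)).continuous

lemma radialWeight_nonneg (y : E) : 0 ≤ radialWeight y := by
  have := expNegInvGlue.nonneg (1 - ‖y‖ ^ 2)
  unfold radialWeight; positivity

lemma radialPotential_nonneg (y : E) : 0 ≤ radialPotential y := expNegInvGlue.nonneg _

lemma radialWeight_pos {y : E} (hy : ‖y‖ < 1) : 0 < radialWeight y := by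
  have h : 0 < 1 - ‖y‖ ^ 2 := by nlinarith [norm_nonneg y]
  have := expNegInvGlue.pos_of_pos h
  unfold radialWeight; positivity

lemma radialPotential_pos {y : E} (hy : ‖y‖ < 1) : 0 < radialPotential y :=
  expNegInvGlue.pos_of_pos (by nlinarith [norm_nonneg y])

lemma radialWeight_eq_zero {y : E} (hy : 1 ≤ ‖y‖) : radialWeight y = 0 := by
  have h : 1 - ‖y‖ ^ 2 ≤ 0 := by nlinarith [norm_nonneg y]
  simp [radialWeight, expNegInvGlue.zero_of_nonpos h]

lemma radialPotential_eq_zero {y : E} (hy : 1 ≤ ‖y‖) : radialPotential y = 0 :=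
  expNegInvGlue.zero_of_nonpos (by nlinarith [norm_nonneg y])

lemma radialWeight_neg (y : E) : radialWeight (-y) = radialWeight y := by
  simp [radialWeight]

lemma fderiv_radialPotential (y e : E) :
    fderiv ℝ radialPotential y e = - (radialWeight y * inner ℝ y e) := by
  have h1 : HasDerivAt expNegInvGlue ((1 - ‖y‖ ^ 2)⁻¹ ^ 2 * expNegInvGlue (1 - ‖y‖ ^ 2))
      (1 - ‖y‖ ^ 2) := by
    have := expNegInvGlue.hasDerivAt_polynomial_eval_inv_mul 1 (1 - ‖y‖ ^ 2)
    simpa using this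
  have h2 : HasFDerivAt (fun z : E => 1 - ‖z‖ ^ 2) (-(2 • innerSL ℝ y)) y :=
    (hasStrictFDerivAt_norm_sq y).hasFDerivAt.const_sub 1
  have h3 := h1.comp_hasFDerivAt y h2
  have h4 : fderiv ℝ (radialPotential : E → ℝ) y = _ := h3.fderiv
  rw [h4]
  simp [radialWeight]
  ring

variable [FiniteDimensional ℝ E]

lemma hasCompactSupport_radialPotential : HasCompactSupport (radialPotential : E → ℝ) :=
  HasCompactSupport.intro (isCompact_closedBall (0 : E) 1) fun y hy =>
    radialPotential_eq_zero (by simpa using (not_le.1 (fun h => hy (by simpa using h))).le)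

lemma hasCompactSupport_radialWeight : HasCompactSupport (radialWeight : E → ℝ) :=
  HasCompactSupport.intro (isCompact_closedBall (0 : E) 1) fun y hy =>
    radialWeight_eq_zero (by simpa using (not_le.1 (fun h => hy (by simpa using h))).le)

variable [MeasurableSpace E] [BorelSpace E] (ν : Measure E) [ν.IsAddHaarMeasure]

lemma integrable_radialWeight_smul {g : E → F} (hg : Continuous g) :
    Integrable (fun y => radialWeight y • g y) ν :=
  (continuous_radialWeight.smul hg).integrable_of_hasCompactSupport
    hasCompactSupport_radialWeight.smul_right

lemma integrable_radialPotential_smul {g : E → F} (hg : Continuous g) :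
    Integrable (fun y => radialPotential y • g y) ν :=
  (continuous_radialPotential.smul hg).integrable_of_hasCompactSupport
    hasCompactSupport_radialPotential.smul_right

lemma integrable_radialWeight : Integrable (radialWeight : E → ℝ) ν :=
  continuous_radialWeight.integrable_of_hasCompactSupport hasCompactSupport_radialWeight

lemma integral_radialWeight_pos : 0 < ∫ y : E, radialWeight y ∂ν := by
  refine continuous_radialWeight.integral_pos_of_hasCompactSupport_nonneg_nonzero
    hasCompactSupport_radialWeight radialWeight_nonneg (x := 0) ?_
  exact (radialWeight_pos (by simp)).ne'

lemma integral_radialPotential_pos : 0 < ∫ y : E, radialPotential y ∂ν := by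
  refine continuous_radialPotential.integral_pos_of_hasCompactSupport_nonneg_nonzero
    hasCompactSupport_radialPotential radialPotential_nonneg (x := 0) ?_
  exact (radialPotential_pos (by simp)).ne'

/-- Differentiation under the integral produces `radialWeight y • DU(P + s y) y`, the pairing of `-∇
radialPotential` with the gradient of `U`. Integration by parts moves the derivative onto `U` and
leaves its Laplacian weighted by `radialPotential`. This replaces Green's formula on spheres. -/
lemma hasDerivAt_integral_radialWeight {U : E → F} (hU : ContDiff ℝ 2 U) (P : E) (s : ℝ) :
    HasDerivAt (fun s : ℝ => ∫ y, radialWeight y • U (P + s • y) ∂ν)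
      (s • ∫ y, radialPotential y • Laplacian.laplacian U (P + s • y) ∂ν) s := by
  have hU1 : ContDiff ℝ 1 (fderiv ℝ U) := hU.fderiv_right (by norm_num)
  have hUd : Differentiable ℝ U := hU.differentiable (by norm_num)
  have hU1d : Differentiable ℝ (fderiv ℝ U) := hU1.differentiable (by norm_num)
  have hderiv : HasDerivAt (fun s : ℝ => ∫ y, radialWeight y • U (P + s • y) ∂ν)
      (∫ y, radialWeight y • fderiv ℝ U (P + s • y) y ∂ν) s := by
    have hc : Continuous (fun q : ℝ × E => fderiv ℝ U (P + q.1 • q.2) q.2) := by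
      have := hU1.continuous
      exact (this.comp (by fun_prop)).clm_apply continuous_snd
    obtain ⟨C, hC⟩ := ((isCompact_closedBall s 1).prod (isCompact_closedBall (0 : E) 1)).exists_bound_of_continuousOn
      hc.continuousOn
    refine (hasDerivAt_integral_of_dominated_loc_of_deriv_le (μ := ν)
      (F := fun s y => radialWeight y • U (P + s • y))
      (F' := fun s y => radialWeight y • fderiv ℝ U (P + s • y) y)
      (bound := fun y => radialWeight y * C)
      (Metric.closedBall_mem_nhds s one_pos) ?_ ?_ ?_ ?_ ?_ ?_).2
    · exact Filter.Eventually.of_forall fun t =>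
        (integrable_radialWeight_smul ν (by have := hU.continuous; fun_prop)).aestronglyMeasurable
    · exact integrable_radialWeight_smul ν (by have := hU.continuous; fun_prop)
    · exact (integrable_radialWeight_smul ν
        (g := fun y => fderiv ℝ U (P + s • y) y)
        (hc.comp (by fun_prop : Continuous fun y : E => (s, y)))).aestronglyMeasurable
    · refine Filter.Eventually.of_forall fun y t ht => ?_
      rw [norm_smul, Real.norm_of_nonneg (radialWeight_nonneg y)]
      by_cases hy : ‖y‖ < 1
      · exact mul_le_mul_of_nonneg_left (hC (t, y) ⟨ht, by simpa using hy.le⟩)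
          (radialWeight_nonneg y)
      · simp [radialWeight_eq_zero (not_lt.1 hy)]
    · exact (integrable_radialWeight ν).mul_const C
    · refine Filter.Eventually.of_forall fun y t _ => ?_
      have h1 : HasDerivAt (fun t : ℝ => P + t • y) y t := by
        simpa using ((hasDerivAt_id t).smul_const y).const_add P
      exact ((hUd (P + t • y)).hasFDerivAt.comp_hasDerivAt t h1).const_smul (radialWeight y)
  convert hderiv using 1
  let b := stdOrthonormalBasis ℝ E
  -- Integration by parts in the direction `b i`; the sign of `∇ radialPotential` cancels the sign
  -- of the formula, and the factor `s` is the chain rule for `y ↦ P + s • y`.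
  have hpart : ∀ i, ∫ y, (radialWeight y * inner ℝ y (b i)) • fderiv ℝ U (P + s • y) (b i) ∂ν =
      s • ∫ y, radialPotential y • fderiv ℝ (fderiv ℝ U) (P + s • y) (b i) (b i) ∂ν := by
    intro i
    have hg : ∀ y, HasFDerivAt (fun y => fderiv ℝ U (P + s • y) (b i))
        (s • (fderiv ℝ (fderiv ℝ U) (P + s • y)).flip (b i)) y := by
      intro y
      have h1 : HasFDerivAt (fun y : E => P + s • y) (s • ContinuousLinearMap.id ℝ E) y :=
        ((hasFDerivAt_id y).const_smul s).const_add P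
      have h2 := ((hU1d (P + s • y)).hasFDerivAt.comp y h1).clm_apply
        (hasFDerivAt_const (b i) y)
      refine h2.congr_fderiv ?_
      ext v
      simp
    have hgd : ∀ y, fderiv ℝ (fun y => fderiv ℝ U (P + s • y) (b i)) y (b i) =
        s • fderiv ℝ (fderiv ℝ U) (P + s • y) (b i) (b i) := fun y => by
      rw [(hg y).fderiv]; simp
    have hc1 : Continuous fun y => fderiv ℝ U (P + s • y) (b i) := by
      have := hU1.continuous; fun_prop
    have hc2 : Continuous fun y => fderiv ℝ (fderiv ℝ U) (P + s • y) (b i) (b i) := by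
      have := hU1.continuous_fderiv (by norm_num); fun_prop
    have key := integral_smul_fderiv_eq_neg_fderiv_smul_of_integrable (μ := ν)
      (f := (radialPotential : E → ℝ)) (g := fun y => fderiv ℝ U (P + s • y) (b i)) (v := b i)
      (by
        simp only [fderiv_radialPotential, neg_smul, mul_smul]
        refine (integrable_radialWeight_smul ν ?_).neg
        fun_prop)
      (by
        simp only [hgd]
        exact integrable_radialPotential_smul ν (hc2.const_smul s))
      (integrable_radialPotential_smul ν hc1)
      (fun x _ => (contDiff_radialPotential (n := 1)).differentiable (by norm_num) x)
      (fun x _ => (hg x).differentiableAt)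
    simp only [hgd, fderiv_radialPotential, neg_smul, integral_neg, neg_neg] at key
    rw [← key, ← integral_smul]
    congr 1; ext y; rw [smul_comm]
  have hsum : ∀ y, radialWeight y • fderiv ℝ U (P + s • y) y =
      ∑ i, (radialWeight y * inner ℝ y (b i)) • fderiv ℝ U (P + s • y) (b i) := by
    intro y
    conv_lhs => rw [← b.sum_repr' y, map_sum, Finset.smul_sum]
    refine Finset.sum_congr rfl fun i _ => ?_
    rw [map_smul, smul_smul, real_inner_comm]
    rw [b.sum_repr' y]
  have hlap : ∀ y, radialPotential y • Laplacian.laplacian U (P + s • y) =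
      ∑ i, radialPotential y • fderiv ℝ (fderiv ℝ U) (P + s • y) (b i) (b i) := by
    intro y
    rw [laplacian_eq_iteratedFDeriv_orthonormalBasis U b, Finset.smul_sum]
    simp [iteratedFDeriv_two_apply]
  simp_rw [hsum, hlap]
  rw [integral_finsetSum, integral_finsetSum, Finset.smul_sum]
  · exact Finset.sum_congr rfl fun i _ => (hpart i).symm
  · intro i _
    simp_rw [mul_smul]
    refine integrable_radialWeight_smul ν ?_
    have := hU1.continuous; fun_prop
  · intro i _
    refine integrable_radialPotential_smul ν ?_
    have := hU1.continuous_fderiv (by norm_num); fun_prop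

end RadialMollifier

/-! ### The mean value property and its converse. -/

section MeanValue

variable {E F : Type*} [NormedAddCommGroup E] [InnerProductSpace ℝ E]
  [NormedAddCommGroup F] [NormedSpace ℝ F] [FiniteDimensional ℝ E]

/-- A cutoff provides a global `C²` function with the same germs near `P`, so that
`hasDerivAt_integral_radialWeight`, which is stated for global functions, applies to local ones. -/
lemma exists_contDiff_eventuallyEq {u : E → F} {P : E} {r R : ℝ} (hr : 0 < r) (hrR : r < R)
    (hu : ∀ x ∈ Metric.closedBall P R, ContDiffAt ℝ 2 u x) :
    ∃ U : E → F, ContDiff ℝ 2 U ∧ ∀ x ∈ Metric.ball P r, U =ᶠ[𝓝 x] u := by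
  let χ : ContDiffBump P := ⟨r, R, hr, hrR⟩
  refine ⟨fun x => χ x • u x, contDiff_iff_contDiffAt.2 fun x => ?_, fun x hx => ?_⟩
  · by_cases hx : x ∈ Metric.closedBall P R
    · exact χ.contDiff.contDiffAt.smul (hu x hx)
    · have h0 : (fun x => χ x • u x) =ᶠ[𝓝 x] fun _ => 0 := by
        filter_upwards [Metric.isClosed_closedBall.isOpen_compl.mem_nhds hx] with z hz
        have : χ z = 0 := by
          refine χ.zero_of_le_dist ?_
          simpa using (not_le.1 (fun h => hz (by simpa using h)) : R < dist z P).le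
        simp [this]
      exact contDiffAt_const.congr_of_eventuallyEq h0
  · filter_upwards [Metric.isOpen_ball.mem_nhds hx] with z hz
    have : χ z = 1 := χ.one_of_mem_closedBall (Metric.ball_subset_closedBall hz)
    simp [this]

variable [MeasurableSpace E] [BorelSpace E] (ν : Measure E) [ν.IsAddHaarMeasure]

/-- The mean value property of harmonic functions, for the weight `radialWeight`. -/
theorem InnerProductSpace.HarmonicOnNhd.integral_radialWeight_smul [CompleteSpace F] {u : E → F} {P : E} {r : ℝ} (hr : 0 < r)
    (hu : HarmonicOnNhd u (Metric.closedBall P r)) :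
    ∫ y, radialWeight y • u (P + r • y) ∂ν = (∫ y : E, radialWeight y ∂ν) • u P := by
  -- Harmonicity is an open condition, so the closed ball has a margin `δ`; the cutoff takes place
  -- between radii `r + δ / 2` and `r + δ`.
  obtain ⟨δ, hδ, hsub⟩ := (isCompact_closedBall P r).exists_cthickening_subset_open
    (isOpen_setOfPred_harmonicAt (f := u)) hu
  rw [cthickening_closedBall hδ.le hr.le] at hsub
  obtain ⟨U, hU, hUu⟩ := exists_contDiff_eventuallyEq (u := u) (P := P) (r := r + δ / 2)
    (R := δ + r) (by positivity) (by linarith) (fun x hx => (hsub hx).1)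
  have hball : ∀ s : ℝ, s ∈ Set.Icc 0 r → ∀ y : E, ‖y‖ ≤ 1 →
      P + s • y ∈ Metric.ball P (r + δ / 2) := by
    intro s hs y hy
    rw [mem_ball_iff_norm, add_sub_cancel_left, norm_smul, Real.norm_of_nonneg hs.1]
    nlinarith [hs.1, hs.2, norm_nonneg y]
  have hder : ∀ s ∈ Set.Icc 0 r,
      HasDerivAt (fun s : ℝ => ∫ y, radialWeight y • U (P + s • y) ∂ν) 0 s := by
    intro s hs
    convert hasDerivAt_integral_radialWeight ν hU P s using 1
    have : ∀ y : E, radialPotential y • Laplacian.laplacian U (P + s • y) = 0 := by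
      intro y
      by_cases hy : ‖y‖ ≤ 1
      · have hm := hball s hs y hy
        rw [(laplacian_congr_nhds (hUu _ hm)).eq_of_nhds,
          (hsub (Metric.ball_subset_closedBall.trans
            (Metric.closedBall_subset_closedBall (by linarith)) hm)).2.eq_of_nhds]
        simp
      · simp [radialPotential_eq_zero (not_le.1 hy).le]
    simp [this]
  have hconst := constant_of_has_deriv_right_zero
    (fun s hs => (hder s hs).continuousAt.continuousWithinAt)
    (fun s hs => (hder s ⟨hs.1, hs.2.le⟩).hasDerivWithinAt) r ⟨hr.le, le_rfl⟩
  have h1 : ∀ y : E, radialWeight y • u (P + r • y) = radialWeight y • U (P + r • y) := by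
    intro y
    by_cases hy : ‖y‖ ≤ 1
    · rw [(hUu _ (hball r ⟨hr.le, le_rfl⟩ y hy)).eq_of_nhds]
    · simp [radialWeight_eq_zero (not_le.1 hy).le]
  simp_rw [h1]
  rw [hconst]
  simp only [zero_smul, add_zero]
  rw [integral_smul_const, (hUu P (Metric.mem_ball_self (by positivity))).eq_of_nhds]

/-- With a fixed radius the mean value property says that `S` is, near `P`, a constant multiple of
its convolution with a smooth compactly supported weight; smoothness is inherited from the weight.
-/
lemma contDiffAt_of_integral_radialWeight_smul [CompleteSpace F] {S : E → F} {Ω : Set E} (hΩ : IsOpen Ω)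
    (hS : ContinuousOn S Ω)
    (h : ∀ P ∈ Ω, ∀ r > 0, Metric.closedBall P r ⊆ Ω →
      ∫ y, radialWeight y • S (P + r • y) ∂ν = (∫ y : E, radialWeight y ∂ν) • S P)
    {P : E} (hP : P ∈ Ω) : ContDiffAt ℝ 2 S P := by
  obtain ⟨R, hR, hsub⟩ := Metric.isOpen_iff.1 hΩ P hP
  -- For `x` within `r` of `P`, the ball of radius `r` about `x` stays in the ball of radius `2 r <
  -- R` about `P`, which is compact in `Ω`.
  set r := R / 3 with hr
  have hr0 : 0 < r := by positivity
  have hK : Metric.closedBall P (2 * r) ⊆ Ω :=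
    (Metric.closedBall_subset_ball (by linarith)).trans hsub
  set T : E → F := (Metric.closedBall P (2 * r)).indicator S with hT
  have hTint : LocallyIntegrable T ν := by
    refine (Integrable.locallyIntegrable ?_)
    rw [integrable_indicator_iff Metric.isClosed_closedBall.measurableSet]
    exact (hS.mono hK).integrableOn_compact (isCompact_closedBall _ _)
  set w : E → ℝ := fun z => radialWeight (r⁻¹ • z) with hw
  have hwc : HasCompactSupport w := by
    refine HasCompactSupport.intro (isCompact_closedBall (0 : E) r) fun y hy => ?_
    refine radialWeight_eq_zero ?_
    rw [norm_smul, norm_inv, Real.norm_of_nonneg hr0.le, inv_mul_eq_div, one_le_div hr0]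
    simpa using (not_le.1 (fun h => hy (by simpa using h))).le
  have hws : ContDiff ℝ 2 w :=
    (contDiff_radialWeight (n := 2)).comp (contDiff_const_smul r⁻¹)
  have hconv := hwc.contDiff_convolution_left (ContinuousLinearMap.lsmul ℝ ℝ) (μ := ν) hws hTint
  set c := ∫ y : E, radialWeight y ∂ν with hc
  have hc0 : c ≠ 0 := (integral_radialWeight_pos ν).ne'
  set n := Module.finrank ℝ E
  have key : S =ᶠ[𝓝 P] fun x => (c⁻¹ * (r ^ n)⁻¹) •
      (MeasureTheory.convolution w T (ContinuousLinearMap.lsmul ℝ ℝ) ν) x := by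
    filter_upwards [Metric.ball_mem_nhds P hr0] with x hx
    have hsubx : Metric.closedBall x r ⊆ Metric.closedBall P (2 * r) := by
      refine Metric.closedBall_subset_closedBall' ?_
      rw [Metric.mem_ball] at hx; linarith
    have h1 := h x (hK (hsubx (Metric.mem_closedBall_self hr0.le))) r hr0 (hsubx.trans hK)
    have h2 : S x = c⁻¹ • ∫ y, radialWeight y • S (x + r • y) ∂ν := by
      rw [h1, smul_smul, inv_mul_cancel₀ hc0, one_smul]
    rw [h2, mul_smul]
    congr 1
    -- The substitution `y ↦ (-r) • y` turns the mean into a convolution, because the weight is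
    -- even.
    have h3 : ∀ y, radialWeight y • S (x + r • y) =
        (fun z => w z • T (x - z)) ((-r) • y) := by
      intro y
      have : w ((-r) • y) = radialWeight y := by
        simp only [hw, smul_smul]
        rw [mul_neg, inv_mul_cancel₀ hr0.ne', neg_one_smul, radialWeight_neg]
      simp only [this]
      by_cases hy : ‖y‖ ≤ 1
      · congr 1
        rw [hT, Set.indicator_of_mem]
        · simp
        · apply hsubx
          rw [mem_closedBall_iff_norm]
          simp only [neg_smul, sub_neg_eq_add, add_sub_cancel_left, norm_smul,
            Real.norm_of_nonneg hr0.le]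
          nlinarith
      · simp [radialWeight_eq_zero (not_le.1 hy).le]
    simp_rw [h3]
    rw [Measure.integral_comp_smul ν (fun z => w z • T (x - z)) (-r)]
    congr 1
    rw [abs_inv, abs_pow, abs_neg, abs_of_pos hr0]
  exact ((hconv.const_smul _).contDiffAt).congr_of_eventuallyEq key

/-- A continuous function with the mean value property on an open set is harmonic. -/
theorem harmonicOnNhd_of_integral_radialWeight_smul [CompleteSpace F] {S : E → F} {Ω : Set E} (hΩ : IsOpen Ω)
    (hS : ContinuousOn S Ω)
    (h : ∀ P ∈ Ω, ∀ r > 0, Metric.closedBall P r ⊆ Ω →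
      ∫ y, radialWeight y • S (P + r • y) ∂ν = (∫ y : E, radialWeight y ∂ν) • S P) :
    HarmonicOnNhd S Ω := by
  have hC2 : ∀ P ∈ Ω, ContDiffAt ℝ 2 S P := fun P hP =>
    contDiffAt_of_integral_radialWeight_smul ν hΩ hS h hP
  have hlap : ∀ P ∈ Ω, Laplacian.laplacian S P = 0 := by
    intro P hP
    obtain ⟨R, hR, hsub⟩ := Metric.isOpen_iff.1 hΩ P hP
    obtain ⟨U, hU, hUS⟩ := exists_contDiff_eventuallyEq (u := S) (P := P) (r := R / 4)
      (R := R / 2) (by positivity) (by linarith)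
      (fun x hx => hC2 x (hsub (Metric.closedBall_subset_ball (by linarith) hx)))
    have hUc : Continuous (Laplacian.laplacian U) := by
      rw [laplacian_eq_iteratedFDeriv_stdOrthonormalBasis]
      have := hU.continuous_iteratedFDeriv (m := 2) le_rfl
      fun_prop
    -- The weighted means are constant for small `s > 0`, so their derivative `s • J s` vanishes
    -- there. Continuity of `J` at `0` then gives `J 0 = 0`, and `J 0` is a positive multiple of the
    -- Laplacian at `P`.
    set J : ℝ → F := fun s => ∫ y, radialPotential y • Laplacian.laplacian U (P + s • y) ∂ν
    have hJ0 : J 0 = (∫ y : E, radialPotential y ∂ν) • Laplacian.laplacian S P := by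
      simp only [J, zero_smul, add_zero]
      rw [integral_smul_const, (laplacian_congr_nhds
        (hUS P (Metric.mem_ball_self (by positivity)))).eq_of_nhds]
    have hJs : ∀ s ∈ Set.Ioo 0 (R / 4), J s = 0 := by
      intro s hs
      have h1 := hasDerivAt_integral_radialWeight ν hU P s
      have h2 : (fun s : ℝ => ∫ y, radialWeight y • U (P + s • y) ∂ν) =ᶠ[𝓝 s]
          fun _ => (∫ y : E, radialWeight y ∂ν) • S P := by
        filter_upwards [isOpen_Ioo.mem_nhds hs] with t ht
        rw [← h P hP t ht.1 ((Metric.closedBall_subset_ball (by linarith [ht.2])).trans hsub)]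
        congr 1; ext y
        by_cases hy : ‖y‖ < 1
        · congr 1
          refine (hUS _ ?_).eq_of_nhds
          rw [mem_ball_iff_norm, add_sub_cancel_left, norm_smul, Real.norm_of_nonneg ht.1.le]
          nlinarith [ht.1, ht.2, norm_nonneg y]
        · simp [radialWeight_eq_zero (not_lt.1 hy)]
      have h3 := h1.unique ((hasDerivAt_const s _).congr_of_eventuallyEq h2)
      exact (smul_eq_zero.1 h3).resolve_left hs.1.ne'
    have hJc : ContinuousAt J 0 := by
      have hcont : Continuous fun q : ℝ × E => Laplacian.laplacian U (P + q.1 • q.2) := by fun_prop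
      obtain ⟨C, hC⟩ := ((isCompact_closedBall (0 : ℝ) 1).prod
        (isCompact_closedBall (0 : E) 1)).exists_bound_of_continuousOn hcont.continuousOn
      refine continuousAt_of_dominated (bound := fun y => radialPotential y • C) ?_ ?_ ?_ ?_
      · exact Eventually.of_forall fun s =>
          (integrable_radialPotential_smul ν (by fun_prop)).aestronglyMeasurable
      · filter_upwards [Metric.closedBall_mem_nhds (0 : ℝ) one_pos] with s hs
        refine Eventually.of_forall fun y => ?_
        rw [norm_smul, Real.norm_of_nonneg (radialPotential_nonneg y)]
        by_cases hy : ‖y‖ < 1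
        · exact mul_le_mul_of_nonneg_left (hC (s, y) ⟨hs, by simpa using hy.le⟩)
            (radialPotential_nonneg y)
        · simp [radialPotential_eq_zero (not_lt.1 hy)]
      · exact integrable_radialPotential_smul ν continuous_const
      · exact Eventually.of_forall fun y => by fun_prop
    have hlim : Tendsto J (𝓝[>] 0) (𝓝 0) := by
      refine tendsto_const_nhds.congr' ?_
      filter_upwards [Ioo_mem_nhdsGT (show (0 : ℝ) < R / 4 by positivity)] with s hs
      exact (hJs s hs).symm
    have := tendsto_nhds_unique (hJc.tendsto.mono_left nhdsWithin_le_nhds) hlim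
    rw [hJ0] at this
    exact (smul_eq_zero.1 this).resolve_left (integral_radialPotential_pos ν).ne'
  intro P hP
  exact ⟨hC2 P hP, by filter_upwards [hΩ.mem_nhds hP] with x hx using hlap x hx⟩

end MeanValue

/-! ### The Laplacian from one-variable derivatives along an orthonormal basis. -/

section LaplacianAlongLines

variable {E F : Type*} [NormedAddCommGroup E] [InnerProductSpace ℝ E]
  [NormedAddCommGroup F] [NormedSpace ℝ F] [FiniteDimensional ℝ E]

lemma laplacian_eq_sum_of_hasDerivAt {ι : Type*} [Fintype ι] (b : OrthonormalBasis ι ℝ E)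
    {f : E → F} {P : E} (hf : ContDiffAt ℝ 2 f P) {g' : ι → ℝ → F} {g'' : ι → F}
    (h1 : ∀ i, ∀ᶠ s : ℝ in 𝓝 0, HasDerivAt (fun s : ℝ => f (P + s • b i)) (g' i s) s)
    (h2 : ∀ i, HasDerivAt (g' i) (g'' i) 0) :
    Laplacian.laplacian f P = ∑ i, g'' i := by
  rw [laplacian_eq_iteratedFDeriv_orthonormalBasis f b]
  refine Finset.sum_congr rfl fun i _ => ?_
  have hline : ∀ s : ℝ, HasDerivAt (fun s : ℝ => P + s • b i) (b i) s := fun s => by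
    simpa using ((hasDerivAt_id s).smul_const (b i)).const_add P
  have hd : ∀ᶠ z in 𝓝 P, DifferentiableAt ℝ f z := by
    filter_upwards [hf.eventually (by simp)] with z hz using hz.differentiableAt (by norm_num)
  have htend : Tendsto (fun s : ℝ => P + s • b i) (𝓝 0) (𝓝 P) := by
    simpa using (hline 0).continuousAt.tendsto
  have h3 : g' i =ᶠ[𝓝 0] fun s => fderiv ℝ f (P + s • b i) (b i) := by
    filter_upwards [h1 i, htend.eventually hd] with s hs hs'
    exact hs.unique (hs'.hasFDerivAt.comp_hasDerivAt s (hline s))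
  have h4 : HasDerivAt (fun s : ℝ => fderiv ℝ f (P + s • b i) (b i))
      (fderiv ℝ (fderiv ℝ f) P (b i) (b i)) 0 := by
    have h5 : HasFDerivAt (fderiv ℝ f) (fderiv ℝ (fderiv ℝ f) P) (P + (0 : ℝ) • b i) := by
      have h : DifferentiableAt ℝ (fderiv ℝ f) P :=
        (hf.fderiv_right (m := 1) (by norm_num)).differentiableAt one_ne_zero
      rw [zero_smul, add_zero]
      exact h.hasFDerivAt
    have h7 : HasDerivAt (fun s : ℝ => fderiv ℝ f (P + s • b i))
        (fderiv ℝ (fderiv ℝ f) P (b i)) 0 := h5.comp_hasDerivAt 0 (hline 0)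
    refine (h7.clm_apply (hasDerivAt_const 0 (b i))).congr_deriv ?_
    rw [map_zero, add_zero]
  have h6 := (h2 i).unique (h4.congr_of_eventuallyEq h3)
  simp [iteratedFDeriv_two_apply, h6]

end LaplacianAlongLines

/-! ### Harmonicity of the Poisson kernel and of a quadratic barrier. -/

section PoissonKernel

variable {d : ℕ}

/-- The Poisson kernel of the half space, without its normalizing constant. -/
noncomputable def halfSpaceKernel (z : AmbientSpace d) : ℝ := z.snd / ‖z‖ ^ (d + 1)

lemma AmbientSpace.norm_sq (z : AmbientSpace d) : ‖z‖ ^ 2 = ‖z.fst‖ ^ 2 + z.snd ^ 2 := by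
  rw [WithLp.prod_norm_sq_eq_of_L2, Real.norm_eq_abs, sq_abs]

lemma AmbientSpace.snd_eq_inner (z : AmbientSpace d) :
    z.snd = inner ℝ z (WithLp.toLp 2 ((0 : EuclideanSpace ℝ (Fin d)), (1 : ℝ))) := by
  simp [WithLp.prod_inner_apply]

lemma AmbientSpace.norm_fst_le (z : AmbientSpace d) : ‖z.fst‖ ≤ ‖z‖ :=
  abs_le_of_sq_le_sq' (by rw [AmbientSpace.norm_sq]; nlinarith [sq_nonneg z.snd])
    (norm_nonneg z) |>.2

lemma AmbientSpace.abs_snd_le (z : AmbientSpace d) : |z.snd| ≤ ‖z‖ :=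
  sq_le_sq₀ (abs_nonneg _) (norm_nonneg _) |>.1
    (by rw [AmbientSpace.norm_sq, sq_abs]; nlinarith [sq_nonneg ‖z.fst‖])

lemma AmbientSpace.norm_le_add (z : AmbientSpace d) : ‖z‖ ≤ ‖z.fst‖ + |z.snd| := by
  refine abs_le_of_sq_le_sq' (a := ‖z‖) ?_ (by positivity) |>.2
  rw [AmbientSpace.norm_sq, ← sq_abs z.snd]
  nlinarith [mul_nonneg (norm_nonneg z.fst) (abs_nonneg z.snd)]

lemma AmbientSpace.continuous_fst : Continuous fun z : AmbientSpace d => z.fst :=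
  WithLp.prod_continuous_ofLp 2 _ _ |>.fst

lemma AmbientSpace.continuous_snd : Continuous fun z : AmbientSpace d => z.snd :=
  WithLp.prod_continuous_ofLp 2 _ _ |>.snd

lemma isOpen_upperHalfSpace : IsOpen (upperHalfSpace d) :=
  isOpen_lt continuous_const AmbientSpace.continuous_snd

lemma finrank_ambientSpace : Module.finrank ℝ (AmbientSpace d) = d + 1 := by
  rw [(WithLp.linearEquiv 2 ℝ (EuclideanSpace ℝ (Fin d) × ℝ)).finrank_eq]
  simp

lemma norm_line_sq (P b : AmbientSpace d) (hb : ‖b‖ = 1) (s : ℝ) :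
    ‖P + s • b‖ ^ 2 = ‖P‖ ^ 2 + 2 * s * inner ℝ P b + s ^ 2 := by
  rw [norm_add_sq_real, inner_smul_right, norm_smul, hb, mul_one, Real.norm_eq_abs, sq_abs]
  ring

lemma norm_pos_of_snd_pos {z : AmbientSpace d} (hz : 0 < z.snd) : 0 < ‖z‖ :=
  (hz.trans_le (le_abs_self _)).trans_le (AmbientSpace.abs_snd_le z)

lemma halfSpaceKernel_nonneg {z : AmbientSpace d} (hz : 0 ≤ z.snd) : 0 ≤ halfSpaceKernel z := by
  unfold halfSpaceKernel; positivity

/-- Along a line in a unit direction `‖z‖ ^ 2` is a quadratic polynomial, so this form can be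
differentiated twice by hand. -/
lemma halfSpaceKernel_eq_rpow (z : AmbientSpace d) :
    halfSpaceKernel z = z.snd * (‖z‖ ^ 2) ^ (-((d : ℝ) + 1) / 2) := by
  have : (‖z‖ ^ 2) ^ (-((d : ℝ) + 1) / 2) = (‖z‖ ^ (d + 1))⁻¹ := by
    rw [← Real.rpow_natCast ‖z‖ 2, ← Real.rpow_mul (norm_nonneg z), ← Real.rpow_natCast ‖z‖ (d + 1),
      ← Real.rpow_neg (norm_nonneg z)]
    congr 1; push_cast; ring
  rw [halfSpaceKernel, this, div_eq_mul_inv]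

lemma AmbientSpace.contDiff_snd : ContDiff ℝ 2 fun z : AmbientSpace d => z.snd := by
  simp_rw [AmbientSpace.snd_eq_inner]
  exact contDiff_id.inner ℝ contDiff_const

lemma sum_inner_mul_snd (b : OrthonormalBasis (Fin (Module.finrank ℝ (AmbientSpace d))) ℝ
    (AmbientSpace d)) (P : AmbientSpace d) : ∑ i, inner ℝ P (b i) * (b i).snd = P.snd := by
  rw [AmbientSpace.snd_eq_inner P, ← b.sum_inner_mul_inner P]
  exact Finset.sum_congr rfl fun i _ => by rw [AmbientSpace.snd_eq_inner (b i)]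

lemma sum_snd_sq (b : OrthonormalBasis (Fin (Module.finrank ℝ (AmbientSpace d))) ℝ
    (AmbientSpace d)) : ∑ i, (b i).snd ^ 2 = 1 := by
  have := sum_inner_mul_snd b (WithLp.toLp 2 ((0 : EuclideanSpace ℝ (Fin d)), (1 : ℝ)))
  refine Eq.trans (Finset.sum_congr rfl fun i _ => ?_) this
  rw [real_inner_comm, ← AmbientSpace.snd_eq_inner, sq]

lemma sum_inner_sq (b : OrthonormalBasis (Fin (Module.finrank ℝ (AmbientSpace d))) ℝ
    (AmbientSpace d)) (P : AmbientSpace d) : ∑ i, (inner ℝ P (b i)) ^ 2 = ‖P‖ ^ 2 := by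
  simpa using b.sum_sq_norm_inner_left P

theorem harmonicOnNhd_halfSpaceKernel :
    HarmonicOnNhd (halfSpaceKernel : AmbientSpace d → ℝ) (upperHalfSpace d) := by
  set m : ℝ := -((d : ℝ) + 1) / 2 with hm
  have hfun : (halfSpaceKernel : AmbientSpace d → ℝ) = fun z => z.snd * (‖z‖ ^ 2) ^ m :=
    funext halfSpaceKernel_eq_rpow
  have hC : ∀ P ∈ upperHalfSpace d, ContDiffAt ℝ 2 (halfSpaceKernel : AmbientSpace d → ℝ) P := by
    intro P hP
    rw [hfun]
    refine AmbientSpace.contDiff_snd.contDiffAt.mul (ContDiffAt.rpow_const_of_ne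
      (contDiff_norm_sq ℝ).contDiffAt ?_)
    have := norm_pos_of_snd_pos hP
    positivity
  refine fun P hP => ⟨hC P hP, ?_⟩
  filter_upwards [isOpen_upperHalfSpace.mem_nhds hP] with P hP
  have hN : 0 < ‖P‖ ^ 2 := by have := norm_pos_of_snd_pos hP; positivity
  set N := ‖P‖ ^ 2 with hNdef
  let b := stdOrthonormalBasis ℝ (AmbientSpace d)
  set p : Fin (Module.finrank ℝ (AmbientSpace d)) → ℝ := fun i => inner ℝ P (b i) with hp
  have hB : ∀ (i) (s : ℝ), HasDerivAt (fun s : ℝ => N + 2 * s * p i + s ^ 2) (2 * p i + 2 * s) s := by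
    intro i s
    have h := ((((hasDerivAt_id s).const_mul 2).mul_const (p i)).const_add N).add
      ((hasDerivAt_id s).pow 2)
    refine h.congr_deriv ?_
    simp
  have hL : ∀ (i) (s : ℝ), HasDerivAt (fun s : ℝ => P.snd + s * (b i).snd) ((b i).snd) s := by
    intro i s
    simpa using ((hasDerivAt_id s).mul_const (b i).snd).const_add P.snd
  have hpos : ∀ i, ∀ᶠ s : ℝ in 𝓝 0, 0 < N + 2 * s * p i + s ^ 2 := by
    intro i
    have : ContinuousAt (fun s : ℝ => N + 2 * s * p i + s ^ 2) 0 := (hB i 0).continuousAt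
    exact this.eventually (lt_mem_nhds (by simpa using hN))
  rw [laplacian_eq_sum_of_hasDerivAt b (hC P hP)
    (g' := fun i s => (b i).snd * (N + 2 * s * p i + s ^ 2) ^ m +
      (P.snd + s * (b i).snd) * ((2 * p i + 2 * s) * m * (N + 2 * s * p i + s ^ 2) ^ (m - 1)))
    (g'' := fun i => 4 * m * N ^ (m - 1) * (p i * (b i).snd) +
      P.snd * (4 * m * (m - 1) * N ^ (m - 1 - 1) * p i ^ 2 + 2 * m * N ^ (m - 1))) ?_ ?_]
  -- The sum over the basis equals `2 * m * P.snd * N ^ (m - 1) * (2 * m + d + 1)`, which vanishes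
  -- by the choice of `m`.
  · simp only [Finset.sum_add_distrib, ← Finset.mul_sum]
    rw [sum_inner_mul_snd b P, sum_inner_sq b P, Finset.sum_const, Finset.card_univ,
      Fintype.card_fin, finrank_ambientSpace, ← hNdef]
    have : N ^ (m - 1 - 1) * N = N ^ (m - 1) := by
      rw [← Real.rpow_add_one hN.ne']; congr 1; ring
    have h2 : 4 * m * (m - 1) * N ^ (m - 1 - 1) * N = 4 * m * (m - 1) * N ^ (m - 1) := by
      rw [← this]; ring
    rw [h2, nsmul_eq_mul, hm]
    push_cast
    simp only [Pi.zero_apply]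
    ring
  · intro i
    filter_upwards [hpos i] with s hs
    have h := (hL i s).mul ((hB i s).rpow_const (p := m) (Or.inl hs.ne'))
    refine h.congr_of_eventuallyEq (Eventually.of_forall fun s => ?_)
    simp only [hfun, norm_line_sq P (b i) (b.orthonormal.1 i) s]
    simp [hp, hNdef]
  · intro i
    have h0 : N + 2 * (0 : ℝ) * p i + 0 ^ 2 ≠ 0 := by simpa using hN.ne'
    have e1 := ((hB i 0).rpow_const (p := m) (Or.inl h0)).const_mul (b i).snd
    have e2 : HasDerivAt (fun s : ℝ => (2 * p i + 2 * s) * m) (2 * m) 0 := by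
      simpa using (((hasDerivAt_id (0 : ℝ)).const_mul 2).const_add (2 * p i)).mul_const m
    have e3 := (hL i 0).mul (e2.mul ((hB i 0).rpow_const (p := m - 1) (Or.inl h0)))
    refine (e1.add e3).congr_deriv ?_
    simp
    ring

/-- A harmonic polynomial that grows at infinity in the half space. -/
theorem harmonicOnNhd_barrier (c : ℝ) :
    HarmonicOnNhd (fun z : AmbientSpace d => ‖z‖ ^ 2 - (d + 1) * z.snd ^ 2 + c * z.snd)
      Set.univ := by
  have hC : ContDiff ℝ 2
      (fun z : AmbientSpace d => ‖z‖ ^ 2 - (d + 1) * z.snd ^ 2 + c * z.snd) := by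
    have := AmbientSpace.contDiff_snd (d := d)
    have := contDiff_norm_sq ℝ (E := AmbientSpace d) (n := 2)
    fun_prop
  refine fun P _ => ⟨hC.contDiffAt, Eventually.of_forall fun P => ?_⟩
  let b := stdOrthonormalBasis ℝ (AmbientSpace d)
  rw [laplacian_eq_sum_of_hasDerivAt b hC.contDiffAt
    (g' := fun i s => 2 * inner ℝ P (b i) + 2 * s -
      (d + 1) * (2 * (P.snd + s * (b i).snd) * (b i).snd) + c * (b i).snd)
    (g'' := fun i => 2 - 2 * (d + 1) * (b i).snd ^ 2) ?_ ?_]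
  · simp only [Finset.sum_sub_distrib, ← Finset.mul_sum]
    rw [sum_snd_sq b, Finset.sum_const, Finset.card_univ, Fintype.card_fin, finrank_ambientSpace]
    simp
    ring
  · refine fun i => Eventually.of_forall fun s => ?_
    have hL : HasDerivAt (fun s : ℝ => P.snd + s * (b i).snd) ((b i).snd) s := by
      simpa using ((hasDerivAt_id s).mul_const (b i).snd).const_add P.snd
    have hB : HasDerivAt (fun s : ℝ => ‖P‖ ^ 2 + 2 * s * inner ℝ P (b i) + s ^ 2)
        (2 * inner ℝ P (b i) + 2 * s) s := by
      have h := ((((hasDerivAt_id s).const_mul 2).mul_const (inner ℝ P (b i))).const_add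
        (‖P‖ ^ 2)).add ((hasDerivAt_id s).pow 2)
      refine h.congr_deriv ?_
      simp
    have h := (hB.sub ((hL.pow 2).const_mul ((d : ℝ) + 1))).add (hL.const_mul c)
    refine (h.congr_of_eventuallyEq (Eventually.of_forall fun s => ?_)).congr_deriv ?_
    · simp only [norm_line_sq P (b i) (b.orthonormal.1 i) s]
      simp
    · simp
  · intro i
    have hL : HasDerivAt (fun s : ℝ => P.snd + s * (b i).snd) ((b i).snd) 0 := by
      simpa using ((hasDerivAt_id (0 : ℝ)).mul_const (b i).snd).const_add P.snd
    have h := ((((hasDerivAt_id (0 : ℝ)).const_mul 2).const_add (2 * inner ℝ P (b i))).sub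
      (((hL.const_mul 2).mul_const (b i).snd).const_mul ((d : ℝ) + 1))).add_const (c * (b i).snd)
    refine h.congr_deriv ?_
    simp
    ring

end PoissonKernel

/-! ### The Poisson integral: harmonicity, Hardy norm, lower bound on tents. -/

section PoissonIntegral

variable {d : ℕ}

/-- The Poisson integral of `f`, without the normalizing constant of the kernel. -/
noncomputable def halfSpaceIntegral (f : EuclideanSpace ℝ (Fin d) → ℝ) (z : AmbientSpace d) : ℝ :=
  ∫ y, halfSpaceKernel (z - WithLp.toLp 2 (y, 0)) * f y

/-- The mass of `halfSpaceKernel` on each horizontal hyperplane. -/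
noncomputable def halfSpaceKernelMass (d : ℕ) : ℝ :=
  ∫ w : EuclideanSpace ℝ (Fin d), halfSpaceKernel (WithLp.toLp 2 (w, (1 : ℝ)) : AmbientSpace d)

lemma continuousOn_halfSpaceKernel :
    ContinuousOn (halfSpaceKernel : AmbientSpace d → ℝ) (upperHalfSpace d) :=
  harmonicOnNhd_halfSpaceKernel.continuousOn

lemma measurable_halfSpaceKernel : Measurable (halfSpaceKernel : AmbientSpace d → ℝ) :=
  AmbientSpace.continuous_snd.measurable.div (continuous_norm.pow _).measurable

lemma continuous_toLp : Continuous fun q : EuclideanSpace ℝ (Fin d) × ℝ =>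
    (WithLp.toLp 2 q : AmbientSpace d) :=
  WithLp.prod_continuous_toLp 2 _ _

lemma halfSpaceKernel_smul {t : ℝ} (ht : 0 < t) (w : EuclideanSpace ℝ (Fin d)) :
    halfSpaceKernel (WithLp.toLp 2 (t • w, t) : AmbientSpace d) =
      (t ^ d)⁻¹ * halfSpaceKernel (WithLp.toLp 2 (w, (1 : ℝ)) : AmbientSpace d) := by
  have h : (WithLp.toLp 2 (t • w, t) : AmbientSpace d) =
      t • (WithLp.toLp 2 (w, (1 : ℝ)) : AmbientSpace d) := by
    apply WithLp.ofLp_injective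
    ext <;> simp
  have hpos : 0 < ‖(WithLp.toLp 2 (w, (1 : ℝ)) : AmbientSpace d)‖ :=
    norm_pos_of_snd_pos (by simp)
  rw [h, halfSpaceKernel, halfSpaceKernel, norm_smul, Real.norm_of_nonneg ht.le]
  simp only [WithLp.smul_snd, smul_eq_mul, mul_pow, pow_succ t]
  field_simp

lemma integrable_halfSpaceKernel_one :
    Integrable fun w : EuclideanSpace ℝ (Fin d) =>
      halfSpaceKernel (WithLp.toLp 2 (w, (1 : ℝ)) : AmbientSpace d) := by
  have h := integrable_rpow_neg_one_add_norm_sq (E := EuclideanSpace ℝ (Fin d))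
    (μ := volume) (r := d + 1) (by simp)
  refine h.congr (Eventually.of_forall fun w => ?_)
  simp only [halfSpaceKernel_eq_rpow, AmbientSpace.norm_sq]
  simp [add_comm]

lemma halfSpaceKernelMass_pos : 0 < halfSpaceKernelMass d := by
  have hc : Continuous fun w : EuclideanSpace ℝ (Fin d) =>
      halfSpaceKernel (WithLp.toLp 2 (w, (1 : ℝ)) : AmbientSpace d) :=
    continuousOn_halfSpaceKernel.comp_continuous
      (continuous_toLp.comp (by fun_prop)) (fun w => by simp [upperHalfSpace])
  refine (integral_pos_iff_support_of_nonneg (fun w => halfSpaceKernel_nonneg (by simp))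
    integrable_halfSpaceKernel_one).2 ?_
  have : (Function.support fun w : EuclideanSpace ℝ (Fin d) =>
      halfSpaceKernel (WithLp.toLp 2 (w, (1 : ℝ)) : AmbientSpace d)) = Set.univ := by
    ext w
    have hpos : 0 < ‖(WithLp.toLp 2 (w, (1 : ℝ)) : AmbientSpace d)‖ :=
      norm_pos_of_snd_pos (by simp)
    simp only [Function.mem_support, Set.mem_univ, iff_true, halfSpaceKernel]
    exact (div_pos (by simp) (by positivity)).ne'
  rw [this]
  exact Measure.measure_univ_pos.2 (NeZero.ne _)

lemma integrable_halfSpaceKernel_fst {t : ℝ} (ht : 0 < t) :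
    Integrable fun v : EuclideanSpace ℝ (Fin d) =>
      halfSpaceKernel (WithLp.toLp 2 (v, t) : AmbientSpace d) := by
  rw [← integrable_comp_smul_iff volume _ ht.ne']
  simp_rw [halfSpaceKernel_smul ht]
  exact integrable_halfSpaceKernel_one.const_mul _

lemma sub_toLp (z : AmbientSpace d) (y : EuclideanSpace ℝ (Fin d)) :
    z - WithLp.toLp 2 (y, 0) = WithLp.toLp 2 (z.fst - y, z.snd) := by
  apply WithLp.ofLp_injective
  ext <;> simp

lemma integrable_halfSpaceKernel_sub {z : AmbientSpace d} (hz : 0 < z.snd) :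
    Integrable fun y : EuclideanSpace ℝ (Fin d) =>
      halfSpaceKernel (z - WithLp.toLp 2 (y, 0)) := by
  simp_rw [sub_toLp]
  exact (integrable_halfSpaceKernel_fst hz).comp_sub_left z.fst

/-- The substitution `y = z.fst - z.snd • w` moves the dependence on `z` from the kernel to `f`. The
right-hand side still makes sense at `z.snd = 0`, where it is the kernel mass times the boundary
value. -/
lemma halfSpaceIntegral_eq (f : EuclideanSpace ℝ (Fin d) → ℝ) {z : AmbientSpace d}
    (hz : 0 < z.snd) :
    halfSpaceIntegral f z = ∫ w : EuclideanSpace ℝ (Fin d),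
      halfSpaceKernel (WithLp.toLp 2 (w, (1 : ℝ)) : AmbientSpace d) * f (z.fst - z.snd • w) := by
  unfold halfSpaceIntegral
  set h : EuclideanSpace ℝ (Fin d) → ℝ := fun v =>
    halfSpaceKernel (WithLp.toLp 2 (v, z.snd) : AmbientSpace d) * f (z.fst - v) with hh
  have h1 : ∀ y, halfSpaceKernel (z - WithLp.toLp 2 (y, 0)) * f y = h (z.fst - y) := by
    intro y; simp [hh, sub_toLp]
  have h2 : ∀ w, halfSpaceKernel (WithLp.toLp 2 (w, (1 : ℝ)) : AmbientSpace d) *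
      f (z.fst - z.snd • w) = z.snd ^ d * h (z.snd • w) := by
    intro w
    simp only [hh, halfSpaceKernel_smul hz]
    field_simp
  simp_rw [h1, h2]
  rw [integral_sub_left_eq_self h, integral_const_mul, Measure.integral_comp_smul]
  simp only [finrank_euclideanSpace, Fintype.card_fin, abs_inv, abs_pow, abs_of_pos hz, smul_eq_mul]
  field_simp

lemma integral_halfSpaceKernel_fst {t : ℝ} (ht : 0 < t) :
    ∫ v : EuclideanSpace ℝ (Fin d), halfSpaceKernel (WithLp.toLp 2 (v, t) : AmbientSpace d) =
      halfSpaceKernelMass d := by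
  have h := halfSpaceIntegral_eq (d := d) (fun _ => 1) (z := WithLp.toLp 2 (0, t)) (by simpa using ht)
  simp only [halfSpaceIntegral, mul_one, sub_toLp] at h
  rw [halfSpaceKernelMass, ← h]
  exact (integral_sub_left_eq_self (fun v : EuclideanSpace ℝ (Fin d) =>
    halfSpaceKernel (WithLp.toLp 2 (v, t) : AmbientSpace d)) volume 0).symm

lemma lintegral_halfSpaceKernel_fst {t : ℝ} (ht : 0 < t) :
    ∫⁻ v : EuclideanSpace ℝ (Fin d),
      ENNReal.ofReal (halfSpaceKernel (WithLp.toLp 2 (v, t) : AmbientSpace d)) =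
      ENNReal.ofReal (halfSpaceKernelMass d) := by
  rw [← integral_halfSpaceKernel_fst ht, ofReal_integral_eq_lintegral_ofReal
    (integrable_halfSpaceKernel_fst ht)
    (Eventually.of_forall fun v => halfSpaceKernel_nonneg (by simpa using ht.le))]

/-- A Harnack-type bound: a displacement smaller than the height changes the kernel by a bounded
factor, since the height at most doubles and the norm shrinks at most by `1 - ρ`. It supplies the
dominating functions for continuity and for Fubini. -/
lemma halfSpaceKernel_add_le {v w : AmbientSpace d} {ρ : ℝ} (hv : 0 < v.snd) (hρ0 : 0 ≤ ρ)
    (hρ : ρ < 1) (hw : ‖w‖ ≤ ρ * v.snd) :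
    halfSpaceKernel (v + w) ≤ 2 / (1 - ρ) ^ (d + 1) * halfSpaceKernel v := by
  have hsnd := (abs_le.1 (AmbientSpace.abs_snd_le w))
  have hv0 := norm_pos_of_snd_pos hv
  have hvn : v.snd ≤ ‖v‖ := (le_abs_self _).trans (AmbientSpace.abs_snd_le v)
  have h1 : (v + w).snd ≤ 2 * v.snd := by
    rw [WithLp.add_snd]; nlinarith
  have h2 : (1 - ρ) * ‖v‖ ≤ ‖v + w‖ := by
    have := norm_sub_le_norm_add v w
    nlinarith
  have h3 : 0 < (1 - ρ) * ‖v‖ := mul_pos (by linarith) hv0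
  have h4 : ((1 - ρ) * ‖v‖) ^ (d + 1) ≤ ‖v + w‖ ^ (d + 1) := pow_le_pow_left₀ h3.le h2 _
  unfold halfSpaceKernel
  calc (v + w).snd / ‖v + w‖ ^ (d + 1) ≤ (2 * v.snd) / ‖v + w‖ ^ (d + 1) := by gcongr
    _ ≤ (2 * v.snd) / ((1 - ρ) * ‖v‖) ^ (d + 1) := by gcongr
    _ = _ := by rw [mul_pow]; field_simp

lemma add_snd_pos {v w : AmbientSpace d} (hw : ‖w‖ < v.snd) : 0 < (v + w).snd := by
  have := (abs_le.1 (AmbientSpace.abs_snd_le w)).1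
  rw [WithLp.add_snd]; linarith

lemma lt_snd_of_closedBall_subset {z : AmbientSpace d} {r : ℝ} (hr : 0 < r)
    (h : Metric.closedBall z r ⊆ upperHalfSpace d) : r < z.snd := by
  have h1 : z - WithLp.toLp 2 ((0 : EuclideanSpace ℝ (Fin d)), r) ∈ Metric.closedBall z r := by
    rw [mem_closedBall_iff_norm]
    simp [abs_of_pos hr]
  have := h h1
  simpa [upperHalfSpace] using this

variable {f : EuclideanSpace ℝ (Fin d) → ℝ} {B : ℝ}

lemma integrable_halfSpaceKernel_mul (hf : Measurable f) (hB : ∀ x, |f x| ≤ B)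
    {z : AmbientSpace d} (hz : 0 < z.snd) :
    Integrable fun y => halfSpaceKernel (z - WithLp.toLp 2 (y, 0)) * f y :=
  (integrable_halfSpaceKernel_sub hz).mul_bdd hf.aestronglyMeasurable
    (Eventually.of_forall hB)

lemma continuousOn_halfSpaceIntegral (hf : Measurable f) (hB : ∀ x, |f x| ≤ B) :
    ContinuousOn (halfSpaceIntegral f) (upperHalfSpace d) := by
  intro z hz
  refine ContinuousAt.continuousWithinAt ?_
  have hz' : 0 < z.snd := hz
  refine continuousAt_of_dominated (bound := fun y => 2 / (1 - 1 / 2) ^ (d + 1) *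
    halfSpaceKernel (z - WithLp.toLp 2 (y, 0)) * B) ?_ ?_ ?_ ?_
  · filter_upwards [isOpen_upperHalfSpace.mem_nhds hz] with x hx
    exact (integrable_halfSpaceKernel_mul hf hB hx).aestronglyMeasurable
  · filter_upwards [Metric.ball_mem_nhds z (show 0 < 1 / 2 * z.snd by positivity)] with x hx
    refine Eventually.of_forall fun y => ?_
    have hx' : ‖x - z‖ ≤ 1 / 2 * z.snd := (mem_ball_iff_norm.1 hx).le
    have hpos : 0 < x.snd := by
      have := add_snd_pos (v := z) (w := x - z) (by linarith)
      simpa using this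
    have h1 := halfSpaceKernel_add_le (v := z - WithLp.toLp 2 (y, 0)) (w := x - z) (ρ := 1 / 2)
      (by simpa using hz') (by norm_num) (by norm_num) (by simpa using hx')
    have h2 : z - WithLp.toLp 2 (y, 0) + (x - z) = x - WithLp.toLp 2 (y, 0) := by abel
    rw [h2] at h1
    rw [norm_mul, Real.norm_of_nonneg (halfSpaceKernel_nonneg (by simpa using hpos.le))]
    have h3 : 0 ≤ halfSpaceKernel (x - WithLp.toLp 2 (y, 0)) :=
      halfSpaceKernel_nonneg (by simpa using hpos.le)
    exact mul_le_mul h1 (hB y) (norm_nonneg _) (h3.trans h1)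
  · exact ((integrable_halfSpaceKernel_sub hz').const_mul _).mul_const B
  · refine Eventually.of_forall fun y => ?_
    have h1 : ContinuousAt (fun x : AmbientSpace d => x - WithLp.toLp 2 (y, 0)) z := by fun_prop
    have h2 : ContinuousAt (halfSpaceKernel : AmbientSpace d → ℝ) (z - WithLp.toLp 2 (y, 0)) :=
      continuousOn_halfSpaceKernel.continuousAt (isOpen_upperHalfSpace.mem_nhds
        (by simpa [upperHalfSpace] using hz'))
    exact (ContinuousAt.comp (f := fun x : AmbientSpace d => x - WithLp.toLp 2 (y, 0)) h2 h1).mul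
      continuousAt_const

/-- Fubini reduces the mean value property to that of the translated kernels. The closed ball stays
strictly above the boundary, so `r / z.snd < 1` and the Harnack bound gives integrability on the
product. -/
lemma integral_radialWeight_halfSpaceIntegral (hf : Measurable f) (hB : ∀ x, |f x| ≤ B)
    {z : AmbientSpace d} {r : ℝ} (hr : 0 < r)
    (h : Metric.closedBall z r ⊆ upperHalfSpace d) :
    ∫ y, radialWeight y • halfSpaceIntegral f (z + r • y) =
      (∫ y : AmbientSpace d, radialWeight y) • halfSpaceIntegral f z := by
  have hrz := lt_snd_of_closedBall_subset hr h
  have hz : 0 < z.snd := hr.trans hrz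
  have hρ : r / z.snd < 1 := (div_lt_one hz).2 hrz
  have hint : Integrable (Function.uncurry fun (y' : AmbientSpace d)
      (y : EuclideanSpace ℝ (Fin d)) => radialWeight y' *
        (halfSpaceKernel (z + r • y' - WithLp.toLp 2 (y, 0)) * f y)) (volume.prod volume) := by
    have hdom := (integrable_radialWeight (E := AmbientSpace d) volume).mul_prod
      (((integrable_halfSpaceKernel_sub hz).const_mul (2 / (1 - r / z.snd) ^ (d + 1))).mul_const B)
    refine hdom.mono' ?_ (Eventually.of_forall ?_)
    · refine Measurable.aestronglyMeasurable ?_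
      refine (continuous_radialWeight.measurable.comp measurable_fst).mul
        ((measurable_halfSpaceKernel.comp ?_).mul (hf.comp measurable_snd))
      refine Continuous.measurable ?_
      have : Continuous fun q : AmbientSpace d × EuclideanSpace ℝ (Fin d) =>
        (WithLp.toLp 2 (q.2, (0 : ℝ)) : AmbientSpace d) := continuous_toLp.comp (by fun_prop)
      fun_prop
    · rintro ⟨y', y⟩
      simp only [Function.uncurry]
      rw [norm_mul, Real.norm_of_nonneg (radialWeight_nonneg y')]
      by_cases hy : ‖y'‖ < 1
      · refine mul_le_mul_of_nonneg_left ?_ (radialWeight_nonneg y')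
        have hw : ‖r • y'‖ ≤ r := by
          rw [norm_smul, Real.norm_of_nonneg hr.le]; nlinarith
        have h1 := halfSpaceKernel_add_le (v := z - WithLp.toLp 2 (y, 0)) (w := r • y')
          (ρ := r / z.snd) (by simpa using hz) (by positivity) hρ
          (by simpa [hz.ne'] using hw)
        have h2 : z - WithLp.toLp 2 (y, 0) + r • y' = z + r • y' - WithLp.toLp 2 (y, 0) := by abel
        rw [h2] at h1
        have hpos := add_snd_pos (v := z) (w := r • y') (by linarith)
        have h3 : 0 ≤ halfSpaceKernel (z + r • y' - WithLp.toLp 2 (y, 0)) :=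
          halfSpaceKernel_nonneg (by simpa using hpos.le)
        rw [norm_mul, Real.norm_of_nonneg h3]
        exact mul_le_mul h1 (hB y) (norm_nonneg _) (h3.trans h1)
      · simp [radialWeight_eq_zero (not_lt.1 hy)]
  unfold halfSpaceIntegral
  simp_rw [smul_eq_mul, ← integral_const_mul]
  rw [integral_integral_swap hint]
  congr 1; ext y
  have hmv := HarmonicOnNhd.integral_radialWeight_smul (volume : Measure (AmbientSpace d))
    (u := halfSpaceKernel) (P := z - WithLp.toLp 2 (y, 0)) hr
    (harmonicOnNhd_halfSpaceKernel.mono (fun x hx => by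
      have hx' : x + WithLp.toLp 2 (y, 0) ∈ Metric.closedBall z r := by
        rw [mem_closedBall_iff_norm] at hx ⊢
        convert hx using 2; abel
      have := h hx'
      simpa [upperHalfSpace] using this))
  simp only [smul_eq_mul] at hmv
  rw [← mul_assoc, ← hmv, ← integral_mul_const]
  congr 1; ext y'
  rw [show z - WithLp.toLp 2 (y, 0) + r • y' = z + r • y' - WithLp.toLp 2 (y, 0) by abel]
  ring

theorem harmonicOnNhd_halfSpaceIntegral (hf : Measurable f) (hB : ∀ x, |f x| ≤ B) :
    HarmonicOnNhd (halfSpaceIntegral f) (upperHalfSpace d) :=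
  harmonicOnNhd_of_integral_radialWeight_smul volume isOpen_upperHalfSpace
    (continuousOn_halfSpaceIntegral hf hB)
    (fun _ _ _ hr h => integral_radialWeight_halfSpaceIntegral hf hB hr h)

/-- For bounded continuous boundary values, the Poisson integral extends continuously to the
boundary. -/
lemma continuous_integral_halfSpaceKernel_mul (hf : Continuous f) (hB : ∀ x, |f x| ≤ B) :
    Continuous fun z : AmbientSpace d => ∫ w : EuclideanSpace ℝ (Fin d),
      halfSpaceKernel (WithLp.toLp 2 (w, (1 : ℝ)) : AmbientSpace d) * f (z.fst - z.snd • w) := by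
  have h1 := AmbientSpace.continuous_fst (d := d)
  have h2 := AmbientSpace.continuous_snd (d := d)
  refine continuous_of_dominated (bound := fun w =>
    halfSpaceKernel (WithLp.toLp 2 (w, (1 : ℝ)) : AmbientSpace d) * B) ?_ ?_ ?_ ?_
  · intro z
    exact (integrable_halfSpaceKernel_one.mul_bdd (c := B) (Continuous.aestronglyMeasurable
      (by fun_prop)) (Eventually.of_forall fun w => hB _)).aestronglyMeasurable
  · refine fun z => Eventually.of_forall fun w => ?_
    have h3 : 0 ≤ halfSpaceKernel (WithLp.toLp 2 (w, (1 : ℝ)) : AmbientSpace d) :=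
      halfSpaceKernel_nonneg (by simp)
    rw [norm_mul, Real.norm_of_nonneg h3]
    exact mul_le_mul_of_nonneg_left (hB _) h3
  · exact integrable_halfSpaceKernel_one.mul_const B
  · exact Eventually.of_forall fun w => by fun_prop

lemma enorm_halfSpaceIntegral_le (f : EuclideanSpace ℝ (Fin d) → ℝ)
    (x : EuclideanSpace ℝ (Fin d)) {t : ℝ} (ht : 0 < t) :
    ‖halfSpaceIntegral f (WithLp.toLp 2 (x, t))‖ₑ ≤ ∫⁻ y,
      ENNReal.ofReal (halfSpaceKernel (WithLp.toLp 2 (x - y, t) : AmbientSpace d)) * ‖f y‖ₑ := by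
  refine (enorm_integral_le_lintegral_enorm _).trans (lintegral_mono fun y => ?_)
  have h : (WithLp.toLp 2 (x, t) : AmbientSpace d) - WithLp.toLp 2 (y, 0) =
      WithLp.toLp 2 (x - y, t) := sub_toLp _ y
  rw [enorm_mul, h, Real.enorm_of_nonneg (halfSpaceKernel_nonneg (by simpa using ht.le))]

/-- Minkowski's inequality for the Poisson integral. -/
lemma eLpNorm_halfSpaceIntegral_le (hf : Measurable f) {p : ℝ} (hp : 1 ≤ p) {t : ℝ} (ht : 0 < t) :
    eLpNorm (fun x => halfSpaceIntegral f (WithLp.toLp 2 (x, t))) (ENNReal.ofReal p) volume ≤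
      ENNReal.ofReal (halfSpaceKernelMass d) * eLpNorm f (ENNReal.ofReal p) volume := by
  have hp0 : 0 < p := by linarith
  set c := ENNReal.ofReal (halfSpaceKernelMass d)
  set K : EuclideanSpace ℝ (Fin d) → ℝ≥0∞ := fun v =>
    ENNReal.ofReal (halfSpaceKernel (WithLp.toLp 2 (v, t) : AmbientSpace d)) with hK
  have hKm : Measurable K := (measurable_halfSpaceKernel.comp
    (continuous_toLp.measurable.comp (by fun_prop))).ennreal_ofReal
  have hKi : ∫⁻ v, K v = c := lintegral_halfSpaceKernel_fst ht
  have hpt : ∀ x, ‖halfSpaceIntegral f (WithLp.toLp 2 (x, t))‖ₑ ^ p ≤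
      c ^ (p - 1) * ∫⁻ y, K (x - y) * ‖f y‖ₑ ^ p := by
    intro x
    -- Comparison of the `L¹` and `Lᵖ` norms of `f` for the measure `K (x - y) dy` of finite mass
    -- `c`; integrating the `p`-th power in `x` by Tonelli gives one more factor `c`, hence `c ^ p`
    -- in total.
    set m := volume.withDensity fun y => K (x - y) with hm
    have hKx : Measurable fun y => K (x - y) := hKm.comp (by fun_prop)
    have hmass : m Set.univ = c := by
      rw [hm, withDensity_apply _ MeasurableSet.univ, Measure.restrict_univ, ← hKi]
      exact lintegral_sub_left_eq_self K x
    have h1 := eLpNorm_le_eLpNorm_mul_rpow_measure_univ (μ := m) (f := f) (p := 1)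
      (q := ENNReal.ofReal p) (by simpa using ENNReal.ofReal_le_ofReal hp)
      hf.aestronglyMeasurable
    rw [eLpNorm_one_eq_lintegral_enorm, hmass,
      eLpNorm_eq_lintegral_rpow_enorm_toReal (by simpa using hp0) (by simp),
      ENNReal.toReal_ofReal hp0.le,
      lintegral_withDensity_eq_lintegral_mul _ hKx (by fun_prop),
      lintegral_withDensity_eq_lintegral_mul _ hKx (by fun_prop)] at h1
    have h2 := (enorm_halfSpaceIntegral_le f x ht).trans h1
    have h3 := ENNReal.rpow_le_rpow h2 hp0.le
    rw [ENNReal.mul_rpow_of_nonneg _ _ hp0.le, ← ENNReal.rpow_mul, one_div,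
      inv_mul_cancel₀ hp0.ne', ENNReal.rpow_one, ← ENNReal.rpow_mul, mul_comm] at h3
    have h4 : (1 / ENNReal.toReal 1 - p⁻¹) * p = p - 1 := by simp; field_simp
    rw [h4] at h3
    exact h3
  rw [eLpNorm_eq_lintegral_rpow_enorm_toReal (by simpa using hp0) (by simp),
    eLpNorm_eq_lintegral_rpow_enorm_toReal (by simpa using hp0) (by simp),
    ENNReal.toReal_ofReal hp0.le]
  have hm2 : Measurable fun q : EuclideanSpace ℝ (Fin d) × EuclideanSpace ℝ (Fin d) =>
      K (q.1 - q.2) * ‖f q.2‖ₑ ^ p :=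
    (hKm.comp (by fun_prop)).mul (by fun_prop)
  calc (∫⁻ x, ‖halfSpaceIntegral f (WithLp.toLp 2 (x, t))‖ₑ ^ p) ^ (1 / p)
      ≤ (∫⁻ x, c ^ (p - 1) * ∫⁻ y, K (x - y) * ‖f y‖ₑ ^ p) ^ (1 / p) := by
        gcongr with x; exact hpt x
    _ = (c ^ p * ∫⁻ y, ‖f y‖ₑ ^ p) ^ (1 / p) := by
        congr 1
        rw [lintegral_const_mul _ hm2.lintegral_prod_right', lintegral_lintegral_swap
          hm2.aemeasurable]
        have : ∀ y, ∫⁻ x, K (x - y) * ‖f y‖ₑ ^ p = c * ‖f y‖ₑ ^ p := by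
          intro y
          have hKy : Measurable fun x => K (x - y) := hKm.comp (measurable_id.sub_const y)
          rw [lintegral_mul_const _ hKy, lintegral_sub_right_eq_self K y, hKi]
        simp_rw [this]
        rw [lintegral_const_mul _ (by fun_prop), ← mul_assoc]
        congr 1
        have hc0 : c ≠ 0 := by simpa [c] using halfSpaceKernelMass_pos
        have : c ^ p = c ^ (p - 1 + 1) := by congr 1; ring
        rw [this, ENNReal.rpow_add _ _ hc0 (by simp [c]), ENNReal.rpow_one]
    _ = c * (∫⁻ y, ‖f y‖ₑ ^ p) ^ (1 / p) := by
        rw [ENNReal.mul_rpow_of_nonneg _ _ (by positivity), ← ENNReal.rpow_mul,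
          mul_one_div_cancel hp0.ne', ENNReal.rpow_one]

lemma hardyNorm_halfSpaceIntegral_le (hf : Measurable f) {p : ℝ} (hp : 1 ≤ p) :
    hardyNorm (ENNReal.ofReal p) (fun z => (halfSpaceIntegral f z : ℂ)) ≤
      ENNReal.ofReal (halfSpaceKernelMass d) * eLpNorm f (ENNReal.ofReal p) volume := by
  refine iSup₂_le fun t ht => ?_
  refine le_trans (le_of_eq ?_) (eLpNorm_halfSpaceIntegral_le hf hp ht)
  exact eLpNorm_congr_norm_ae (Eventually.of_forall fun x => by simp)

/-- Over the ball of radius `t = z.snd` about `z.fst` the kernel is at least `t / (2 t) ^ (d + 1)`,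
and the ball has volume proportional to `t ^ d`. The bound is therefore scale invariant, and by
`mem_tent_iff` it applies at points of a tent over a set where `f ≥ a`. -/
lemma le_halfSpaceIntegral (hf : Measurable f) (hB : ∀ x, |f x| ≤ B) (hf0 : ∀ x, 0 ≤ f x)
    {z : AmbientSpace d} (hz : 0 < z.snd) {a : ℝ} (ha : ∀ x ∈ Metric.ball z.fst z.snd, a ≤ f x)
    (ha0 : 0 ≤ a) :
    volume.real (Metric.ball (0 : EuclideanSpace ℝ (Fin d)) 1) / 2 ^ (d + 1) * a ≤
      halfSpaceIntegral f z := by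
  have hint := integrable_halfSpaceKernel_mul hf hB hz
  set t := z.snd
  have hball : volume.real (Metric.ball z.fst t) =
      t ^ d * volume.real (Metric.ball (0 : EuclideanSpace ℝ (Fin d)) 1) := by
    rw [measureReal_def, Measure.addHaar_ball_of_pos _ _ hz, ENNReal.toReal_mul,
      ENNReal.toReal_ofReal (by positivity), ← measureReal_def, finrank_euclideanSpace,
      Fintype.card_fin]
  calc volume.real (Metric.ball (0 : EuclideanSpace ℝ (Fin d)) 1) / 2 ^ (d + 1) * a
      = ∫ y in Metric.ball z.fst t, t / (2 * t) ^ (d + 1) * a := by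
        rw [setIntegral_const, hball, smul_eq_mul, mul_pow, pow_succ t]
        field_simp
    _ ≤ ∫ y in Metric.ball z.fst t, halfSpaceKernel (z - WithLp.toLp 2 (y, 0)) * f y := by
        refine setIntegral_mono_on (integrableOn_const (by simp [measure_ball_lt_top.ne]))
          hint.integrableOn Metric.isOpen_ball.measurableSet fun y hy => ?_
        have hsnd : (z - WithLp.toLp 2 (y, 0)).snd = t := by simp [t]
        have hn : ‖z - WithLp.toLp 2 (y, 0)‖ ≤ 2 * t := by
          refine (AmbientSpace.norm_le_add _).trans ?_
          rw [hsnd, abs_of_pos hz]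
          have : ‖z.fst - y‖ < t := by rw [← dist_eq_norm, dist_comm]; exact hy
          have h2 : (z - WithLp.toLp 2 (y, 0)).fst = z.fst - y := rfl
          rw [h2]
          linarith
        have hn0 : 0 < ‖z - WithLp.toLp 2 (y, 0)‖ := norm_pos_of_snd_pos (by rw [hsnd]; exact hz)
        refine mul_le_mul ?_ (ha y hy) ha0 (halfSpaceKernel_nonneg (by rw [hsnd]; exact hz.le))
        rw [halfSpaceKernel, hsnd]
        gcongr
    _ ≤ halfSpaceIntegral f z := by
        refine setIntegral_le_integral hint (Eventually.of_forall fun y => ?_)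
        exact mul_nonneg (halfSpaceKernel_nonneg (by simpa using hz.le)) (hf0 y)

end PoissonIntegral

/-! ### Tents, cubes and the covering of superlevel sets of the maximal function. -/

section Tents

variable {d : ℕ}

/-- This description of tents by balls is what links them to covering arguments and to the cone
estimates. -/
lemma mem_tent_iff {O : Set (EuclideanSpace ℝ (Fin d))} {z : upperHalfSpace d} :
    z ∈ tent O ↔ Metric.ball z.1.fst z.1.snd ⊆ O := by
  simp only [tent, cone, Set.mem_compl_iff, Set.mem_iUnion, Set.mem_ofPred_eq, not_exists, not_lt]
  constructor
  · intro h x hx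
    by_contra hxO
    have := h x hxO
    rw [mem_ball_iff_norm] at hx
    linarith
  · intro h x hxO
    by_contra hlt
    exact hxO (h (mem_ball_iff_norm.2 (not_le.1 hlt)))

lemma disjoint_tent {O O' : Set (EuclideanSpace ℝ (Fin d))} (h : Disjoint O O') :
    Disjoint (tent O) (tent O') := by
  rw [Set.disjoint_left] at h ⊢
  intro z hz hz'
  have hc : z.1.fst ∈ Metric.ball z.1.fst z.1.snd := Metric.mem_ball_self z.2
  exact h (mem_tent_iff.1 hz hc) (mem_tent_iff.1 hz' hc)

lemma measurableSet_tent (O : Set (EuclideanSpace ℝ (Fin d))) : MeasurableSet (tent O) := by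
  refine (IsOpen.measurableSet ?_).compl
  refine isOpen_iUnion fun x => isOpen_iUnion fun _ => ?_
  have h1 : Continuous fun z : upperHalfSpace d => z.1.fst :=
    AmbientSpace.continuous_fst.comp continuous_subtype_val
  have h2 : Continuous fun z : upperHalfSpace d => z.1.snd :=
    AmbientSpace.continuous_snd.comp continuous_subtype_val
  exact isOpen_lt (by fun_prop) h2

lemma openCube_eq (a : EuclideanSpace ℝ (Fin d)) (l : ℝ) :
    openCube a l = WithLp.ofLp ⁻¹' (Set.univ.pi fun i => Set.Ioo (a i) (a i + l)) := by
  ext x; simp [openCube]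

lemma isOpen_openCube (a : EuclideanSpace ℝ (Fin d)) (l : ℝ) : IsOpen (openCube a l) := by
  rw [openCube_eq]
  exact (isOpen_set_pi Set.finite_univ fun _ _ => isOpen_Ioo).preimage
    (PiLp.continuous_ofLp 2 _)

lemma volume_openCube (a : EuclideanSpace ℝ (Fin d)) (l : ℝ) :
    volume (openCube a l) = ENNReal.ofReal l ^ d := by
  rw [openCube_eq]
  refine ((EuclideanSpace.volume_preserving_symm_measurableEquiv_toLp (Fin d)).measure_preimage
    (MeasurableSet.univ_pi fun _ => measurableSet_Ioo).nullMeasurableSet).trans ?_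
  simp [Real.volume_pi_Ioo]

lemma volume_openCube_ne_top (a : EuclideanSpace ℝ (Fin d)) (l : ℝ) :
    volume (openCube a l) ≠ ∞ := by
  rw [volume_openCube]; simp

lemma volume_openCube_ne_zero (a : EuclideanSpace ℝ (Fin d)) {l : ℝ} (hl : 0 < l) :
    volume (openCube a l) ≠ 0 := by
  rw [volume_openCube]; simp [hl]

/-- A cube of side at most `2 m` meeting one of side `m` protrudes by at most `2 m` on each side,
whence the factor `5 = 1 + 2 + 2`. -/
lemma openCube_subset_enlargement {a b : EuclideanSpace ℝ (Fin d)} {l m : ℝ}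
    (h : (openCube a l ∩ openCube b m).Nonempty) (hlm : l ≤ 2 * m) :
    openCube a l ⊆ openCube (WithLp.toLp 2 fun i => b i - 2 * m) (5 * m) := by
  obtain ⟨x, hx1, hx2⟩ := h
  intro z hz i
  have h1 := hx1 i
  have h2 := hx2 i
  have h3 := hz i
  constructor
  · simp only; linarith
  · simp only; linarith

lemma lt_feffermanSteinMaximal_iff {μ : Measure (upperHalfSpace d)}
    {x : EuclideanSpace ℝ (Fin d)} {c : ℝ≥0∞} :
    c < feffermanSteinMaximal μ x ↔ ∃ (a : EuclideanSpace ℝ (Fin d)) (l : ℝ), 0 < l ∧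
      x ∈ openCube a l ∧ c < μ (tent (openCube a l)) / volume (openCube a l) := by
  simp only [feffermanSteinMaximal, lt_iSup_iff, exists_prop]

/-- The supremum is uncentred over open cubes, so a cube that witnesses the inequality at `x`
witnesses it at every point of that cube. -/
lemma isOpen_lt_feffermanSteinMaximal (μ : Measure (upperHalfSpace d)) (c : ℝ≥0∞) :
    IsOpen {x | c < feffermanSteinMaximal μ x} := by
  rw [isOpen_iff_mem_nhds]
  intro x hx
  obtain ⟨a, l, hl, hxa, h⟩ := lt_feffermanSteinMaximal_iff.1 hx
  filter_upwards [(isOpen_openCube a l).mem_nhds hxa] with y hy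
  exact lt_feffermanSteinMaximal_iff.2 ⟨a, l, hl, hy, h⟩

lemma measurable_feffermanSteinMaximal (μ : Measure (upperHalfSpace d)) :
    Measurable (feffermanSteinMaximal μ) :=
  measurable_of_Ioi fun c => (isOpen_lt_feffermanSteinMaximal μ c).measurableSet

lemma measure_tent_le_feffermanSteinMaximal_mul (μ : Measure (upperHalfSpace d))
    {x a : EuclideanSpace ℝ (Fin d)} {l : ℝ} (hl : 0 < l) (hx : x ∈ openCube a l) :
    μ (tent (openCube a l)) ≤ feffermanSteinMaximal μ x * volume (openCube a l) := by
  rw [← ENNReal.div_le_iff (volume_openCube_ne_zero a hl) (volume_openCube_ne_top a l)]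
  unfold feffermanSteinMaximal
  exact le_iSup_of_le a (le_iSup_of_le l (le_iSup_of_le hl (le_iSup_of_le hx le_rfl)))

/-- A compact subset of a superlevel set of the maximal function is covered, up to dilation, by
finitely many disjoint cubes on which the quotient is large. -/
lemma exists_finset_openCube_of_isCompact (μ : Measure (upperHalfSpace d)) {c : ℝ≥0∞}
    {K : Set (EuclideanSpace ℝ (Fin d))} (hK : IsCompact K)
    (hKc : K ⊆ {x | c < feffermanSteinMaximal μ x}) :
    ∃ J : Finset (EuclideanSpace ℝ (Fin d) × ℝ),
      (J : Set (EuclideanSpace ℝ (Fin d) × ℝ)).PairwiseDisjoint (fun Q => openCube Q.1 Q.2) ∧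
      (∀ Q ∈ J, c * volume (openCube Q.1 Q.2) ≤ μ (tent (openCube Q.1 Q.2))) ∧
      volume K ≤ 5 ^ d * ∑ Q ∈ J, volume (openCube Q.1 Q.2) := by
  let I : Set (EuclideanSpace ℝ (Fin d) × ℝ) := {Q | 0 < Q.2 ∧
    c < μ (tent (openCube Q.1 Q.2)) / volume (openCube Q.1 Q.2)}
  obtain ⟨t, htI, htf, hcov⟩ := hK.elim_finite_subcover_image (b := I)
    (c := fun Q => openCube Q.1 Q.2) (fun Q _ => isOpen_openCube _ _) (fun x hx => by
      obtain ⟨a, l, hl, hxa, h⟩ := lt_feffermanSteinMaximal_iff.1 (hKc hx)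
      exact Set.mem_biUnion (show (a, l) ∈ I from ⟨hl, h⟩) hxa)
  obtain ⟨R, hR⟩ := (htf.image Prod.snd).bddAbove
  let t' := {Q ∈ t | (openCube Q.1 Q.2).Nonempty}
  obtain ⟨u, hut, hdisj, hu⟩ := Vitali.exists_disjoint_subfamily_covering_enlargement
    (fun Q : EuclideanSpace ℝ (Fin d) × ℝ => openCube Q.1 Q.2) t' (fun Q => Q.2) 2 one_lt_two
    (fun Q hQ => (htI hQ.1).1.le) R (fun Q hQ => hR ⟨Q, hQ.1, rfl⟩) (fun Q hQ => hQ.2)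
  have huf : u.Finite := htf.subset (hut.trans fun Q hQ => hQ.1)
  refine ⟨huf.toFinset, by simpa using hdisj, fun Q hQ => ?_, ?_⟩
  · have hQI := htI (hut (huf.mem_toFinset.1 hQ)).1
    rw [← ENNReal.le_div_iff_mul_le (Or.inl (volume_openCube_ne_zero _ hQI.1))
      (Or.inl (volume_openCube_ne_top _ _))]
    exact hQI.2.le
  · have hsub : K ⊆ ⋃ Q ∈ huf.toFinset,
        openCube (WithLp.toLp 2 fun i => Q.1 i - 2 * Q.2) (5 * Q.2) := by
      intro x hx
      obtain ⟨Q, hQt, hxQ⟩ := Set.mem_iUnion₂.1 (hcov hx)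
      obtain ⟨Q', hQ'u, hne, hle⟩ := hu Q ⟨hQt, x, hxQ⟩
      exact Set.mem_iUnion₂.2 ⟨Q', huf.mem_toFinset.2 hQ'u,
        openCube_subset_enlargement hne hle hxQ⟩
    refine (measure_mono hsub).trans ((measure_biUnion_finset_le _ _).trans (le_of_eq ?_))
    rw [Finset.mul_sum]
    refine Finset.sum_congr rfl fun Q _ => ?_
    rw [volume_openCube, volume_openCube, ENNReal.ofReal_mul (by norm_num), mul_pow]
    norm_num

end Tents

/-! ### A geometric sum and an absorption inequality. -/

section Necessity

/-- For `ρ > 1` a sum of powers with exponents at most `k₀` is controlled by `ρ ^ k₀`, whatever the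
number of terms; this lets the top level stand for all levels at a point. -/
lemma sum_zpow_le_of_forall_le {ρ : ℝ} (hρ : 1 < ρ) (S : Finset ℤ) (k₀ : ℤ) (hS : ∀ k ∈ S, k ≤ k₀) :
    ∑ k ∈ S, ρ ^ k ≤ (1 - ρ⁻¹)⁻¹ * ρ ^ k₀ := by
  have hρ0 : 0 < ρ := by linarith
  have h1 : ∀ k ∈ S, ρ ^ k = ρ⁻¹ ^ (k₀ - k).toNat * ρ ^ k₀ := by
    intro k hk
    have : ((k₀ - k).toNat : ℤ) = k₀ - k := Int.toNat_of_nonneg (by linarith [hS k hk])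
    rw [← zpow_natCast, this, inv_zpow, ← zpow_neg, ← zpow_add₀ hρ0.ne']
    congr 1; ring
  rw [Finset.sum_congr rfl h1, ← Finset.sum_mul]
  refine mul_le_mul_of_nonneg_right ?_ (by positivity)
  have hinj : Set.InjOn (fun k : ℤ => (k₀ - k).toNat) S := by
    intro a ha b hb hab
    have := hS a ha; have := hS b hb
    simp only at hab
    omega
  rw [← Finset.sum_image (f := fun n : ℕ => ρ⁻¹ ^ n) hinj,
    ← tsum_geometric_of_lt_one (by positivity) (inv_lt_one_of_one_lt₀ hρ)]
  exact (summable_geometric_of_lt_one (by positivity) (inv_lt_one_of_one_lt₀ hρ)).sum_le_tsum _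
    (fun _ _ => by positivity)

variable {d : ℕ}

/-- Division by `X ^ (1 / α)` leaves `X ^ (1 / β) ≤ C`. Finiteness of `X` is essential, which is why
the packing estimate is proved for finite families with a constant independent of them. -/
lemma ENNReal.le_of_le_mul_rpow {X C : ℝ≥0∞} {α β : ℝ} (hα : 1 < α) (hαβ : 1 / α + 1 / β = 1)
    (hX : X ≠ ∞) (h : X ≤ C * X ^ (1 / α)) : X ≤ C ^ β := by
  have hα' : 1 / α < 1 := by rw [div_lt_one (by linarith)]; exact hα
  have hβ : 0 < β := by
    have : 0 < 1 / β := by linarith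
    simpa using this
  rcases eq_or_ne X 0 with rfl | hX0
  · simp
  have h1 : X ^ (1 / β) ≤ C := by
    have h2 : X ^ (1 / β) * X ^ (1 / α) ≤ C * X ^ (1 / α) := by
      rw [← ENNReal.rpow_add _ _ hX0 hX, add_comm, hαβ, ENNReal.rpow_one]; exact h
    rwa [ENNReal.mul_le_mul_iff_left (by simp [hX0, hX]) (by simp [hX0, hX])] at h2
  have h3 := ENNReal.rpow_le_rpow h1 hβ.le
  rwa [← ENNReal.rpow_mul, one_div_mul_cancel hβ.ne', ENNReal.rpow_one] at h3

end Necessity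

/-! ### Necessity: testing the embedding on step functions over families of cubes. -/

section Necessity

variable {d : ℕ}

/-- The union of the cubes of a finite family. -/
def cubeUnion (J : Finset (EuclideanSpace ℝ (Fin d) × ℝ)) : Set (EuclideanSpace ℝ (Fin d)) :=
  ⋃ Q ∈ J, openCube Q.1 Q.2

/-- The union of the tents over the cubes of a finite family. -/
def tentUnion (J : Finset (EuclideanSpace ℝ (Fin d) × ℝ)) : Set (upperHalfSpace d) :=
  ⋃ Q ∈ J, tent (openCube Q.1 Q.2)

lemma measurableSet_cubeUnion (J : Finset (EuclideanSpace ℝ (Fin d) × ℝ)) :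
    MeasurableSet (cubeUnion J) :=
  (isOpen_biUnion fun _ _ => isOpen_openCube _ _).measurableSet

lemma measurableSet_tentUnion (J : Finset (EuclideanSpace ℝ (Fin d) × ℝ)) :
    MeasurableSet (tentUnion J) :=
  J.measurableSet_biUnion fun _ _ => measurableSet_tent _

lemma ball_subset_cubeUnion {J : Finset (EuclideanSpace ℝ (Fin d) × ℝ)} {z : upperHalfSpace d}
    (hz : z ∈ tentUnion J) : Metric.ball z.1.fst z.1.snd ⊆ cubeUnion J := by
  obtain ⟨Q, hQ, hzQ⟩ := Set.mem_iUnion₂.1 hz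
  exact (mem_tent_iff.1 hzQ).trans (Set.subset_biUnion_of_mem (u := fun Q => openCube Q.1 Q.2) hQ)

/-- The step function `sup_{k ∈ S} b k * 1_{∪ J k}`. -/
noncomputable def stepSup (S : Finset ℤ) (J : ℤ → Finset (EuclideanSpace ℝ (Fin d) × ℝ))
    (b : ℤ → ℝ≥0) (x : EuclideanSpace ℝ (Fin d)) : ℝ≥0 :=
  S.sup fun k => (cubeUnion (J k)).indicator (fun _ => b k) x

variable {S : Finset ℤ} {J : ℤ → Finset (EuclideanSpace ℝ (Fin d) × ℝ)} {b : ℤ → ℝ≥0}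

lemma measurable_stepSup : Measurable (stepSup S J b) := by
  have : stepSup S J b = S.sup fun k => (cubeUnion (J k)).indicator (fun _ => b k) := by
    ext x; simp [stepSup, Finset.sup_apply]
  rw [this]
  exact Finset.sup_induction measurable_const (fun _ h _ h' => h.sup h')
    fun k _ => measurable_const.indicator (measurableSet_cubeUnion _)

lemma stepSup_le (x : EuclideanSpace ℝ (Fin d)) : stepSup S J b x ≤ S.sup b :=
  Finset.sup_mono_fun fun _ _ => Set.indicator_le_self' (fun _ _ => zero_le) x

lemma le_stepSup {k : ℤ} (hk : k ∈ S) {x : EuclideanSpace ℝ (Fin d)} (hx : x ∈ cubeUnion (J k)) :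
    b k ≤ stepSup S J b x := by
  have h := Finset.le_sup (f := fun k => (cubeUnion (J k)).indicator (fun _ => b k) x) hk
  rwa [Set.indicator_of_mem hx] at h

/-- The supremum is attained at one level, and the power of that value is one term of the sum; cubes
of different levels may overlap freely. -/
lemma stepSup_rpow_le (x : EuclideanSpace ℝ (Fin d)) {p : ℝ} (hp : 0 < p) :
    (stepSup S J b x : ℝ≥0∞) ^ p ≤
      ∑ k ∈ S, (cubeUnion (J k)).indicator (fun _ => (b k : ℝ≥0∞) ^ p) x := by
  rcases S.eq_empty_or_nonempty with rfl | hS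
  · simp [stepSup, hp]
  obtain ⟨k, hk, hkS⟩ := S.exists_mem_eq_sup hS
    fun k => (cubeUnion (J k)).indicator (fun _ => b k) x
  rw [stepSup, hkS]
  refine le_trans (le_of_eq ?_) (Finset.single_le_sum
    (f := fun k => (cubeUnion (J k)).indicator (fun _ => (b k : ℝ≥0∞) ^ p) x)
    (fun _ _ => zero_le) hk)
  by_cases hx : x ∈ cubeUnion (J k)
  · simp [hx]
  · simp [hx, hp]

lemma lintegral_stepSup_rpow_le {p : ℝ} (hp : 0 < p) :
    ∫⁻ x, (stepSup S J b x : ℝ≥0∞) ^ p ≤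
      ∑ k ∈ S, (b k : ℝ≥0∞) ^ p * ∑ Q ∈ J k, volume (openCube Q.1 Q.2) := by
  refine (lintegral_mono fun x => stepSup_rpow_le x hp).trans ?_
  rw [lintegral_finsetSum _ fun k _ => measurable_const.indicator (measurableSet_cubeUnion _)]
  refine Finset.sum_le_sum fun k _ => ?_
  rw [lintegral_indicator_const (measurableSet_cubeUnion _)]
  gcongr
  exact measure_biUnion_finset_le _ _

/-- The main packing estimate: the cubes on which `μ (T Q) ≥ 2ᵏ |Q|` are summable with weights. -/
lemma sum_volume_openCube_le {α β q : ℝ} (hα : 1 < α) (hαβ : 1 / α + 1 / β = 1) (hq : 1 ≤ q)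
    {μ : Measure (upperHalfSpace d)} {M : ℝ≥0}
    (hM : ∀ u : AmbientSpace d → ℂ, MemHardy (ENNReal.ofReal (α * q)) u →
      eLpNorm (fun z : upperHalfSpace d => u z) (ENNReal.ofReal q) μ
        ≤ M * hardyNorm (ENNReal.ofReal (α * q)) u) :
    ∃ C : ℝ≥0, ∀ (S : Finset ℤ) (J : ℤ → Finset (EuclideanSpace ℝ (Fin d) × ℝ)),
      (∀ k ∈ S, (J k : Set (EuclideanSpace ℝ (Fin d) × ℝ)).PairwiseDisjoint
        (fun Q => openCube Q.1 Q.2)) →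
      (∀ k ∈ S, ∀ Q ∈ J k, (((2 : ℝ≥0) ^ k : ℝ≥0) : ℝ≥0∞) * volume (openCube Q.1 Q.2) ≤
        μ (tent (openCube Q.1 Q.2))) →
      ∑ k ∈ S, (((2 : ℝ≥0) ^ k * ((2 : ℝ≥0) ^ (β - 1)) ^ k : ℝ≥0) : ℝ≥0∞) *
        ∑ Q ∈ J k, volume (openCube Q.1 Q.2) ≤ C := by
  have hα0 : 0 < α := by linarith
  have hq0 : 0 < q := by linarith
  have hαq : 0 < α * q := by positivity
  have hβ1 : 1 < β := by
    have h1 : 1 / α < 1 := by rw [div_lt_one hα0]; exact hα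
    have h2 : 0 < 1 / β := by linarith
    have h3 : 0 < β := by simpa using h2
    have h4 : 1 / β < 1 := by have : 0 < 1 / α := by positivity
                              linarith
    rwa [div_lt_one h3] at h4
  have hβα : (β - 1) * α = β := by
    have : β ≠ 0 := by linarith
    field_simp at hαβ
    linarith
  -- This base satisfies `ρ ^ α = 2 * ρ`, equivalently `(β - 1) α = β`. It makes the norm of the
  -- test function and the weight `2 ^ k * ρ ^ k` of the packing sum agree.
  set ρ : ℝ≥0 := (2 : ℝ≥0) ^ (β - 1) with hρdef
  have hρ : 1 < ρ := NNReal.one_lt_rpow one_lt_two (by linarith)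
  have hραk : ∀ k : ℤ, (ρ ^ k) ^ α = 2 ^ k * ρ ^ k := by
    intro k
    have h1 : ρ ^ α = 2 * ρ := by
      rw [hρdef, ← NNReal.rpow_mul, hβα]
      conv_rhs => rw [← NNReal.rpow_one_add' (x := 2) (y := β - 1) (by linarith)]
      congr 1; ring
    rw [← mul_zpow, ← h1, ← NNReal.rpow_intCast ρ, ← NNReal.rpow_intCast (ρ ^ α),
      ← NNReal.rpow_mul ρ, ← NNReal.rpow_mul ρ, mul_comm]
  set κ : ℝ := volume.real (Metric.ball (0 : EuclideanSpace ℝ (Fin d)) 1) / 2 ^ (d + 1) with hκ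
  have hκ0 : 0 < κ := by
    refine div_pos (ENNReal.toReal_pos (Metric.measure_ball_pos _ _ one_pos).ne'
      measure_ball_lt_top.ne) (by positivity)
  set g : ℝ≥0∞ := ENNReal.ofReal ((1 - (ρ : ℝ)⁻¹)⁻¹) with hg
  set c := ENNReal.ofReal (halfSpaceKernelMass d) with hc
  set C₀ : ℝ≥0∞ := g * (ENNReal.ofReal κ)⁻¹ ^ q * (M * c) ^ q with hC₀
  have hC₀top : C₀ ≠ ∞ := by
    refine ENNReal.mul_ne_top (ENNReal.mul_ne_top (by simp [hg]) ?_) ?_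
    · exact ENNReal.rpow_ne_top_of_nonneg hq0.le (by simp [hκ0])
    · exact ENNReal.rpow_ne_top_of_nonneg hq0.le (by simp [hc, ENNReal.mul_eq_top])
  refine ⟨(C₀ ^ β).toNNReal, fun S J hdisj hbig => ?_⟩
  rw [ENNReal.coe_toNNReal (ENNReal.rpow_ne_top_of_nonneg (by linarith) hC₀top)]
  set X := ∑ k ∈ S, (((2 : ℝ≥0) ^ k * ρ ^ k : ℝ≥0) : ℝ≥0∞) *
        ∑ Q ∈ J k, volume (openCube Q.1 Q.2) with hX
  have hXtop : X ≠ ∞ := by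
    refine ENNReal.sum_ne_top.2 fun k _ => ENNReal.mul_ne_top ENNReal.coe_ne_top
      (ENNReal.sum_ne_top.2 fun Q _ => volume_openCube_ne_top _ _)
  refine ENNReal.le_of_le_mul_rpow hα hαβ hXtop ?_
  -- The heights satisfy `b k ^ q = ρ ^ k`, the weight needed on the tents, and `b k ^ (α * q) = 2 ^
  -- k * ρ ^ k`, the weight occurring in `X`.
  set b : ℤ → ℝ≥0 := fun k => (ρ ^ k) ^ (1 / q) with hb
  set f : EuclideanSpace ℝ (Fin d) → ℝ := fun x => (stepSup S J b x : ℝ) with hf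
  have hfm : Measurable f := measurable_stepSup.coe_nnreal_real
  have hfB : ∀ x, |f x| ≤ (S.sup b : ℝ≥0) := fun x => by
    rw [hf, NNReal.abs_eq]; exact_mod_cast stepSup_le x
  have hbpow : ∀ k, (b k : ℝ≥0∞) ^ (α * q) = ((2 ^ k * ρ ^ k : ℝ≥0) : ℝ≥0∞) := by
    intro k
    rw [← ENNReal.coe_rpow_of_nonneg _ hαq.le, hb, ← hραk k, ← NNReal.rpow_mul]
    congr 2; field_simp
  have hfnorm : eLpNorm f (ENNReal.ofReal (α * q)) volume ≤ X ^ (1 / (α * q)) := by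
    rw [eLpNorm_eq_lintegral_rpow_enorm_toReal (by simpa using hαq) (by simp),
      ENNReal.toReal_ofReal hαq.le]
    gcongr
    have h1 : ∀ x, ‖f x‖ₑ = (stepSup S J b x : ℝ≥0∞) := fun x => by
      rw [hf]; simp
    simp_rw [h1]
    refine (lintegral_stepSup_rpow_le hαq).trans (le_of_eq ?_)
    simp_rw [hbpow]
    rfl
  have hH := hardyNorm_halfSpaceIntegral_le hfm (p := α * q) (by nlinarith)
  have hmem : MemHardy (ENNReal.ofReal (α * q)) fun z : AmbientSpace d =>
      (halfSpaceIntegral f z : ℂ) := by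
    refine ⟨(harmonicOnNhd_halfSpaceIntegral hfm hfB).comp_CLM Complex.ofRealCLM, ?_⟩
    refine hH.trans_lt (ENNReal.mul_lt_top (by simp) (hfnorm.trans_lt ?_))
    exact ENNReal.rpow_lt_top_of_nonneg (by positivity) hXtop
  have hemb : ∫⁻ z : upperHalfSpace d, ‖(halfSpaceIntegral f z : ℂ)‖ₑ ^ q ∂μ ≤
      (M * c) ^ q * X ^ (1 / α) := by
    have h1 := hM _ hmem
    rw [eLpNorm_eq_lintegral_rpow_enorm_toReal (by simpa using hq0) (by simp),
      ENNReal.toReal_ofReal hq0.le] at h1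
    have h2 := ENNReal.rpow_le_rpow (h1.trans (mul_le_mul_right (hH.trans
      (mul_le_mul_right hfnorm _)) _)) hq0.le
    rw [← ENNReal.rpow_mul, one_div_mul_cancel hq0.ne', ENNReal.rpow_one, ← mul_assoc,
      ENNReal.mul_rpow_of_nonneg _ _ hq0.le, ← ENNReal.rpow_mul] at h2
    convert h2 using 3
    field_simp
  -- Only the highest level `k₀` whose tents contain `z` matters: the sum is at most `g * ρ ^ k₀`,
  -- and the Poisson integral at `z` is at least `κ * b k₀`.
  have hpt : ∀ z : upperHalfSpace d,
      ∑ k ∈ S, (tentUnion (J k)).indicator (fun _ => ((ρ ^ k : ℝ≥0) : ℝ≥0∞)) z ≤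
        g * (ENNReal.ofReal κ)⁻¹ ^ q * ‖(halfSpaceIntegral f z : ℂ)‖ₑ ^ q := by
    classical
    intro z
    set S' := S.filter fun k => z ∈ tentUnion (J k) with hS'
    have hsum : ∑ k ∈ S, (tentUnion (J k)).indicator (fun _ => ((ρ ^ k : ℝ≥0) : ℝ≥0∞)) z =
        ∑ k ∈ S', ((ρ ^ k : ℝ≥0) : ℝ≥0∞) := by
      rw [hS', Finset.sum_filter]
      exact Finset.sum_congr rfl fun k _ => by rw [Set.indicator_apply]
    rw [hsum]
    rcases S'.eq_empty_or_nonempty with he | hne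
    · simp [he]
    set k₀ := S'.max' hne
    have hk₀ : k₀ ∈ S ∧ z ∈ tentUnion (J k₀) :=
      Finset.mem_filter.1 (S'.max'_mem hne)
    have h1 : ∑ k ∈ S', ((ρ ^ k : ℝ≥0) : ℝ≥0∞) ≤ g * ((ρ ^ k₀ : ℝ≥0) : ℝ≥0∞) := by
      have h := sum_zpow_le_of_forall_le (ρ := (ρ : ℝ)) (by exact_mod_cast hρ) S' k₀
        fun k hk => S'.le_max' k hk
      have h2 := ENNReal.ofReal_le_ofReal h
      have hρ0 : 0 ≤ (1 - (ρ : ℝ)⁻¹)⁻¹ := by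
        have : (ρ : ℝ)⁻¹ < 1 := inv_lt_one_of_one_lt₀ (by exact_mod_cast hρ)
        rw [inv_nonneg]; linarith
      rw [ENNReal.ofReal_mul hρ0, ENNReal.ofReal_sum_of_nonneg (fun _ _ => by positivity)] at h2
      have h3 : ∀ k : ℤ, ENNReal.ofReal ((ρ : ℝ) ^ k) = ((ρ ^ k : ℝ≥0) : ℝ≥0∞) := by
        intro k
        rw [← NNReal.coe_zpow, ENNReal.ofReal_coe_nnreal]
      simpa only [h3] using h2
    have h2 : κ * (b k₀ : ℝ) ≤ halfSpaceIntegral f z :=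
      le_halfSpaceIntegral hfm hfB (fun x => by rw [hf]; positivity) z.2
        (fun x hx => by
          rw [hf]; exact_mod_cast le_stepSup hk₀.1 (ball_subset_cubeUnion hk₀.2 hx)) (by positivity)
    have h3 : ENNReal.ofReal κ * (b k₀ : ℝ≥0∞) ≤ ‖(halfSpaceIntegral f z : ℂ)‖ₑ := by
      have h0 : 0 ≤ halfSpaceIntegral f z := le_trans (by positivity) h2
      have h4 : ‖(halfSpaceIntegral f z : ℂ)‖ₑ = ENNReal.ofReal (halfSpaceIntegral f z) := by
        rw [← Real.enorm_of_nonneg h0]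
        simp [enorm_eq_nnnorm]
      rw [h4, ← ENNReal.ofReal_coe_nnreal, ← ENNReal.ofReal_mul hκ0.le]
      exact ENNReal.ofReal_le_ofReal h2
    have h5 : ((ρ ^ k₀ : ℝ≥0) : ℝ≥0∞) = (b k₀ : ℝ≥0∞) ^ q := by
      rw [← ENNReal.coe_rpow_of_nonneg _ hq0.le, hb, ← NNReal.rpow_mul, one_div_mul_cancel hq0.ne',
        NNReal.rpow_one]
    refine h1.trans ?_
    rw [mul_assoc, ← ENNReal.mul_rpow_of_nonneg _ _ hq0.le, h5]
    gcongr
    rw [mul_comm, ← div_eq_mul_inv, ENNReal.le_div_iff_mul_le (by simp [hκ0]) (by simp), mul_comm]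
    exact h3
  -- The factor `2 ^ k` of the weight is spent on `2 ^ k * |Q| ≤ μ (T Q)`; disjoint cubes have
  -- disjoint tents, so these measures add up within each level.
  calc X ≤ ∑ k ∈ S, ((ρ ^ k : ℝ≥0) : ℝ≥0∞) * μ (tentUnion (J k)) := by
        refine Finset.sum_le_sum fun k hk => ?_
        rw [ENNReal.coe_mul, mul_comm (((2 : ℝ≥0) ^ k : ℝ≥0) : ℝ≥0∞), mul_assoc]
        gcongr
        rw [tentUnion, measure_biUnion_finset (fun Q hQ Q' hQ' hne => disjoint_tent
          (hdisj k hk hQ hQ' hne)) (fun Q _ => measurableSet_tent _), Finset.mul_sum]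
        exact Finset.sum_le_sum fun Q hQ => hbig k hk Q hQ
    _ = ∫⁻ z, ∑ k ∈ S, (tentUnion (J k)).indicator (fun _ => ((ρ ^ k : ℝ≥0) : ℝ≥0∞)) z ∂μ := by
        rw [lintegral_finsetSum _ fun k _ =>
          measurable_const.indicator (measurableSet_tentUnion _)]
        simp_rw [lintegral_indicator_const (measurableSet_tentUnion _)]
    _ ≤ ∫⁻ z : upperHalfSpace d, g * (ENNReal.ofReal κ)⁻¹ ^ q *
          ‖(halfSpaceIntegral f z : ℂ)‖ₑ ^ q ∂μ := lintegral_mono hpt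
    _ = g * (ENNReal.ofReal κ)⁻¹ ^ q *
          ∫⁻ z : upperHalfSpace d, ‖(halfSpaceIntegral f z : ℂ)‖ₑ ^ q ∂μ := by
        refine lintegral_const_mul' _ _ (ENNReal.mul_ne_top (by simp [hg]) ?_)
        exact ENNReal.rpow_ne_top_of_nonneg hq0.le (by simp [hκ0])
    _ ≤ g * (ENNReal.ofReal κ)⁻¹ ^ q * ((M * c) ^ q * X ^ (1 / α)) := by gcongr
    _ = C₀ * X ^ (1 / α) := by rw [hC₀]; ring

/-- A dyadic layer cake bound. If `2 ^ k < t ≤ 2 ^ (k + 1)`, the single term of index `k`, equal to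
`2 ^ (k β)`, already gives `t ^ β` up to `2 ^ β`. For `t = ∞` the terms are unbounded. -/
lemma rpow_le_tsum_indicator {β : ℝ} (hβ : 1 < β) (t : ℝ≥0∞) :
    t ^ β ≤ (2 : ℝ≥0∞) ^ β * ∑' k : ℤ, {s : ℝ≥0∞ | (((2 : ℝ≥0) ^ k : ℝ≥0) : ℝ≥0∞) < s}.indicator
      (fun _ => (((2 : ℝ≥0) ^ k * ((2 : ℝ≥0) ^ (β - 1)) ^ k : ℝ≥0) : ℝ≥0∞)) t := by
  have hw : ∀ k : ℤ, (((2 : ℝ≥0) ^ k * ((2 : ℝ≥0) ^ (β - 1)) ^ k : ℝ≥0) : ℝ≥0∞) =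
      ((2 : ℝ≥0∞) ^ k) ^ β := by
    intro k
    have : (2 : ℝ≥0) ^ k * ((2 : ℝ≥0) ^ (β - 1)) ^ k = ((2 : ℝ≥0) ^ k) ^ β := by
      rw [← NNReal.rpow_intCast, ← NNReal.rpow_intCast, ← NNReal.rpow_mul, ← NNReal.rpow_mul,
        ← NNReal.rpow_add (by norm_num)]
      congr 1; ring
    rw [this, ENNReal.coe_rpow_of_nonneg _ (by linarith), ENNReal.coe_zpow (by norm_num)]
    rfl
  have hz : ∀ k : ℤ, (((2 : ℝ≥0) ^ k : ℝ≥0) : ℝ≥0∞) = (2 : ℝ≥0∞) ^ k := fun k => by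
    rw [ENNReal.coe_zpow (by norm_num)]; rfl
  simp_rw [hw, hz]
  rcases eq_or_ne t 0 with rfl | ht0
  · simp [show 0 < β by linarith]
  rcases eq_or_ne t ∞ with rfl | ht
  · have : ∑' k : ℤ, {s : ℝ≥0∞ | (2 : ℝ≥0∞) ^ k < s}.indicator
        (fun _ => ((2 : ℝ≥0∞) ^ k) ^ β) ∞ = ∞ := by
      refine ENNReal.eq_top_of_forall_nnreal_le fun r => ?_
      obtain ⟨n, hn⟩ := exists_nat_ge r
      refine le_trans ?_ (ENNReal.le_tsum (n : ℤ))
      have hlt : (2 : ℝ≥0∞) ^ (n : ℤ) < ∞ := by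
        rw [zpow_natCast]; exact ENNReal.pow_lt_top (by simp)
      rw [Set.indicator_of_mem (by exact hlt)]
      have h1 : (r : ℝ≥0∞) ≤ (2 : ℝ≥0∞) ^ (n : ℤ) := by
        rw [zpow_natCast]
        refine le_trans (by exact_mod_cast hn : (r : ℝ≥0∞) ≤ (n : ℝ≥0∞)) ?_
        exact_mod_cast (Nat.lt_two_pow_self (n := n)).le
      refine h1.trans (ENNReal.le_rpow_self_of_one_le ?_ hβ.le)
      rw [zpow_natCast]
      exact one_le_pow₀ (by norm_num)
    rw [this, ENNReal.mul_top (by simp)]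
    exact le_top
  · obtain ⟨k, hk1, hk2⟩ := ENNReal.exists_mem_Ioc_zpow ht0 ht (y := 2) (by norm_num) (by simp)
    calc t ^ β ≤ ((2 : ℝ≥0∞) ^ (k + 1)) ^ β := by gcongr
      _ = (2 : ℝ≥0∞) ^ β * ((2 : ℝ≥0∞) ^ k) ^ β := by
        rw [← ENNReal.mul_rpow_of_nonneg _ _ (by linarith), ENNReal.zpow_add (by norm_num) (by simp),
          zpow_one, mul_comm]
      _ ≤ _ := by
        gcongr
        refine le_trans (le_of_eq ?_) (ENNReal.le_tsum k)
        rw [Set.indicator_of_mem (by exact hk1)]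

theorem memLp_feffermanSteinMaximal_of_isEmbeddingCarleson {α β q : ℝ} (hα : 1 < α)
    (hαβ : 1 / α + 1 / β = 1) (hq : 1 ≤ q) {μ : Measure (upperHalfSpace d)}
    (h : IsEmbeddingCarleson α q μ) :
    MemLp (feffermanSteinMaximal μ) (ENNReal.ofReal β) volume := by
  have hβ1 : 1 < β := by
    have hα0 : 0 < α := by linarith
    have h1 : 1 / α < 1 := by rw [div_lt_one hα0]; exact hα
    have h2 : 0 < 1 / β := by linarith
    have h3 : 0 < β := by simpa using h2
    have h4 : 1 / β < 1 := by have : 0 < 1 / α := by positivity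
                              linarith
    rwa [div_lt_one h3] at h4
  obtain ⟨M, hM⟩ := h
  obtain ⟨C, hC⟩ := sum_volume_openCube_le hα hαβ hq hM
  refine ⟨(measurable_feffermanSteinMaximal μ).aestronglyMeasurable, ?_⟩
  rw [eLpNorm_eq_lintegral_rpow_enorm_toReal (by simp; linarith) (by simp),
    ENNReal.toReal_ofReal (by linarith)]
  refine ENNReal.rpow_lt_top_of_nonneg (by positivity) ?_
  simp only [enorm_eq_self]
  set w : ℤ → ℝ≥0 := fun k => (2 : ℝ≥0) ^ k * ((2 : ℝ≥0) ^ (β - 1)) ^ k with hw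
  set E : ℤ → Set (EuclideanSpace ℝ (Fin d)) := fun k =>
    {x | (((2 : ℝ≥0) ^ k : ℝ≥0) : ℝ≥0∞) < feffermanSteinMaximal μ x} with hE
  have hEo : ∀ k, IsOpen (E k) := fun k => isOpen_lt_feffermanSteinMaximal μ _
  have hfin : ∀ S : Finset ℤ, ∑ k ∈ S, (w k : ℝ≥0∞) * volume (E k) ≤ 5 ^ d * C := by
    intro S
    -- Each open level set is exhausted by an increasing sequence of compact sets with a common
    -- index `n`, so that the supremum over `n` can be taken outside the finite sum over levels.
    choose F hFc hFs hFu hFm using fun k => (hEo k).exists_iUnion_isClosed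
    set K : ℤ → ℕ → Set (EuclideanSpace ℝ (Fin d)) := fun k n =>
      F k n ∩ Metric.closedBall 0 n with hKdef
    have hKmono : ∀ k, Monotone (K k) := fun k m n hmn =>
      Set.inter_subset_inter (hFm k hmn) (Metric.closedBall_subset_closedBall (by exact_mod_cast hmn))
    have hKc : ∀ k n, IsCompact (K k n) := fun k n =>
      (isCompact_closedBall _ _).inter_left (hFc k n)
    have hKu : ∀ k, ⋃ n, K k n = E k := by
      intro k
      rw [← hFu k]
      refine Set.Subset.antisymm (Set.iUnion_mono fun n => Set.inter_subset_left) ?_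
      intro x hx
      obtain ⟨n, hn⟩ := Set.mem_iUnion.1 hx
      obtain ⟨m, hm⟩ := exists_nat_ge ‖x‖
      refine Set.mem_iUnion.2 ⟨max n m, hFm k (le_max_left _ _) hn, ?_⟩
      rw [mem_closedBall_zero_iff]
      exact hm.trans (by exact_mod_cast le_max_right _ _)
    have hvol : ∀ k, (w k : ℝ≥0∞) * volume (E k) = ⨆ n, (w k : ℝ≥0∞) * volume (K k n) := by
      intro k
      rw [← hKu k, (hKmono k).measure_iUnion, ENNReal.mul_iSup]
    simp_rw [hvol]
    rw [ENNReal.finsetSum_iSup_of_monotone fun k m n hmn => by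
      gcongr; exact hKmono k hmn]
    refine iSup_le fun n => ?_
    choose J hJd hJb hJv using fun k => exists_finset_openCube_of_isCompact μ (hKc k n)
      (c := (((2 : ℝ≥0) ^ k : ℝ≥0) : ℝ≥0∞)) (Set.inter_subset_left.trans (hFs k n))
    calc ∑ k ∈ S, (w k : ℝ≥0∞) * volume (K k n)
        ≤ ∑ k ∈ S, 5 ^ d * ((w k : ℝ≥0∞) * ∑ Q ∈ J k, volume (openCube Q.1 Q.2)) := by
          refine Finset.sum_le_sum fun k _ => ?_
          rw [mul_left_comm]
          gcongr
          exact hJv k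
      _ ≤ 5 ^ d * C := by
          rw [← Finset.mul_sum]
          gcongr
          exact hC S J (fun k _ => hJd k) (fun k _ => hJb k)
  have hbound : ∫⁻ x, feffermanSteinMaximal μ x ^ β ≤ (2 : ℝ≥0∞) ^ β * (5 ^ d * C) := by
    calc ∫⁻ x, feffermanSteinMaximal μ x ^ β
        ≤ ∫⁻ x, (2 : ℝ≥0∞) ^ β * ∑' k : ℤ, (E k).indicator (fun _ => (w k : ℝ≥0∞)) x :=
          lintegral_mono fun x => rpow_le_tsum_indicator hβ1 _
      _ = (2 : ℝ≥0∞) ^ β * ∑' k : ℤ, (w k : ℝ≥0∞) * volume (E k) := by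
          rw [lintegral_const_mul' _ _ (ENNReal.rpow_ne_top_of_nonneg (by linarith) (by simp)),
            lintegral_tsum fun k => (measurable_const.indicator (hEo k).measurableSet).aemeasurable]
          simp_rw [lintegral_indicator_const (hEo _).measurableSet]
      _ ≤ _ := by
          gcongr
          rw [ENNReal.tsum_eq_iSup_sum]
          exact iSup_le hfin
  refine ne_top_of_le_ne_top ?_ hbound
  exact ENNReal.mul_ne_top (ENNReal.rpow_ne_top_of_nonneg (by linarith) (by simp))
    (ENNReal.mul_ne_top (by simp) ENNReal.coe_ne_top)

end Necessity

/-! ### The Hardy-Littlewood maximal theorem and domination of the Poisson integral. -/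

section MaximalFunction

/-- The layer cake formula for extended nonnegative functions; finiteness of the values allows
passing to the real-valued version. -/
lemma lintegral_rpow_eq_lintegral_meas_ofReal_lt_mul {Ω : Type*} [MeasurableSpace Ω]
    (μ : Measure Ω) {F : Ω → ℝ≥0∞} (hF : Measurable F) (hFtop : ∀ x, F x ≠ ∞) {p : ℝ} (hp : 0 < p) :
    ∫⁻ x, F x ^ p ∂μ = ENNReal.ofReal p *
      ∫⁻ t in Set.Ioi (0 : ℝ), μ {x | ENNReal.ofReal t < F x} * ENNReal.ofReal (t ^ (p - 1)) := by
  have h := lintegral_rpow_eq_lintegral_meas_lt_mul μ (f := fun x => (F x).toReal)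
    (Eventually.of_forall fun _ => ENNReal.toReal_nonneg) hF.ennreal_toReal.aemeasurable hp
  convert h using 1
  · refine lintegral_congr fun x => ?_
    rw [← ENNReal.ofReal_rpow_of_nonneg ENNReal.toReal_nonneg hp.le, ENNReal.ofReal_toReal (hFtop x)]
  · congr 1
    refine setLIntegral_congr_fun measurableSet_Ioi fun t ht => ?_
    congr 2
    ext x
    exact ENNReal.ofReal_lt_iff_lt_toReal (Set.mem_Ioi.1 ht).le (hFtop x)

variable {d : ℕ}

/-- The (uncentred) Hardy-Littlewood maximal function. -/
noncomputable def hardyLittlewoodMaximal (f : EuclideanSpace ℝ (Fin d) → ℝ≥0∞)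
    (x : EuclideanSpace ℝ (Fin d)) : ℝ≥0∞ :=
  ⨆ (y : EuclideanSpace ℝ (Fin d)) (r : ℝ) (_ : 0 < r) (_ : x ∈ Metric.ball y r),
    (∫⁻ z in Metric.ball y r, f z) / volume (Metric.ball y r)

lemma lt_hardyLittlewoodMaximal_iff {f : EuclideanSpace ℝ (Fin d) → ℝ≥0∞}
    {x : EuclideanSpace ℝ (Fin d)} {c : ℝ≥0∞} :
    c < hardyLittlewoodMaximal f x ↔ ∃ (y : EuclideanSpace ℝ (Fin d)) (r : ℝ), 0 < r ∧
      x ∈ Metric.ball y r ∧ c < (∫⁻ z in Metric.ball y r, f z) / volume (Metric.ball y r) := by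
  simp only [hardyLittlewoodMaximal, lt_iSup_iff, exists_prop]

lemma isOpen_lt_hardyLittlewoodMaximal (f : EuclideanSpace ℝ (Fin d) → ℝ≥0∞) (c : ℝ≥0∞) :
    IsOpen {x | c < hardyLittlewoodMaximal f x} := by
  rw [isOpen_iff_mem_nhds]
  intro x hx
  obtain ⟨y, r, hr, hxy, h⟩ := lt_hardyLittlewoodMaximal_iff.1 hx
  filter_upwards [Metric.isOpen_ball.mem_nhds hxy] with z hz
  exact lt_hardyLittlewoodMaximal_iff.2 ⟨y, r, hr, hz, h⟩

lemma measurable_hardyLittlewoodMaximal (f : EuclideanSpace ℝ (Fin d) → ℝ≥0∞) :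
    Measurable (hardyLittlewoodMaximal f) :=
  measurable_of_Ioi fun c => (isOpen_lt_hardyLittlewoodMaximal f c).measurableSet

lemma setLIntegral_ball_le_hardyLittlewoodMaximal_mul (f : EuclideanSpace ℝ (Fin d) → ℝ≥0∞)
    {x y : EuclideanSpace ℝ (Fin d)} {r : ℝ} (hx : x ∈ Metric.ball y r) :
    ∫⁻ z in Metric.ball y r, f z ≤ hardyLittlewoodMaximal f x * volume (Metric.ball y r) := by
  have hr : 0 < r := Metric.pos_of_mem_ball hx
  rw [← ENNReal.div_le_iff (Metric.measure_ball_pos _ _ hr).ne' measure_ball_lt_top.ne]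
  unfold hardyLittlewoodMaximal
  exact le_iSup_of_le y (le_iSup_of_le r (le_iSup_of_le hr (le_iSup_of_le hx le_rfl)))

/-- Boundedness of `f` makes the maximal function finite everywhere, as the layer cake formula
requires. -/
lemma hardyLittlewoodMaximal_le {f : EuclideanSpace ℝ (Fin d) → ℝ≥0∞} {B : ℝ≥0∞}
    (hf : ∀ x, f x ≤ B) (x : EuclideanSpace ℝ (Fin d)) : hardyLittlewoodMaximal f x ≤ B := by
  refine iSup_le fun y => iSup_le fun r => iSup_le fun hr => iSup_le fun _ => ?_
  refine ENNReal.div_le_of_le_mul ?_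
  calc ∫⁻ z in Metric.ball y r, f z ≤ ∫⁻ z in Metric.ball y r, B := lintegral_mono fun z => hf z
    _ = B * volume (Metric.ball y r) := setLIntegral_const _ _

lemma volume_ball_eq (y : EuclideanSpace ℝ (Fin d)) {r : ℝ} (hr : 0 < r) :
    volume (Metric.ball y r) =
      ENNReal.ofReal (r ^ d) * volume (Metric.ball (0 : EuclideanSpace ℝ (Fin d)) 1) := by
  rw [Measure.addHaar_ball_of_pos _ _ hr, finrank_euclideanSpace, Fintype.card_fin]

lemma ball_subset_enlargement {X : Type*} [PseudoMetricSpace X] {y y' : X} {r r' : ℝ}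
    (h : (Metric.ball y r ∩ Metric.ball y' r').Nonempty) (hr : r ≤ 2 * r') :
    Metric.ball y r ⊆ Metric.ball y' (5 * r') := by
  obtain ⟨x, hx, hx'⟩ := h
  intro z hz
  rw [Metric.mem_ball] at *
  have h1 := dist_triangle4 z y x y'
  rw [dist_comm y x] at h1
  linarith

/-- The weak type `(1, 1)` inequality. -/
lemma mul_volume_lt_hardyLittlewoodMaximal_le (f : EuclideanSpace ℝ (Fin d) → ℝ≥0∞) (c : ℝ≥0∞) :
    c * volume {x | c < hardyLittlewoodMaximal f x} ≤ 5 ^ d * ∫⁻ x, f x := by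
  rw [(isOpen_lt_hardyLittlewoodMaximal f c).measure_eq_iSup_isCompact]
  simp only [ENNReal.mul_iSup]
  refine iSup_le fun K => iSup_le fun hKc => iSup_le fun hK => ?_
  let I : Set (EuclideanSpace ℝ (Fin d) × ℝ) := {Q | 0 < Q.2 ∧
    c < (∫⁻ z in Metric.ball Q.1 Q.2, f z) / volume (Metric.ball Q.1 Q.2)}
  obtain ⟨t, htI, htf, hcov⟩ := hK.elim_finite_subcover_image (b := I)
    (c := fun Q => Metric.ball Q.1 Q.2) (fun Q _ => Metric.isOpen_ball) (fun x hx => by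
      obtain ⟨a, l, hl, hxa, h⟩ := lt_hardyLittlewoodMaximal_iff.1 (hKc hx)
      exact Set.mem_biUnion (show (a, l) ∈ I from ⟨hl, h⟩) hxa)
  obtain ⟨R, hR⟩ := (htf.image Prod.snd).bddAbove
  obtain ⟨u, hut, hdisj, hu⟩ := Vitali.exists_disjoint_subfamily_covering_enlargement
    (fun Q : EuclideanSpace ℝ (Fin d) × ℝ => Metric.ball Q.1 Q.2) t (fun Q => Q.2) 2 one_lt_two
    (fun Q hQ => (htI hQ).1.le) R (fun Q hQ => hR ⟨Q, hQ, rfl⟩)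
    (fun Q hQ => Metric.nonempty_ball.2 (htI hQ).1)
  have huf : u.Finite := htf.subset hut
  have hsub : K ⊆ ⋃ Q ∈ huf.toFinset, Metric.ball Q.1 (5 * Q.2) := by
    intro x hx
    obtain ⟨Q, hQt, hxQ⟩ := Set.mem_iUnion₂.1 (hcov hx)
    obtain ⟨Q', hQ'u, hne, hle⟩ := hu Q hQt
    exact Set.mem_iUnion₂.2 ⟨Q', huf.mem_toFinset.2 hQ'u, ball_subset_enlargement hne hle hxQ⟩
  calc c * volume K ≤ c * ∑ Q ∈ huf.toFinset, volume (Metric.ball Q.1 (5 * Q.2)) := by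
        gcongr
        exact (measure_mono hsub).trans (measure_biUnion_finset_le _ _)
    _ ≤ ∑ Q ∈ huf.toFinset, 5 ^ d * ∫⁻ x in Metric.ball Q.1 Q.2, f x := by
        rw [Finset.mul_sum]
        refine Finset.sum_le_sum fun Q hQ => ?_
        have hQI := htI (hut (huf.mem_toFinset.1 hQ))
        have h1 : c * volume (Metric.ball Q.1 Q.2) ≤ ∫⁻ x in Metric.ball Q.1 Q.2, f x := by
          rw [← ENNReal.le_div_iff_mul_le (Or.inl (Metric.measure_ball_pos _ _ hQI.1).ne')
            (Or.inl measure_ball_lt_top.ne)]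
          exact hQI.2.le
        have h2 : volume (Metric.ball Q.1 (5 * Q.2)) = 5 ^ d * volume (Metric.ball Q.1 Q.2) := by
          have : 0 < Q.2 := hQI.1
          rw [volume_ball_eq _ this, volume_ball_eq _ (by positivity), mul_pow,
            ENNReal.ofReal_mul (by positivity), mul_assoc]
          norm_num
        rw [h2, mul_left_comm]
        gcongr
    _ = 5 ^ d * ∫⁻ x in ⋃ Q ∈ huf.toFinset, Metric.ball Q.1 Q.2, f x := by
        rw [← Finset.mul_sum, lintegral_biUnion_finset (fun Q hQ Q' hQ' hne =>
          hdisj (huf.mem_toFinset.1 hQ) (huf.mem_toFinset.1 hQ') hne)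
          (fun Q _ => Metric.isOpen_ball.measurableSet)]
    _ ≤ 5 ^ d * ∫⁻ x, f x := by gcongr; exact Measure.restrict_le_self

/-- The Hardy-Littlewood maximal theorem. -/
theorem lintegral_hardyLittlewoodMaximal_rpow_le {p : ℝ} (hp : 1 < p)
    {f : EuclideanSpace ℝ (Fin d) → ℝ≥0∞} (hf : Measurable f) {B : ℝ≥0} (hB : ∀ x, f x ≤ B) :
    ∫⁻ x, hardyLittlewoodMaximal f x ^ p ≤
      ENNReal.ofReal (p / (p - 1)) * (5 ^ d * 2 ^ p) * ∫⁻ x, f x ^ p := by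
  have hp0 : 0 < p := by linarith
  have hp1 : 0 < p - 1 := by linarith
  set ν : Measure (EuclideanSpace ℝ (Fin d)) := volume.withDensity f with hν
  have hftop : ∀ x, f x ≠ ∞ := fun x => ne_top_of_le_ne_top ENNReal.coe_ne_top (hB x)
  -- Marcinkiewicz truncation at height `t / 2`: the part of `f` below it contributes at most `t /
  -- 2` to every average, so the weak type bound is needed only for the part above, whose integral
  -- is `ν A`.
  have hlevel : ∀ t : ℝ, 0 < t → volume {x | ENNReal.ofReal t < hardyLittlewoodMaximal f x} ≤
      2 * 5 ^ d * ENNReal.ofReal t⁻¹ * ν {x | ENNReal.ofReal t < 2 * f x} := by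
    intro t ht
    set s := ENNReal.ofReal (t / 2) with hs
    have hst : s + s = ENNReal.ofReal t := by
      rw [hs, ← ENNReal.ofReal_add (by positivity) (by positivity)]; ring_nf
    have hs0 : s ≠ 0 := by simp [hs, ht]
    have hs_top : s ≠ ∞ := by simp [hs]
    set A := {x | ENNReal.ofReal t < 2 * f x} with hA
    have hAm : MeasurableSet A := measurableSet_lt measurable_const (hf.const_mul 2)
    have hle : ∀ x, f x ≤ A.indicator f x + s := by
      intro x
      by_cases hx : x ∈ A
      · simp [hx]
      · simp only [hx, not_false_eq_true, Set.indicator_of_notMem, zero_add]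
        have : 2 * f x ≤ 2 * s := by
          rw [two_mul s, hst]; exact not_lt.1 hx
        exact (ENNReal.mul_le_mul_iff_right (by norm_num) (by norm_num)).1 this
    have hsub : {x | ENNReal.ofReal t < hardyLittlewoodMaximal f x} ⊆
        {x | s < hardyLittlewoodMaximal (A.indicator f) x} := by
      intro x hx
      obtain ⟨y, r, hr, hxy, h⟩ := lt_hardyLittlewoodMaximal_iff.1 hx
      refine lt_hardyLittlewoodMaximal_iff.2 ⟨y, r, hr, hxy, ?_⟩
      have hv0 := (Metric.measure_ball_pos volume y hr).ne'
      have hvt : volume (Metric.ball y r) ≠ ∞ := measure_ball_lt_top.ne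
      have h1 : (∫⁻ z in Metric.ball y r, f z) / volume (Metric.ball y r) ≤
          (∫⁻ z in Metric.ball y r, A.indicator f z) / volume (Metric.ball y r) + s := by
        rw [ENNReal.div_le_iff hv0 hvt, add_mul, ENNReal.div_mul_cancel hv0 hvt]
        calc ∫⁻ z in Metric.ball y r, f z
            ≤ ∫⁻ z in Metric.ball y r, (A.indicator f z + s) := lintegral_mono hle
          _ = _ := by rw [lintegral_add_right _ measurable_const, setLIntegral_const]
      have h2 := h.trans_le h1
      rw [← hst] at h2
      exact (ENNReal.add_lt_add_iff_right hs_top).1 h2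
    have hw := mul_volume_lt_hardyLittlewoodMaximal_le (A.indicator f) s
    rw [lintegral_indicator hAm, ← withDensity_apply _ hAm] at hw
    have h3 : s * volume {x | ENNReal.ofReal t < hardyLittlewoodMaximal f x} ≤ 5 ^ d * ν A :=
      (mul_le_mul_right (measure_mono hsub) _).trans hw
    have hsinv : s⁻¹ = 2 * ENNReal.ofReal t⁻¹ := by
      rw [hs, ← ENNReal.ofReal_inv_of_pos (by positivity), inv_div, div_eq_mul_inv,
        ENNReal.ofReal_mul (by norm_num)]
      norm_num
    calc volume {x | ENNReal.ofReal t < hardyLittlewoodMaximal f x}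
        = s⁻¹ * (s * volume {x | ENNReal.ofReal t < hardyLittlewoodMaximal f x}) := by
          rw [← mul_assoc, ENNReal.inv_mul_cancel hs0 hs_top, one_mul]
      _ ≤ s⁻¹ * (5 ^ d * ν A) := by gcongr
      _ = _ := by rw [hsinv]; ring
  have hMtop : ∀ x, hardyLittlewoodMaximal f x ≠ ∞ := fun x =>
    ne_top_of_le_ne_top ENNReal.coe_ne_top (hardyLittlewoodMaximal_le hB x)
  rw [lintegral_rpow_eq_lintegral_meas_ofReal_lt_mul volume (measurable_hardyLittlewoodMaximal f)
    hMtop hp0]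
  have hlc := lintegral_rpow_eq_lintegral_meas_ofReal_lt_mul ν (F := fun x => 2 * f x)
    (hf.const_mul 2) (fun x => ENNReal.mul_ne_top (by norm_num) (hftop x)) hp1
  -- Because `ν` has density `f`, the power `p - 1` against `ν` is the power `p` against Lebesgue
  -- measure; a second use of the layer cake formula thus closes the estimate.
  have hlhs : ∫⁻ x, (2 * f x) ^ (p - 1) ∂ν = 2 ^ (p - 1) * ∫⁻ x, f x ^ p := by
    rw [hν, lintegral_withDensity_eq_lintegral_mul _ hf (by fun_prop),
      ← lintegral_const_mul _ (by fun_prop)]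
    refine lintegral_congr fun x => ?_
    rw [Pi.mul_apply, ENNReal.mul_rpow_of_nonneg _ _ hp1.le, mul_left_comm]
    congr 1
    rcases eq_or_ne (f x) 0 with h0 | h0
    · simp [h0, hp0]
    · conv_rhs => rw [show p = 1 + (p - 1) by ring, ENNReal.rpow_add _ _ h0 (hftop x),
        ENNReal.rpow_one]
  have hkey : ∫⁻ t in Set.Ioi (0 : ℝ), volume {x | ENNReal.ofReal t < hardyLittlewoodMaximal f x} *
      ENNReal.ofReal (t ^ (p - 1)) ≤ 2 * 5 ^ d *
        ∫⁻ t in Set.Ioi (0 : ℝ), ν {x | ENNReal.ofReal t < 2 * f x} *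
          ENNReal.ofReal (t ^ (p - 1 - 1)) := by
    rw [← lintegral_const_mul' _ _ (by finiteness)]
    refine setLIntegral_mono' measurableSet_Ioi fun t ht => ?_
    have ht0 : 0 < t := ht
    calc _ ≤ 2 * 5 ^ d * ENNReal.ofReal t⁻¹ * ν {x | ENNReal.ofReal t < 2 * f x} *
          ENNReal.ofReal (t ^ (p - 1)) := by gcongr; exact hlevel t ht0
      _ = 2 * 5 ^ d * (ν {x | ENNReal.ofReal t < 2 * f x} *
          (ENNReal.ofReal t⁻¹ * ENNReal.ofReal (t ^ (p - 1)))) := by ring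
      _ = _ := by
        rw [← ENNReal.ofReal_mul (by positivity), Real.rpow_sub_one ht0.ne' (p - 1),
          div_eq_inv_mul]
  have hI : ∫⁻ t in Set.Ioi (0 : ℝ), ν {x | ENNReal.ofReal t < 2 * f x} *
      ENNReal.ofReal (t ^ (p - 1 - 1)) =
        (ENNReal.ofReal (p - 1))⁻¹ * (2 ^ (p - 1) * ∫⁻ x, f x ^ p) := by
    rw [← hlhs, hlc, ← mul_assoc, ENNReal.inv_mul_cancel (by simpa using hp1) (by simp), one_mul]
  calc _ ≤ ENNReal.ofReal p * (2 * 5 ^ d *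
        ((ENNReal.ofReal (p - 1))⁻¹ * (2 ^ (p - 1) * ∫⁻ x, f x ^ p))) := by
        rw [← hI]; gcongr
    _ = ENNReal.ofReal (p / (p - 1)) * (5 ^ d * 2 ^ p) * ∫⁻ x, f x ^ p := by
        have h2 : (2 : ℝ≥0∞) ^ p = 2 * 2 ^ (p - 1) := by
          conv_lhs => rw [show p = 1 + (p - 1) by ring,
            ENNReal.rpow_add _ _ (by norm_num) (by norm_num), ENNReal.rpow_one]
        rw [h2, div_eq_mul_inv, ENNReal.ofReal_mul hp0.le, ENNReal.ofReal_inv_of_pos hp1]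
        ring

/-- For the least `j` with `‖v‖ < 2 ^ j * t`, minimality gives `2 ^ j * t ≤ 2 * ‖(v, t)‖`. The
kernel is then at most `2 ^ (-j)` times the reciprocal volume of the ball of radius `2 ^ j * t`, up
to constants, which is summable in `j`. -/
lemma exists_pow_halfSpaceKernel_le {v : EuclideanSpace ℝ (Fin d)} {t : ℝ} (ht : 0 < t) :
    ∃ j : ℕ, ‖v‖ < 2 ^ j * t ∧ halfSpaceKernel (WithLp.toLp 2 (v, t) : AmbientSpace d) ≤
      2 ^ (d + 1) * (1 / 2) ^ j * ((2 ^ j * t) ^ d)⁻¹ := by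
  classical
  have hex : ∃ j : ℕ, ‖v‖ < 2 ^ j * t := by
    obtain ⟨j, hj⟩ := pow_unbounded_of_one_lt (‖v‖ / t) one_lt_two
    exact ⟨j, (div_lt_iff₀ ht).1 hj⟩
  set z : AmbientSpace d := WithLp.toLp 2 (v, t)
  have hz : z.snd = t := rfl
  have hzt : t ≤ ‖z‖ := (le_abs_self _).trans (AmbientSpace.abs_snd_le z)
  refine ⟨Nat.find hex, Nat.find_spec hex, ?_⟩
  have hlow : 2 ^ Nat.find hex * t ≤ 2 * ‖z‖ := by
    rcases Nat.eq_zero_or_pos (Nat.find hex) with h0 | h0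
    · rw [h0]; linarith
    · have h1 := not_lt.1 (Nat.find_min hex (Nat.sub_lt h0 one_pos))
      have h2 : (2 : ℝ) ^ Nat.find hex = 2 * 2 ^ (Nat.find hex - 1) := by
        rw [← pow_succ', Nat.sub_add_cancel h0]
      have h3 : ‖v‖ ≤ ‖z‖ := AmbientSpace.norm_fst_le z
      rw [h2]; linarith
  set j := Nat.find hex
  have h2j : (0 : ℝ) < 2 ^ j := by positivity
  have hpos : 0 < ‖z‖ := ht.trans_le hzt
  rw [halfSpaceKernel, hz, div_le_iff₀ (by positivity)]
  calc t = 2 ^ (d + 1) * (1 / 2) ^ j * ((2 ^ j * t) ^ d)⁻¹ * ((2 ^ j * t) / 2) ^ (d + 1) := by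
        have h1 : (1 / 2 : ℝ) ^ j * (2 ^ j * t) = t := by
          rw [one_div, inv_pow, inv_mul_cancel_left₀ h2j.ne']
        have hs : 0 < 2 ^ j * t := by positivity
        conv_lhs => rw [← h1]
        generalize 2 ^ j * t = s at hs
        rw [div_pow s, pow_succ s]
        field_simp
    _ ≤ _ := by gcongr; linarith

/-- The Poisson integral is dominated, in a cone, by the maximal function at the vertex. -/
lemma exists_lintegral_halfSpaceKernel_mul_le (d : ℕ) :
    ∃ C : ℝ≥0, ∀ (f : EuclideanSpace ℝ (Fin d) → ℝ≥0∞), Measurable f →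
      ∀ (x y : EuclideanSpace ℝ (Fin d)) (t : ℝ), x ∈ Metric.ball y t →
      ∫⁻ z, ENNReal.ofReal (halfSpaceKernel (WithLp.toLp 2 (y - z, t) : AmbientSpace d)) * f z ≤
        C * hardyLittlewoodMaximal f x := by
  set V := volume (Metric.ball (0 : EuclideanSpace ℝ (Fin d)) 1)
  have hV : V ≠ ∞ := measure_ball_lt_top.ne
  set C : ℝ≥0∞ := ENNReal.ofReal (∑' j : ℕ, 2 ^ (d + 1) * (1 / 2 : ℝ) ^ j) * V
  refine ⟨C.toNNReal, fun f hf x y t hx => ?_⟩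
  rw [ENNReal.coe_toNNReal (ENNReal.mul_ne_top (by simp) hV)]
  have ht : 0 < t := Metric.pos_of_mem_ball hx
  have hpt : ∀ z, ENNReal.ofReal (halfSpaceKernel (WithLp.toLp 2 (y - z, t) : AmbientSpace d)) *
      f z ≤ ∑' j : ℕ, ENNReal.ofReal (2 ^ (d + 1) * (1 / 2) ^ j * ((2 ^ j * t) ^ d)⁻¹) *
        (Metric.ball y (2 ^ j * t)).indicator f z := by
    intro z
    obtain ⟨j, hj, hle⟩ := exists_pow_halfSpaceKernel_le (v := y - z) ht
    refine le_trans ?_ (ENNReal.le_tsum j)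
    have hzb : z ∈ Metric.ball y (2 ^ j * t) := by
      rw [Metric.mem_ball, dist_comm, dist_eq_norm]; exact hj
    rw [Set.indicator_of_mem hzb]
    gcongr
  refine (lintegral_mono hpt).trans ?_
  rw [lintegral_tsum fun j => ((hf.indicator Metric.isOpen_ball.measurableSet).const_mul
    _).aemeasurable]
  have hj : ∀ j : ℕ, ∫⁻ z, ENNReal.ofReal (2 ^ (d + 1) * (1 / 2) ^ j * ((2 ^ j * t) ^ d)⁻¹) *
      (Metric.ball y (2 ^ j * t)).indicator f z ≤
        ENNReal.ofReal (2 ^ (d + 1) * (1 / 2) ^ j) * (V * hardyLittlewoodMaximal f x) := by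
    intro j
    have hjt : 0 < 2 ^ j * t := by positivity
    rw [lintegral_const_mul' _ _ (by simp), lintegral_indicator Metric.isOpen_ball.measurableSet]
    -- The balls are centred at `y` but contain `x`; the uncentred maximal function at `x` therefore
    -- controls all their averages.
    have hxj : x ∈ Metric.ball y (2 ^ j * t) :=
      Metric.ball_subset_ball (le_mul_of_one_le_left ht.le (one_le_pow₀ one_le_two)) hx
    refine (mul_le_mul_right (setLIntegral_ball_le_hardyLittlewoodMaximal_mul f hxj) _).trans
      (le_of_eq ?_)
    have h0 : ENNReal.ofReal ((2 ^ j * t) ^ d)⁻¹ * ENNReal.ofReal ((2 ^ j * t) ^ d) = 1 := by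
      rw [← ENNReal.ofReal_mul (by positivity), inv_mul_cancel₀ (by positivity), ENNReal.ofReal_one]
    rw [volume_ball_eq y hjt, ENNReal.ofReal_mul (by positivity)]
    calc _ = ENNReal.ofReal (2 ^ (d + 1) * (1 / 2) ^ j) * (V * hardyLittlewoodMaximal f x) *
          (ENNReal.ofReal ((2 ^ j * t) ^ d)⁻¹ * ENNReal.ofReal ((2 ^ j * t) ^ d)) := by ring
      _ = _ := by rw [h0, mul_one]
  refine (ENNReal.tsum_le_tsum hj).trans (le_of_eq ?_)
  rw [ENNReal.tsum_mul_right, ← ENNReal.ofReal_tsum_of_nonneg (fun _ => by positivity)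
    ((summable_geometric_two).mul_left _), mul_assoc]

end MaximalFunction

/-! ### The sub-mean value inequality and the local strong maximum principle. -/

section Submean

variable {E F : Type*} [NormedAddCommGroup E] [InnerProductSpace ℝ E]
  [NormedAddCommGroup F] [NormedSpace ℝ F] [FiniteDimensional ℝ E]
  [MeasurableSpace E] [BorelSpace E] (ν : Measure E) [ν.IsAddHaarMeasure]

lemma integrable_radialWeight_smul_of_continuousOn {g : E → F}
    (hg : ContinuousOn g (Metric.closedBall 0 1)) :
    Integrable (fun y => radialWeight y • g y) ν := by
  rw [← integrableOn_iff_integrable_of_support_subset (s := Metric.closedBall (0 : E) 1)]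
  · exact (continuous_radialWeight.continuousOn.smul hg).integrableOn_compact
      (isCompact_closedBall _ _)
  · intro y hy
    by_contra h
    refine hy ?_
    have : radialWeight y = 0 := radialWeight_eq_zero
      (by simpa using (not_le.1 (fun h' => h (by simpa using h'))).le)
    simp [this]

lemma continuousOn_comp_add_smul {g : E → F} {P : E} {r : ℝ} (hr : 0 < r)
    (hg : ContinuousOn g (Metric.closedBall P r)) :
    ContinuousOn (fun y => g (P + r • y)) (Metric.closedBall 0 1) := by
  refine hg.comp (by fun_prop) fun y hy => ?_
  rw [mem_closedBall_iff_norm, add_sub_cancel_left, norm_smul, Real.norm_of_nonneg hr.le]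
  have : ‖y‖ ≤ 1 := by simpa using hy
  nlinarith

lemma InnerProductSpace.HarmonicOnNhd.norm_le_integral_radialWeight [CompleteSpace F] {u : E → F}
    {P : E} {r : ℝ} (hr : 0 < r) (hu : HarmonicOnNhd u (Metric.closedBall P r)) :
    (∫ y : E, radialWeight y ∂ν) * ‖u P‖ ≤ ∫ y, radialWeight y * ‖u (P + r • y)‖ ∂ν := by
  have h := hu.integral_radialWeight_smul ν hr
  have h1 := norm_integral_le_integral_norm (μ := ν) fun y => radialWeight y • u (P + r • y)
  rw [h, norm_smul, Real.norm_of_nonneg (integral_radialWeight_pos ν).le] at h1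
  refine h1.trans (le_of_eq ?_)
  congr 1; ext y
  rw [norm_smul, Real.norm_of_nonneg (radialWeight_nonneg y)]

/-- If a continuous function that satisfies the sub-mean value inequality on a ball attains its
maximum at the centre, it is constant on the ball. -/
lemma eqOn_ball_of_radialWeight_submean {h : E → ℝ} {P : E} {r : ℝ} (hr : 0 < r)
    (hc : ContinuousOn h (Metric.closedBall P r))
    (hsub : (∫ y : E, radialWeight y ∂ν) * h P ≤ ∫ y, radialWeight y * h (P + r • y) ∂ν)
    (hmax : ∀ z ∈ Metric.closedBall P r, h z ≤ h P) :
    ∀ z ∈ Metric.ball P r, h z = h P := by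
  have hmem : ∀ y : E, ‖y‖ ≤ 1 → P + r • y ∈ Metric.closedBall P r := by
    intro y hy
    rw [mem_closedBall_iff_norm, add_sub_cancel_left, norm_smul, Real.norm_of_nonneg hr.le]
    nlinarith
  have hcont := continuousOn_comp_add_smul hr hc
  have hint := integrable_radialWeight_smul_of_continuousOn ν
    (g := fun y => h P - h (P + r • y)) (continuousOn_const.sub hcont)
  have hint2 := integrable_radialWeight_smul_of_continuousOn ν hcont
  simp only [smul_eq_mul] at hint hint2
  have hnn : ∀ y, 0 ≤ radialWeight y * (h P - h (P + r • y)) := by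
    intro y
    by_cases hy : ‖y‖ ≤ 1
    · exact mul_nonneg (radialWeight_nonneg y) (by linarith [hmax _ (hmem y hy)])
    · simp [radialWeight_eq_zero (not_le.1 hy).le]
  -- A nonnegative integrand with vanishing integral is zero almost everywhere, hence everywhere on
  -- the open unit ball by continuity, where the weight is positive.
  have hzero : ∫ y, radialWeight y * (h P - h (P + r • y)) ∂ν = 0 := by
    refine le_antisymm ?_ (integral_nonneg hnn)
    simp_rw [mul_sub]
    rw [integral_sub ((integrable_radialWeight ν).mul_const _) hint2, integral_mul_const]
    linarith
  have hae := (integral_eq_zero_iff_of_nonneg hnn hint).1 hzero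
  have hEq := Measure.eqOn_open_of_ae_eq (μ := ν) (U := Metric.ball (0 : E) 1)
    (ae_restrict_of_ae hae) Metric.isOpen_ball
    (continuous_radialWeight.continuousOn.mul (continuousOn_const.sub
      (hcont.mono Metric.ball_subset_closedBall))) continuousOn_const
  intro z hz
  have hy : r⁻¹ • (z - P) ∈ Metric.ball (0 : E) 1 := by
    rw [mem_ball_zero_iff, norm_smul, norm_inv, Real.norm_of_nonneg hr.le, inv_mul_lt_one₀ hr]
    exact mem_ball_iff_norm.1 hz
  have h1 := hEq hy
  simp only [smul_smul, mul_inv_cancel₀ hr.ne', one_smul, add_sub_cancel, Pi.zero_apply] at h1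
  rcases mul_eq_zero.1 h1 with h2 | h2
  · exact absurd h2 (radialWeight_pos (by simpa using hy)).ne'
  · linarith

end Submean

/-! ### Maximum principle and comparison with the Poisson integral. -/

section Comparison

variable {d : ℕ}

lemma isCompact_cylinder (R : ℝ) :
    IsCompact {z : AmbientSpace d | ‖z.fst‖ ≤ R ∧ 0 ≤ z.snd ∧ z.snd ≤ R} := by
  have h1 := AmbientSpace.continuous_fst (d := d)
  have h2 := AmbientSpace.continuous_snd (d := d)
  refine Metric.isCompact_of_isClosed_isBounded ?_ ?_
  · exact (isClosed_le h1.norm continuous_const).inter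
      ((isClosed_le continuous_const h2).inter (isClosed_le h2 continuous_const))
  · refine (Metric.isBounded_closedBall (x := (0 : AmbientSpace d)) (r := R + R)).subset ?_
    rintro z ⟨hz1, hz2, hz3⟩
    rw [mem_closedBall_zero_iff]
    refine (AmbientSpace.norm_le_add z).trans ?_
    rw [abs_of_nonneg hz2]
    linarith

/-- Maximum principle on a cylinder for continuous functions with the sub-mean value property. -/
lemma nonpos_of_submean_of_cylinder {R : ℝ} {h : AmbientSpace d → ℝ}
    (hc : ContinuousOn h {z : AmbientSpace d | ‖z.fst‖ ≤ R ∧ 0 ≤ z.snd ∧ z.snd ≤ R})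
    (hsub : ∀ (P : AmbientSpace d) (r : ℝ), 0 < r → Metric.closedBall P r ⊆ upperHalfSpace d →
      (∫ y : AmbientSpace d, radialWeight y) * h P ≤ ∫ y, radialWeight y * h (P + r • y))
    (hbot : ∀ z : AmbientSpace d, z.snd = 0 → h z ≤ 0)
    (htop : ∀ z : AmbientSpace d, ‖z.fst‖ ≤ R → z.snd = R → h z ≤ 0)
    (hlat : ∀ z : AmbientSpace d, ‖z.fst‖ = R → 0 ≤ z.snd → z.snd ≤ R → h z ≤ 0)
    {z : AmbientSpace d} (hz : ‖z.fst‖ ≤ R ∧ 0 ≤ z.snd ∧ z.snd ≤ R) : h z ≤ 0 := by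
  set K := {z : AmbientSpace d | ‖z.fst‖ ≤ R ∧ 0 ≤ z.snd ∧ z.snd ≤ R} with hK
  have hKc : IsCompact K := isCompact_cylinder R
  by_contra hpos
  rw [not_le] at hpos
  obtain ⟨z₁, hz₁K, hz₁⟩ := hKc.exists_isMaxOn ⟨z, hz⟩ hc
  have hm : 0 < h z₁ := hpos.trans_le (hz₁ hz)
  have hK' : IsCompact (K ∩ h ⁻¹' {h z₁}) :=
    hKc.of_isClosed_subset (hc.preimage_isClosed_of_isClosed hKc.isClosed isClosed_singleton)
      Set.inter_subset_left
  -- Among the maximum points the lowest one is chosen. The function is constant on a ball about it,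
  -- so the point `Q` just below is a lower maximum point: a contradiction without a connectedness
  -- argument.
  obtain ⟨P, ⟨hPK, hPm⟩, hP⟩ := hK'.exists_isMinOn ⟨z₁, hz₁K, rfl⟩
    (AmbientSpace.continuous_snd (d := d)).continuousOn
  have hPm' : h P = h z₁ := hPm
  have h1 : ‖P.fst‖ < R := lt_of_le_of_ne hPK.1 fun he => by
    have := hlat P he hPK.2.1 hPK.2.2; linarith
  have h2 : 0 < P.snd := lt_of_le_of_ne hPK.2.1 fun he => by
    have := hbot P he.symm; linarith
  have h3 : P.snd < R := lt_of_le_of_ne hPK.2.2 fun he => by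
    have := htop P hPK.1 he; linarith
  obtain ⟨r, hr0, hr1, hr2, hr3⟩ : ∃ r : ℝ, 0 < r ∧ r < R - ‖P.fst‖ ∧ r < P.snd ∧ r < R - P.snd := by
    obtain ⟨r, hr0, hr⟩ := exists_between (lt_min (sub_pos.2 h1) (lt_min h2 (sub_pos.2 h3)))
    exact ⟨r, hr0, hr.trans_le (min_le_left _ _),
      hr.trans_le ((min_le_right _ _).trans (min_le_left _ _)),
      hr.trans_le ((min_le_right _ _).trans (min_le_right _ _))⟩
  have hball : ∀ x ∈ Metric.closedBall P r, x ∈ K ∧ 0 < x.snd := by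
    intro x hx
    rw [mem_closedBall_iff_norm] at hx
    have e1 := (AmbientSpace.norm_fst_le (x - P)).trans hx
    have e2 := abs_le.1 ((AmbientSpace.abs_snd_le (x - P)).trans hx)
    rw [WithLp.sub_fst] at e1
    rw [WithLp.sub_snd] at e2
    have e3 := norm_le_norm_add_norm_sub' x.fst P.fst
    exact ⟨⟨by linarith, by linarith, by linarith⟩, by linarith⟩
  have hconst := eqOn_ball_of_radialWeight_submean volume hr0
    (hc.mono fun x hx => (hball x hx).1) (hsub P r hr0 fun x hx => (hball x hx).2)
    (fun x hx => hPm' ▸ hz₁ (hball x hx).1)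
  set Q : AmbientSpace d := P - WithLp.toLp 2 (0, r / 2) with hQdef
  have hQ : Q ∈ Metric.ball P r := by
    rw [mem_ball_iff_norm, hQdef, sub_sub_cancel_left, norm_neg]
    refine (AmbientSpace.norm_le_add _).trans_lt ?_
    change ‖(0 : EuclideanSpace ℝ (Fin d))‖ + |r / 2| < r
    rw [norm_zero, zero_add, abs_of_pos (half_pos hr0)]
    linarith
  have hQsnd : Q.snd = P.snd - r / 2 := by simp [hQdef]
  have hle : P.snd ≤ Q.snd :=
    hP ⟨(hball Q (Metric.ball_subset_closedBall hQ)).1, (hconst Q hQ).trans hPm'⟩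
  linarith

/-- A bounded harmonic function is dominated by the Poisson integral of its modulus. -/
theorem norm_le_halfSpaceIntegral {u : AmbientSpace d → ℂ}
    (hu : HarmonicOnNhd u (upperHalfSpace d)) {ε B : ℝ} (hε : 0 < ε)
    (hB : ∀ z : AmbientSpace d, ε ≤ z.snd → ‖u z‖ ≤ B) {z : AmbientSpace d} (hz : 0 < z.snd) :
    halfSpaceKernelMass d * ‖u (z + WithLp.toLp 2 (0, ε))‖ ≤
      halfSpaceIntegral (fun x => ‖u (WithLp.toLp 2 (x, ε))‖) z := by
  set c := halfSpaceKernelMass d with hcdef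
  have hc : 0 < c := halfSpaceKernelMass_pos
  set e : AmbientSpace d := WithLp.toLp 2 (0, ε) with he
  have hesnd : e.snd = ε := rfl
  set f : EuclideanSpace ℝ (Fin d) → ℝ := fun x => ‖u (WithLp.toLp 2 (x, ε))‖ with hf
  have hB0 : 0 ≤ B := (norm_nonneg _).trans (hB e le_rfl)
  have hfc : Continuous f := by
    refine (hu.continuousOn.comp_continuous (continuous_toLp.comp (by fun_prop)) fun x => ?_).norm
    exact hε
  have hfB : ∀ x, |f x| ≤ B := fun x => by
    rw [abs_of_nonneg (norm_nonneg _)]; exact hB _ le_rfl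
  set S : AmbientSpace d → ℝ := fun z => ∫ w : EuclideanSpace ℝ (Fin d),
      halfSpaceKernel (WithLp.toLp 2 (w, (1 : ℝ)) : AmbientSpace d) * f (z.fst - z.snd • w) with hS
  have hSc : Continuous S := continuous_integral_halfSpaceKernel_mul hfc hfB
  have hSeq : ∀ z : AmbientSpace d, 0 < z.snd → halfSpaceIntegral f z = S z := fun z hz =>
    halfSpaceIntegral_eq f hz
  have hS0 : ∀ z, 0 ≤ S z := fun z => integral_nonneg fun w =>
    mul_nonneg (halfSpaceKernel_nonneg (by simp)) (norm_nonneg _)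
  rw [hSeq z hz]
  -- On the cylinder of size `R` the difference is corrected by a harmonic barrier. It dominates `c
  -- * B` on the top and lateral faces and is nonnegative on the bottom, where the Poisson integral
  -- already equals the boundary modulus times `c`.
  have hmain : ∀ R : ℝ, ‖z.fst‖ ≤ R → z.snd ≤ R →
      c * ‖u (z + e)‖ - S z - c * B * R⁻¹ ^ 2 *
        (‖z‖ ^ 2 - (d + 1) * z.snd ^ 2 + (d + 1) * R * z.snd) ≤ 0 := by
    intro R hR1 hR2
    have hR : 0 < R := hz.trans_le hR2
    -- With linear coefficient `(d + 1) * R` the barrier is `‖x‖ ^ 2 + t * ((d + 1) * R - d * t)`,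
    -- which for `0 ≤ t ≤ R` is nonnegative, and at least `R ^ 2` when `t = R` or `‖x‖ = R`.
    set b : AmbientSpace d → ℝ := fun z =>
      ‖z‖ ^ 2 - (d + 1) * z.snd ^ 2 + (d + 1) * R * z.snd with hb
    have hbh : HarmonicOnNhd b Set.univ := harmonicOnNhd_barrier _
    have hbc : Continuous b := by
      have := hbh.continuousOn
      rwa [continuousOn_univ] at this
    have hb' : ∀ z : AmbientSpace d, b z =
        ‖z.fst‖ ^ 2 + z.snd * ((d + 1) * R - d * z.snd) := fun z => by
      rw [hb]; simp only [AmbientSpace.norm_sq]; ring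
    have hupper : ∀ z : AmbientSpace d, 0 ≤ z.snd → z + e ∈ upperHalfSpace d := fun z hz => by
      change 0 < (z + e).snd
      rw [WithLp.add_snd, hesnd]; linarith
    have huc : ContinuousOn (fun z => ‖u (z + e)‖) {z : AmbientSpace d | 0 ≤ z.snd} :=
      (hu.continuousOn.comp (by fun_prop) fun z hz => hupper z hz).norm
    have hbound : ∀ z : AmbientSpace d, 0 ≤ z.snd → 1 ≤ R⁻¹ ^ 2 * b z →
        c * ‖u (z + e)‖ - S z - c * B * R⁻¹ ^ 2 * b z ≤ 0 := by
      intro z hz hbz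
      have h1 : ‖u (z + e)‖ ≤ B := hB _ (by rw [WithLp.add_snd, hesnd]; linarith)
      have h2 : c * ‖u (z + e)‖ ≤ c * B := mul_le_mul_of_nonneg_left h1 hc.le
      have h3 : c * B * 1 ≤ c * B * (R⁻¹ ^ 2 * b z) :=
        mul_le_mul_of_nonneg_left hbz (by positivity)
      have h4 := hS0 z
      linarith
    have hR2b : ∀ t : ℝ, R ^ 2 ≤ t → 1 ≤ R⁻¹ ^ 2 * t := fun t ht => by
      rw [inv_pow, inv_mul_eq_div, one_le_div (by positivity)]; exact ht
    refine nonpos_of_submean_of_cylinder (R := R)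
      (h := fun z => c * ‖u (z + e)‖ - S z - c * B * R⁻¹ ^ 2 * b z) ?_ ?_ ?_ ?_ ?_
      ⟨hR1, hz.le, hR2⟩
    · have := huc.mono (s := {z : AmbientSpace d | 0 ≤ z.snd})
        (t := {z : AmbientSpace d | ‖z.fst‖ ≤ R ∧ 0 ≤ z.snd ∧ z.snd ≤ R}) fun z hz => hz.2.1
      exact ((this.const_mul c).sub hSc.continuousOn).sub
        (hbc.continuousOn.const_mul _)
    · intro P r hr hPr
      have hrP := lt_snd_of_closedBall_subset hr hPr
      have hPre : Metric.closedBall (P + e) r ⊆ upperHalfSpace d := by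
        intro x hx
        have hx' : x - e ∈ Metric.closedBall P r := by
          rw [mem_closedBall_iff_norm] at hx ⊢
          convert hx using 2; abel
        have := hPr hx'
        simpa using hupper _ (le_of_lt this)
      have h1 := HarmonicOnNhd.norm_le_integral_radialWeight (volume : Measure (AmbientSpace d))
        hr (hu.mono hPre)
      have h2 := integral_radialWeight_halfSpaceIntegral hfc.measurable hfB hr hPr
      have h3 := HarmonicOnNhd.integral_radialWeight_smul (volume : Measure (AmbientSpace d))
        hr (hbh.mono (Set.subset_univ (Metric.closedBall P r)))
      have hcont1 : ContinuousOn (fun z => ‖u (z + e)‖) (Metric.closedBall P r) :=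
        huc.mono fun x hx => show 0 ≤ x.snd from le_of_lt (hPr hx)
      have i1 := integrable_radialWeight_smul_of_continuousOn volume
        (continuousOn_comp_add_smul hr hcont1)
      have i2 := integrable_radialWeight_smul_of_continuousOn volume
        (continuousOn_comp_add_smul hr (hSc.continuousOn (s := Metric.closedBall P r)))
      have i3 := integrable_radialWeight_smul_of_continuousOn volume
        (continuousOn_comp_add_smul hr (hbc.continuousOn (s := Metric.closedBall P r)))
      have h2' : ∫ y, radialWeight y * S (P + r • y) =
          (∫ y : AmbientSpace d, radialWeight y) * S P := by
        rw [← hSeq P (hr.trans hrP), ← smul_eq_mul, ← h2]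
        congr 1; ext y
        by_cases hy : ‖y‖ ≤ 1
        · rw [smul_eq_mul, hSeq]
          refine hPr ?_
          rw [mem_closedBall_iff_norm, add_sub_cancel_left, norm_smul, Real.norm_of_nonneg hr.le]
          nlinarith
        · simp [radialWeight_eq_zero (not_le.1 hy).le]
      simp only [smul_eq_mul] at i1 i2 i3 h3
      have hsplit : ∀ y, radialWeight y * (c * ‖u (P + r • y + e)‖ - S (P + r • y) -
          c * B * R⁻¹ ^ 2 * b (P + r • y)) = c * (radialWeight y * ‖u (P + r • y + e)‖) -
            radialWeight y * S (P + r • y) -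
            c * B * R⁻¹ ^ 2 * (radialWeight y * b (P + r • y)) := fun y => by ring
      simp_rw [hsplit]
      have i12 : Integrable fun y => c * (radialWeight y * ‖u (P + r • y + e)‖) -
          radialWeight y * S (P + r • y) := (i1.const_mul c).sub i2
      rw [integral_sub i12 (i3.const_mul _), integral_sub (i1.const_mul c) i2,
        integral_const_mul, integral_const_mul, h2', h3]
      have h4 : ∀ y, P + e + r • y = P + r • y + e := fun y => by abel
      simp_rw [h4] at h1
      have h5 := mul_le_mul_of_nonneg_left h1 hc.le
      linarith
    · intro z hz0
      have h1 : z + e = WithLp.toLp 2 (z.fst, ε) := by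
        apply WithLp.ofLp_injective
        refine Prod.ext ?_ ?_
        · change z.fst + (0 : EuclideanSpace ℝ (Fin d)) = z.fst
          rw [add_zero]
        · change z.snd + ε = ε
          rw [hz0, zero_add]
      have h2 : S z = c * f z.fst := by
        simp only [hS, hz0, zero_smul, sub_zero]
        rw [integral_mul_const, hcdef, halfSpaceKernelMass]
      have h3 : 0 ≤ b z := by rw [hb', hz0]; simp
      simp only [h1, h2, hf]
      have : 0 ≤ c * B * R⁻¹ ^ 2 * b z := by positivity
      linarith
    · intro z hz1 hz2
      refine hbound z (by rw [hz2]; exact hR.le) (hR2b _ ?_)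
      rw [hb', hz2]
      nlinarith [norm_nonneg z.fst]
    · intro z hz1 hz2 hz3
      refine hbound z hz2 (hR2b _ ?_)
      rw [hb', hz1]
      have hd : (0 : ℝ) ≤ d := Nat.cast_nonneg d
      have : 0 ≤ z.snd * ((d + 1) * R - d * z.snd) := mul_nonneg hz2 (by nlinarith)
      linarith
  -- At a fixed point the barrier grows only linearly in `R`, so after division by `R ^ 2` it
  -- disappears in the limit.
  have hlim : Tendsto (fun R : ℝ => c * ‖u (z + e)‖ - S z - c * B * R⁻¹ ^ 2 *
        (‖z‖ ^ 2 - (d + 1) * z.snd ^ 2 + (d + 1) * R * z.snd)) atTop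
      (𝓝 (c * ‖u (z + e)‖ - S z - (c * B * 0 ^ 2 * (‖z‖ ^ 2 - (d + 1) * z.snd ^ 2) +
        c * B * (d + 1) * z.snd * 0))) := by
    have h0 : Tendsto (fun R : ℝ => R⁻¹) atTop (𝓝 0) := tendsto_inv_atTop_zero
    have h1 := (((h0.pow 2).const_mul (c * B)).mul_const (‖z‖ ^ 2 - (d + 1) * z.snd ^ 2)).add
      (h0.const_mul (c * B * (d + 1) * z.snd))
    refine (h1.const_sub (c * ‖u (z + e)‖ - S z)).congr' ?_
    filter_upwards [eventually_gt_atTop 0] with R hR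
    field_simp
  have := le_of_tendsto hlim (by
    filter_upwards [eventually_ge_atTop ‖z.fst‖, eventually_ge_atTop z.snd] with R h1 h2
    exact hmain R h1 h2)
  linarith

end Comparison

/-! ### Sufficiency: from the maximal function to the embedding. -/

section Sufficiency

variable {d : ℕ}

lemma ENNReal.le_one_add_rpow (a : ℝ≥0∞) {p : ℝ} (hp : 1 ≤ p) : a ≤ 1 + a ^ p := by
  rcases le_total a 1 with h | h
  · exact h.trans le_self_add
  · exact (ENNReal.le_rpow_self_of_one_le h hp).trans le_add_self

lemma lintegral_comp_add_smul (g : EuclideanSpace ℝ (Fin d) → ℝ≥0∞) (hg : Measurable g)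
    (a : EuclideanSpace ℝ (Fin d)) {r : ℝ} (hr : r ≠ 0) :
    ∫⁻ x, g (a + r • x) = ENNReal.ofReal |(r ^ d)⁻¹| * ∫⁻ x, g x := by
  have h1 : Measurable fun x => g (a + x) := hg.comp (measurable_const_add a)
  have h2 := lintegral_map (μ := volume) h1 (measurable_const_smul r)
  rw [Measure.map_addHaar_smul _ hr, lintegral_smul_measure, lintegral_add_left_eq_self g a,
    finrank_euclideanSpace, Fintype.card_fin] at h2
  exact h2.symm

lemma lintegral_rpow_le_hardyNorm {p : ℝ} (hp : 0 < p) (u : AmbientSpace d → ℂ) {t : ℝ}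
    (ht : 0 < t) :
    ∫⁻ x : EuclideanSpace ℝ (Fin d), ‖u (WithLp.toLp 2 (x, t))‖ₑ ^ p ≤
      hardyNorm (ENNReal.ofReal p) u ^ p := by
  have h : eLpNorm (fun x : EuclideanSpace ℝ (Fin d) => u (WithLp.toLp 2 (x, t)))
      (ENNReal.ofReal p) volume ≤ hardyNorm (ENNReal.ofReal p) u :=
    le_iSup₂_of_le t ht le_rfl
  rw [eLpNorm_eq_lintegral_rpow_enorm_toReal (by simpa using hp) (by simp),
    ENNReal.toReal_ofReal hp.le] at h
  have h2 := ENNReal.rpow_le_rpow h hp.le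
  rwa [← ENNReal.rpow_mul, one_div_mul_cancel hp.ne', ENNReal.rpow_one] at h2

/-- Functions in the Hardy space are bounded away from the boundary. -/
lemma exists_bound_of_memHardy {p : ℝ} (hp : 1 ≤ p) {u : AmbientSpace d → ℂ}
    (hu : MemHardy (ENNReal.ofReal p) u) {ε : ℝ} (hε : 0 < ε) :
    ∃ B : ℝ, ∀ z : AmbientSpace d, ε ≤ z.snd → ‖u z‖ ≤ B := by
  classical
  have hp0 : 0 < p := by linarith
  set N := hardyNorm (ENNReal.ofReal p) u with hN
  have hNtop : N ≠ ∞ := hu.2.ne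
  set r := ε / 2 with hr
  have hr0 : 0 < r := by positivity
  -- The function `u` is arbitrary outside the half space, so it is cut off there to obtain
  -- measurability.
  set G : AmbientSpace d → ℝ≥0∞ := fun w => ‖(upperHalfSpace d).indicator u w‖ₑ ^ p with hG
  have hGm : Measurable G := by
    have : Measurable ((upperHalfSpace d).indicator u) := by
      rw [← Set.piecewise_eq_indicator]
      exact hu.1.continuousOn.measurable_piecewise continuousOn_const
        isOpen_upperHalfSpace.measurableSet
    exact this.enorm.pow_const p
  obtain ⟨A, hA⟩ := (isCompact_closedBall (0 : AmbientSpace d) 1).exists_bound_of_continuousOn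
    continuous_radialWeight.continuousOn
  have hA0 : 0 ≤ A := (norm_nonneg _).trans (hA 0 (by simp))
  set D := ENNReal.ofReal |(r ^ d)⁻¹| with hD
  -- The slab contains the unit ball and is a product, so Tonelli reduces the integral to horizontal
  -- slices. Each slice lies at positive height, since `r = ε / 2`, and is controlled by the Hardy
  -- norm.
  set slab : Set (AmbientSpace d) := {y | y.snd ∈ Set.Icc (-1 : ℝ) 1} with hslab
  have hslabm : MeasurableSet slab :=
    AmbientSpace.continuous_snd.measurable measurableSet_Icc
  set T : ℝ≥0∞ := ENNReal.ofReal A *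
    (volume (Metric.closedBall (0 : AmbientSpace d) 1) + D * N ^ p * 2) with hT
  have hTtop : T ≠ ∞ := by
    refine ENNReal.mul_ne_top (by simp) (ENNReal.add_ne_top.2 ⟨measure_closedBall_lt_top.ne, ?_⟩)
    refine ENNReal.mul_ne_top (ENNReal.mul_ne_top (by simp [hD])
      (ENNReal.rpow_ne_top_of_nonneg hp0.le hNtop)) (by simp)
  set cφ := ∫ y : AmbientSpace d, radialWeight y with hcφ
  have hcφ0 : 0 < cφ := integral_radialWeight_pos _
  refine ⟨T.toReal / cφ, fun z hz => ?_⟩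
  have hball : Metric.closedBall z r ⊆ upperHalfSpace d := by
    intro x hx
    rw [mem_closedBall_iff_norm] at hx
    have := abs_le.1 ((AmbientSpace.abs_snd_le (x - z)).trans hx)
    rw [WithLp.sub_snd] at this
    change 0 < x.snd
    linarith
  have hmem : ∀ y : AmbientSpace d, ‖y‖ ≤ 1 → z + r • y ∈ Metric.closedBall z r := by
    intro y hy
    rw [mem_closedBall_iff_norm, add_sub_cancel_left, norm_smul, Real.norm_of_nonneg hr0.le]
    nlinarith
  have hmv := HarmonicOnNhd.norm_le_integral_radialWeight (volume : Measure (AmbientSpace d))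
    hr0 (hu.1.mono hball)
  have hint := integrable_radialWeight_smul_of_continuousOn (volume : Measure (AmbientSpace d))
    (continuousOn_comp_add_smul hr0 (hu.1.continuousOn.mono hball).norm)
  simp only [smul_eq_mul] at hint
  have hslabint : ∫⁻ y, slab.indicator (fun y => G (z + r • y)) y ≤ D * N ^ p * 2 := by
    have hm : Measurable (slab.indicator fun y => G (z + r • y)) :=
      (hGm.comp (by fun_prop)).indicator hslabm
    rw [← (WithLp.volume_preserving_toLp (EuclideanSpace ℝ (Fin d)) ℝ).lintegral_comp hm]
    have hm2 : Measurable fun q : EuclideanSpace ℝ (Fin d) × ℝ =>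
        slab.indicator (fun y => G (z + r • y)) (WithLp.toLp 2 q) :=
      hm.comp continuous_toLp.measurable
    change ∫⁻ q : EuclideanSpace ℝ (Fin d) × ℝ,
      slab.indicator (fun y => G (z + r • y)) (WithLp.toLp 2 q) ∂(volume.prod volume) ≤ _
    rw [lintegral_prod_symm _ hm2.aemeasurable]
    calc ∫⁻ s : ℝ, ∫⁻ x : EuclideanSpace ℝ (Fin d),
          slab.indicator (fun y => G (z + r • y)) (WithLp.toLp 2 (x, s))
        ≤ ∫⁻ s : ℝ, (Set.Icc (-1 : ℝ) 1).indicator (fun _ => D * N ^ p) s := by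
          refine lintegral_mono fun s => ?_
          by_cases hs : s ∈ Set.Icc (-1 : ℝ) 1
          · rw [Set.indicator_of_mem hs]
            have hs' : 0 < z.snd + r * s := by nlinarith [hs.1]
            set g : EuclideanSpace ℝ (Fin d) → ℝ≥0∞ := fun x =>
              G (WithLp.toLp 2 (x, z.snd + r * s)) with hg
            have hgm : Measurable g := hGm.comp (continuous_toLp.measurable.comp (by fun_prop))
            have h1 : ∀ x : EuclideanSpace ℝ (Fin d),
                slab.indicator (fun y => G (z + r • y)) (WithLp.toLp 2 (x, s)) =
                  g (z.fst + r • x) := by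
              intro x
              rw [Set.indicator_of_mem (show (WithLp.toLp 2 (x, s) : AmbientSpace d) ∈ slab from hs)]
              rfl
            simp_rw [h1]
            rw [lintegral_comp_add_smul g hgm _ hr0.ne']
            gcongr
            refine le_trans (le_of_eq ?_) (lintegral_rpow_le_hardyNorm hp0 u hs')
            refine lintegral_congr fun x => ?_
            rw [hg]
            simp only [hG]
            rw [Set.indicator_of_mem (show (WithLp.toLp 2 (x, z.snd + r * s) : AmbientSpace d) ∈
              upperHalfSpace d from hs')]
          · rw [Set.indicator_of_notMem hs]
            have h1 : ∀ x : EuclideanSpace ℝ (Fin d),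
                slab.indicator (fun y => G (z + r • y)) (WithLp.toLp 2 (x, s)) = 0 := fun x =>
              Set.indicator_of_notMem
                (show (WithLp.toLp 2 (x, s) : AmbientSpace d) ∉ slab from hs) _
            simp [h1]
      _ = D * N ^ p * 2 := by
          rw [lintegral_indicator_const measurableSet_Icc, Real.volume_Icc]
          norm_num
  have hle : ENNReal.ofReal (∫ y, radialWeight y * ‖u (z + r • y)‖) ≤ T := by
    rw [ofReal_integral_eq_lintegral_ofReal hint
      (Eventually.of_forall fun y => mul_nonneg (radialWeight_nonneg y) (norm_nonneg _))]
    have hpt : ∀ y : AmbientSpace d, ENNReal.ofReal (radialWeight y * ‖u (z + r • y)‖) ≤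
        ENNReal.ofReal A * ((Metric.closedBall (0 : AmbientSpace d) 1).indicator 1 y +
          slab.indicator (fun y => G (z + r • y)) y) := by
      intro y
      by_cases hy : ‖y‖ ≤ 1
      · have hyb : y ∈ Metric.closedBall (0 : AmbientSpace d) 1 := by simpa using hy
        have hys : y ∈ slab := abs_le.1 ((AmbientSpace.abs_snd_le y).trans hy)
        rw [ENNReal.ofReal_mul (radialWeight_nonneg y), Set.indicator_of_mem hyb,
          Set.indicator_of_mem hys]
        gcongr
        · exact (le_abs_self _).trans (hA y hyb)
        · simp only [hG, Pi.one_apply]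
          rw [Set.indicator_of_mem (hball (hmem y hy)), ofReal_norm]
          exact ENNReal.le_one_add_rpow _ hp
      · simp [radialWeight_eq_zero (not_le.1 hy).le]
    refine (lintegral_mono hpt).trans ?_
    rw [lintegral_const_mul' _ _ (by simp), lintegral_add_left
      (measurable_one.indicator Metric.isClosed_closedBall.measurableSet),
      lintegral_indicator_one Metric.isClosed_closedBall.measurableSet, hT]
    gcongr
  rw [le_div_iff₀ hcφ0, mul_comm]
  refine hmv.trans ?_
  rwa [← ENNReal.ofReal_le_iff_le_toReal hTtop]

/-- The measure of a tent over an open set of finite measure is controlled by the integral of the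
Fefferman-Stein maximal function. -/
lemma exists_measure_tent_le (hd : 1 ≤ d) : ∃ C : ℝ≥0, ∀ (μ : Measure (upperHalfSpace d))
    (O : Set (EuclideanSpace ℝ (Fin d))), volume O ≠ ∞ →
      μ (tent O) ≤ C * ∫⁻ x in O, feffermanSteinMaximal μ x := by
  set V := volume (Metric.ball (0 : EuclideanSpace ℝ (Fin d)) 1) with hVdef
  have hV : V ≠ ∞ := measure_ball_lt_top.ne
  have hV0 : V ≠ 0 := (Metric.measure_ball_pos _ _ one_pos).ne'
  have hCtop : (10 : ℝ≥0∞) ^ d / V ≠ ∞ := ENNReal.div_ne_top (by simp) hV0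
  refine ⟨((10 : ℝ≥0∞) ^ d / V).toNNReal, fun μ O hO => ?_⟩
  rw [ENNReal.coe_toNNReal hCtop]
  set ψ := feffermanSteinMaximal μ
  -- Vitali's lemma needs bounded radii. A ball contained in `O` has volume at most that of `O`, and
  -- for radius at least `1` the radius is at most its `d`-th power; this uses `1 ≤ d`.
  have hrad : ∀ z ∈ tent O, z.1.snd ≤ max 1 ((volume O / V).toReal) := by
    intro z hz
    rcases le_total z.1.snd 1 with h | h
    · exact h.trans (le_max_left _ _)
    refine le_trans ?_ (le_max_right _ _)
    have hz0 : 0 < z.1.snd := z.2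
    have h1 := measure_mono (μ := volume) (mem_tent_iff.1 hz)
    rw [volume_ball_eq _ hz0, ← ENNReal.le_div_iff_mul_le (Or.inl hV0) (Or.inl hV),
      ENNReal.ofReal_le_iff_le_toReal (ENNReal.div_ne_top hO hV0)] at h1
    exact (le_self_pow₀ h (by omega)).trans h1
  obtain ⟨u, hut, hdisj, hu⟩ := Vitali.exists_disjoint_subfamily_covering_enlargement
    (fun z : upperHalfSpace d => Metric.ball z.1.fst z.1.snd) (tent O) (fun z => z.1.snd) 2
    one_lt_two (fun z _ => le_of_lt z.2) _ hrad (fun z _ => Metric.nonempty_ball.2 z.2)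
  have hcount : u.Countable := hdisj.countable_of_isOpen (fun z _ => Metric.isOpen_ball)
    (fun z _ => Metric.nonempty_ball.2 z.2)
  -- The cube of side `10 t` circumscribes the fivefold enlargement of the ball of radius `t`, which
  -- contains every ball of the family that this one represents in the covering.
  set Q : upperHalfSpace d → Set (EuclideanSpace ℝ (Fin d)) := fun z =>
    openCube (WithLp.toLp 2 fun i => z.1.fst i - 5 * z.1.snd) (10 * z.1.snd) with hQ
  have hballQ : ∀ z : upperHalfSpace d, Metric.ball z.1.fst (5 * z.1.snd) ⊆ Q z := by
    intro z x hx i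
    have h1 : |x i - z.1.fst i| ≤ ‖x - z.1.fst‖ := by
      simpa using PiLp.norm_apply_le (x - z.1.fst) i
    rw [mem_ball_iff_norm] at hx
    have h2 := abs_lt.1 (h1.trans_lt hx)
    constructor
    · simp only; linarith
    · simp only; linarith
  have hcover : tent O ⊆ ⋃ z ∈ u, tent (Q z) := by
    intro z hz
    obtain ⟨z', hz'u, hne, hle⟩ := hu z hz
    exact Set.mem_iUnion₂.2 ⟨z', hz'u, mem_tent_iff.2
      ((ball_subset_enlargement hne hle).trans (hballQ z'))⟩
  -- The quotient `μ (T Q) / |Q|` bounds `ψ` from below at every point of `Q`; averaging over the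
  -- concentric ball, of comparable volume, gives the integral. Disjointness of the balls then
  -- allows summation.
  have hone : ∀ z : upperHalfSpace d, μ (tent (Q z)) ≤
      (10 : ℝ≥0∞) ^ d / V * ∫⁻ x in Metric.ball z.1.fst z.1.snd, ψ x := by
    intro z
    have hz0 : 0 < z.1.snd := z.2
    have h1 : ∀ x ∈ Metric.ball z.1.fst z.1.snd, μ (tent (Q z)) ≤ volume (Q z) * ψ x := by
      intro x hx
      rw [mul_comm]
      refine measure_tent_le_feffermanSteinMaximal_mul μ (by positivity) (hballQ z ?_)
      exact Metric.ball_subset_ball (by linarith) hx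
    have h2 : μ (tent (Q z)) * volume (Metric.ball z.1.fst z.1.snd) ≤
        volume (Q z) * ∫⁻ x in Metric.ball z.1.fst z.1.snd, ψ x := by
      rw [← setLIntegral_const, ← lintegral_const_mul' _ _ (volume_openCube_ne_top _ _)]
      exact setLIntegral_mono' Metric.isOpen_ball.measurableSet h1
    set s := ENNReal.ofReal (z.1.snd ^ d) with hs
    have hs0 : s ≠ 0 := by rw [hs]; simpa using pow_pos hz0 d
    have hst : s ≠ ∞ := by simp [hs]
    have hvQ : volume (Q z) = 10 ^ d * s := by
      rw [hQ, volume_openCube, ENNReal.ofReal_mul (by norm_num), mul_pow, hs,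
        ENNReal.ofReal_pow hz0.le]
      norm_num
    rw [volume_ball_eq _ hz0, hvQ, ← hs, ← hVdef] at h2
    have h3 : s * (μ (tent (Q z)) * V) ≤
        s * (10 ^ d * ∫⁻ x in Metric.ball z.1.fst z.1.snd, ψ x) := by
      calc _ = μ (tent (Q z)) * (s * V) := by ring
        _ ≤ _ := h2
        _ = _ := by ring
    have h4 := (ENNReal.mul_le_mul_iff_right hs0 hst).1 h3
    rw [ENNReal.div_eq_inv_mul, mul_assoc, ← ENNReal.div_eq_inv_mul,
      ENNReal.le_div_iff_mul_le (Or.inl hV0) (Or.inl hV)]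
    exact h4
  calc μ (tent O) ≤ μ (⋃ z ∈ u, tent (Q z)) := measure_mono hcover
    _ ≤ ∑' z : u, μ (tent (Q z)) := measure_biUnion_le μ hcount _
    _ ≤ ∑' z : u, (10 : ℝ≥0∞) ^ d / V *
          ∫⁻ x in Metric.ball z.1.1.fst z.1.1.snd, ψ x := ENNReal.tsum_le_tsum fun z => hone z
    _ = (10 : ℝ≥0∞) ^ d / V *
          ∫⁻ x in ⋃ z ∈ u, Metric.ball z.1.fst z.1.snd, ψ x := by
        rw [ENNReal.tsum_mul_left, lintegral_biUnion hcount
          (fun z _ => Metric.isOpen_ball.measurableSet) hdisj]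
    _ ≤ (10 : ℝ≥0∞) ^ d / V * ∫⁻ x in O, ψ x := by
        gcongr
        exact Set.iUnion₂_subset fun z hz => mem_tent_iff.1 (hut hz)

/-- The embedding inequality for the translates `u(·, · + ε)`. -/
lemma exists_lintegral_translate_le (hd : 1 ≤ d) {α β q : ℝ} (hα : 1 < α)
    (hαβ : 1 / α + 1 / β = 1) (hq : 1 ≤ q) {μ : Measure (upperHalfSpace d)}
    (hψ : MemLp (feffermanSteinMaximal μ) (ENNReal.ofReal β) volume) :
    ∃ C : ℝ≥0, ∀ u : AmbientSpace d → ℂ, MemHardy (ENNReal.ofReal (α * q)) u → ∀ ε : ℝ, 0 < ε →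
      ∫⁻ z : upperHalfSpace d, ‖u ((z : AmbientSpace d) + WithLp.toLp 2 (0, ε))‖ₑ ^ q ∂μ ≤
        C * hardyNorm (ENNReal.ofReal (α * q)) u ^ q := by
  have hα0 : 0 < α := by linarith
  have hq0 : 0 < q := by linarith
  have hp1 : 1 < α * q := by nlinarith
  have hp0 : 0 < α * q := by linarith
  have hβ0 : 0 < β := by
    have h1 : 1 / α < 1 := by rw [div_lt_one hα0]; exact hα
    have h2 : 0 < 1 / β := by linarith
    simpa using h2
  have hconj : β.HolderConjugate α := by
    rw [Real.holderConjugate_iff]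
    refine ⟨?_, by simpa [add_comm] using hαβ⟩
    have h1 : 0 < 1 / α := by positivity
    have h2 : 1 / β < 1 := by linarith
    rwa [div_lt_one hβ0] at h2
  set ψ := feffermanSteinMaximal μ with hψdef
  have hψm : Measurable ψ := measurable_feffermanSteinMaximal μ
  set Ψ := ∫⁻ x, ψ x ^ β with hΨ
  have hΨtop : Ψ ≠ ∞ := by
    have h := hψ.2
    rw [eLpNorm_eq_lintegral_rpow_enorm_toReal (by simpa using hβ0) (by simp),
      ENNReal.toReal_ofReal hβ0.le, ENNReal.rpow_lt_top_iff_of_pos (by positivity)] at h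
    exact h.ne
  obtain ⟨C₁, hC₁⟩ := exists_lintegral_halfSpaceKernel_mul_le d
  obtain ⟨C₃, hC₃⟩ := exists_measure_tent_le hd
  set c := ENNReal.ofReal (halfSpaceKernelMass d) with hc
  have hc0 : c ≠ 0 := by simpa [hc] using halfSpaceKernelMass_pos
  set C₂ : ℝ≥0∞ := C₁ / c with hC₂
  have hC₂top : C₂ ≠ ∞ := ENNReal.div_ne_top ENNReal.coe_ne_top hc0
  set C₄ : ℝ≥0∞ := ENNReal.ofReal (α * q / (α * q - 1)) * (5 ^ d * 2 ^ (α * q)) with hC₄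
  have hC₄top : C₄ ≠ ∞ := by
    refine ENNReal.mul_ne_top (by simp) (ENNReal.mul_ne_top (by simp) ?_)
    exact ENNReal.rpow_ne_top_of_nonneg hp0.le (by simp)
  set C : ℝ≥0∞ := C₃ * (Ψ ^ (1 / β) * (C₂ ^ (α * q) * C₄) ^ (1 / α)) with hCdef
  have hCtop : C ≠ ∞ := by
    refine ENNReal.mul_ne_top ENNReal.coe_ne_top (ENNReal.mul_ne_top
      (ENNReal.rpow_ne_top_of_nonneg (by positivity) hΨtop)
      (ENNReal.rpow_ne_top_of_nonneg (by positivity) (ENNReal.mul_ne_top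
        (ENNReal.rpow_ne_top_of_nonneg hp0.le hC₂top) hC₄top)))
  refine ⟨C.toNNReal, fun u hu ε hε => ?_⟩
  rw [ENNReal.coe_toNNReal hCtop]
  set N := hardyNorm (ENNReal.ofReal (α * q)) u with hN
  obtain ⟨B, hB⟩ := exists_bound_of_memHardy hp1.le hu hε
  set f : EuclideanSpace ℝ (Fin d) → ℝ := fun x => ‖u (WithLp.toLp 2 (x, ε))‖ with hf
  have hfc : Continuous f :=
    (hu.1.continuousOn.comp_continuous (f := fun x => WithLp.toLp 2 (x, ε))
      (continuous_toLp.comp (by fun_prop)) fun x => hε).norm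
  set F : EuclideanSpace ℝ (Fin d) → ℝ≥0∞ := fun x => ‖f x‖ₑ with hF
  have hFm : Measurable F := hfc.measurable.enorm
  have hFB : ∀ x, F x ≤ (B.toNNReal : ℝ≥0∞) := by
    intro x
    have h1 : F x = ENNReal.ofReal (f x) := Real.enorm_of_nonneg (norm_nonneg _)
    rw [h1]
    exact ENNReal.ofReal_le_ofReal (hB _ le_rfl)
  have hFp : ∫⁻ x, F x ^ (α * q) ≤ N ^ (α * q) := by
    refine le_trans (le_of_eq ?_) (lintegral_rpow_le_hardyNorm hp0 u hε)
    simp [hF, hf]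
  set g : EuclideanSpace ℝ (Fin d) → ℝ≥0∞ := fun x => C₂ * hardyLittlewoodMaximal F x with hg
  have hgm : Measurable g := (measurable_hardyLittlewoodMaximal F).const_mul _
  have hgtop : ∀ x, g x ≠ ∞ := fun x => ENNReal.mul_ne_top hC₂top
    (ne_top_of_le_ne_top ENNReal.coe_ne_top (hardyLittlewoodMaximal_le hFB x))
  have hgp : ∫⁻ x, g x ^ (α * q) ≤ C₂ ^ (α * q) * C₄ * N ^ (α * q) := by
    simp only [hg, ENNReal.mul_rpow_of_nonneg _ _ hp0.le]
    rw [lintegral_const_mul' _ _ (ENNReal.rpow_ne_top_of_nonneg hp0.le hC₂top), mul_assoc]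
    gcongr
    exact (lintegral_hardyLittlewoodMaximal_rpow_le hp1 hFm hFB).trans (by gcongr)
  set U : upperHalfSpace d → ℝ≥0∞ := fun z => ‖u ((z : AmbientSpace d) + WithLp.toLp 2 (0, ε))‖ₑ with hU
  have hupper : ∀ z : upperHalfSpace d,
      (z : AmbientSpace d) + WithLp.toLp 2 (0, ε) ∈ upperHalfSpace d := by
    intro z
    have hz : 0 < z.1.snd := z.2
    change 0 < z.1.snd + ε
    linarith
  have hUm : Measurable U := by
    refine Measurable.enorm (Continuous.measurable ?_)
    exact hu.1.continuousOn.comp_continuous (by fun_prop) hupper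
  -- The maximal function is taken at an arbitrary `x` whose cone contains `z`, not only at the foot
  -- of `z`; this is what places the superlevel sets of `U` inside tents.
  have hcone : ∀ (z : upperHalfSpace d), ∀ x ∈ Metric.ball z.1.fst z.1.snd, U z ≤ g x := by
    intro z x hx
    have hz : 0 < z.1.snd := z.2
    have h1 := norm_le_halfSpaceIntegral hu.1 hε hB hz
    have h2 : c * U z ≤ C₁ * hardyLittlewoodMaximal F x := by
      calc c * U z = ENNReal.ofReal
            (halfSpaceKernelMass d * ‖u ((z : AmbientSpace d) + WithLp.toLp 2 (0, ε))‖) := by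
            rw [ENNReal.ofReal_mul halfSpaceKernelMass_pos.le, ofReal_norm]
        _ ≤ ENNReal.ofReal (halfSpaceIntegral f z) := ENNReal.ofReal_le_ofReal h1
        _ ≤ ‖halfSpaceIntegral f z‖ₑ := Real.ofReal_le_enorm _
        _ ≤ _ := enorm_halfSpaceIntegral_le f z.1.fst hz
        _ ≤ _ := hC₁ F hFm x z.1.fst z.1.snd hx
    simp only [hg, hC₂]
    rw [ENNReal.div_eq_inv_mul, mul_assoc, ← ENNReal.div_eq_inv_mul,
      ENNReal.le_div_iff_mul_le (Or.inl hc0) (Or.inl (by simp [hc])), mul_comm]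
    exact h2
  rcases eq_or_ne N ∞ with hNtop | hNtop
  · exact absurd hNtop hu.2.ne
  set ν : Measure (EuclideanSpace ℝ (Fin d)) := volume.withDensity ψ with hν
  have hlevel : ∀ t : ℝ, 0 < t → μ {z | ENNReal.ofReal t < U z} ≤
      C₃ * ν {x | ENNReal.ofReal t < g x} := by
    intro t ht
    set O := {x | ENNReal.ofReal t < g x} with hO
    have hOm : MeasurableSet O := measurableSet_lt measurable_const hgm
    -- Chebyshev's inequality in `L ^ (α q)`; finite volume is the hypothesis of the tent estimate.
    have hOfin : volume O ≠ ∞ := by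
      have ht0 : ENNReal.ofReal t ^ (α * q) ≠ 0 := by
        simp [ENNReal.rpow_eq_zero_iff, ht]
      have httop : ENNReal.ofReal t ^ (α * q) ≠ ∞ :=
        ENNReal.rpow_ne_top_of_nonneg hp0.le (by simp)
      have h1 := meas_ge_le_lintegral_div (μ := volume) (f := fun x => g x ^ (α * q))
        (hgm.pow_const _).aemeasurable ht0 httop
      refine ne_top_of_le_ne_top ?_ ((measure_mono fun x hx => ?_).trans h1)
      · refine ENNReal.div_ne_top (ne_top_of_le_ne_top ?_ hgp) ht0
        exact ENNReal.mul_ne_top (ENNReal.mul_ne_top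
          (ENNReal.rpow_ne_top_of_nonneg hp0.le hC₂top) hC₄top)
          (ENNReal.rpow_ne_top_of_nonneg hp0.le hNtop)
      · exact ENNReal.rpow_le_rpow (le_of_lt hx) hp0.le
    have hsub : {z | ENNReal.ofReal t < U z} ⊆ tent O := fun z hz =>
      mem_tent_iff.2 fun x hx => lt_of_lt_of_le hz (hcone z x hx)
    rw [hν, withDensity_apply _ hOm]
    exact (measure_mono hsub).trans (hC₃ μ O hOfin)
  calc ∫⁻ z, U z ^ q ∂μ
      = ENNReal.ofReal q * ∫⁻ t in Set.Ioi (0 : ℝ), μ {z | ENNReal.ofReal t < U z} *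
          ENNReal.ofReal (t ^ (q - 1)) :=
        lintegral_rpow_eq_lintegral_meas_ofReal_lt_mul μ hUm (fun z => by simp [hU]) hq0
    _ ≤ ENNReal.ofReal q * ∫⁻ t in Set.Ioi (0 : ℝ), C₃ * (ν {x | ENNReal.ofReal t < g x} *
          ENNReal.ofReal (t ^ (q - 1))) := by
        gcongr ENNReal.ofReal q * ?_
        refine setLIntegral_mono' measurableSet_Ioi fun t ht => ?_
        rw [← mul_assoc]
        gcongr
        exact hlevel t ht
    _ = C₃ * ∫⁻ x, g x ^ q ∂ν := by
        rw [lintegral_const_mul' _ _ ENNReal.coe_ne_top,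
          lintegral_rpow_eq_lintegral_meas_ofReal_lt_mul ν hgm hgtop hq0]
        ring
    _ = C₃ * ∫⁻ x, ψ x * g x ^ q := by
        rw [hν, lintegral_withDensity_eq_lintegral_mul _ hψm (hgm.pow_const q)]
        rfl
    _ ≤ C₃ * (Ψ ^ (1 / β) * (∫⁻ x, (g x ^ q) ^ α) ^ (1 / α)) := by
        gcongr
        exact ENNReal.lintegral_mul_le_Lp_mul_Lq volume hconj hψm.aemeasurable
          (hgm.pow_const q).aemeasurable
    _ ≤ C₃ * (Ψ ^ (1 / β) * (C₂ ^ (α * q) * C₄ * N ^ (α * q)) ^ (1 / α)) := by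
        simp_rw [← ENNReal.rpow_mul, mul_comm q α]
        gcongr
    _ = C * N ^ q := by
        rw [ENNReal.mul_rpow_of_nonneg _ (N ^ (α * q)) (by positivity), ← ENNReal.rpow_mul N,
          mul_one_div, mul_div_cancel_left₀ _ hα0.ne', hCdef]
        ring

/-- The constant for the translates does not depend on `ε`, and `u` is continuous in the half space,
so Fatou's lemma along `ε = 1 / (n + 1)` transfers the inequality to `u` without any boundary
values. -/
theorem isEmbeddingCarleson_of_memLp_feffermanSteinMaximal (hd : 1 ≤ d) {α β q : ℝ} (hα : 1 < α)
    (hαβ : 1 / α + 1 / β = 1) (hq : 1 ≤ q) {μ : Measure (upperHalfSpace d)}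
    (hψ : MemLp (feffermanSteinMaximal μ) (ENNReal.ofReal β) volume) :
    IsEmbeddingCarleson α q μ := by
  have hq0 : 0 < q := by linarith
  obtain ⟨C, hC⟩ := exists_lintegral_translate_le hd hα hαβ hq hψ
  have hCtop : (C : ℝ≥0∞) ^ (1 / q) ≠ ∞ :=
    ENNReal.rpow_ne_top_of_nonneg (by positivity) ENNReal.coe_ne_top
  refine ⟨((C : ℝ≥0∞) ^ (1 / q)).toNNReal, fun u hu => ?_⟩
  rw [ENNReal.coe_toNNReal hCtop, eLpNorm_eq_lintegral_rpow_enorm_toReal (by simpa using hq0)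
    (by simp), ENNReal.toReal_ofReal hq0.le]
  set N := hardyNorm (ENNReal.ofReal (α * q)) u with hN
  set δ : ℕ → ℝ := fun n => 1 / ((n : ℝ) + 1) with hδ
  have hδ0 : ∀ n, 0 < δ n := fun n => by positivity
  have hδlim : Tendsto δ atTop (𝓝 0) := tendsto_one_div_add_atTop_nhds_zero_nat
  set U : ℕ → upperHalfSpace d → ℝ≥0∞ := fun n z =>
    ‖u ((z : AmbientSpace d) + WithLp.toLp 2 (0, δ n))‖ₑ ^ q with hU
  have hUm : ∀ n, Measurable (U n) := by
    intro n
    refine Measurable.pow_const (Measurable.enorm (Continuous.measurable ?_)) q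
    refine hu.1.continuousOn.comp_continuous (by fun_prop) fun z => ?_
    have hz : 0 < z.1.snd := z.2
    change 0 < z.1.snd + δ n
    linarith [hδ0 n]
  have hlim : ∀ z : upperHalfSpace d, Tendsto (fun n => U n z) atTop (𝓝 (‖u z‖ₑ ^ q)) := by
    intro z
    have h1 : Tendsto (fun n => (z : AmbientSpace d) +
          (WithLp.toLp 2 ((0 : EuclideanSpace ℝ (Fin d)), δ n) : AmbientSpace d)) atTop
        (𝓝 ((z : AmbientSpace d) +
          (WithLp.toLp 2 ((0 : EuclideanSpace ℝ (Fin d)), (0 : ℝ)) : AmbientSpace d))) :=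
      tendsto_const_nhds.add ((continuous_toLp.tendsto (0, 0)).comp
        (tendsto_const_nhds.prodMk_nhds hδlim))
    have h0 : (z : AmbientSpace d) +
        (WithLp.toLp 2 ((0 : EuclideanSpace ℝ (Fin d)), (0 : ℝ)) : AmbientSpace d) = z := by
      have : (WithLp.toLp 2 ((0 : EuclideanSpace ℝ (Fin d)), (0 : ℝ)) : AmbientSpace d) = 0 := rfl
      rw [this, add_zero]
    rw [h0] at h1
    have h2 : ContinuousAt u z :=
      hu.1.continuousOn.continuousAt (isOpen_upperHalfSpace.mem_nhds z.2)
    exact (ENNReal.continuous_rpow_const.tendsto _).comp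
      ((continuous_enorm.tendsto _).comp (h2.tendsto.comp h1))
  have hfatou : ∫⁻ z : upperHalfSpace d, ‖u z‖ₑ ^ q ∂μ ≤ C * N ^ q := by
    calc ∫⁻ z : upperHalfSpace d, ‖u z‖ₑ ^ q ∂μ
        = ∫⁻ z, liminf (fun n => U n z) atTop ∂μ :=
          lintegral_congr fun z => (hlim z).liminf_eq.symm
      _ ≤ liminf (fun n => ∫⁻ z, U n z ∂μ) atTop := lintegral_liminf_le hUm
      _ ≤ C * N ^ q := by
          refine liminf_le_of_le (by isBoundedDefault) fun b hb => ?_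
          obtain ⟨n, hn⟩ := hb.exists
          exact hn.trans (hC u hu (δ n) (hδ0 n))
  calc (∫⁻ z : upperHalfSpace d, ‖u z‖ₑ ^ q ∂μ) ^ (1 / q) ≤ (C * N ^ q) ^ (1 / q) := by gcongr
    _ = (C : ℝ≥0∞) ^ (1 / q) * N := by
        rw [ENNReal.mul_rpow_of_nonneg _ _ (by positivity), ← ENNReal.rpow_mul,
          mul_one_div_cancel hq0.ne', ENNReal.rpow_one]

end Sufficiency

theorem mainTheorem6 (d : ℕ) (hd : 1 ≤ d) (α β : ℝ) (hα : 1 < α) (hαβ : 1 / α + 1 / β = 1)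
    (q : ℝ) (hq : 1 ≤ q) (μ : Measure (upperHalfSpace d)) :
    IsEmbeddingCarleson α q μ ↔
      MemLp (feffermanSteinMaximal μ) (ENNReal.ofReal β) volume :=
  ⟨memLp_feffermanSteinMaximal_of_isEmbeddingCarleson hα hαβ hq,
    isEmbeddingCarleson_of_memLp_feffermanSteinMaximal hd hα hαβ hq⟩
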